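/- **Setting.** Let $1\le n_1\le n_2$, and let $\mathbb R^{n_1\times n_2}$ carry the trace inner product $\langle\cdot,\cdot\rangle$ and the Frobenius norm $\|\cdot\|_F$; $\|\cdot\|$ is the spectral norm, $\|\cdot\|_*$ the nuclear norm, $\sigma_1(X)\ge\dots\ge\sigma_{n_1}(X)$ are the singular values of $X$, and for $w\in\mathbb R^{n_1}$, $[\mathrm{Diag}(w)\ \,0]$ is the $n_1\times n_2$ matrix with diagonal $w$. Let $\mathcal A X=(\langle A_1,X\rangle,\dots,\langle A_m,X\rangle)$ with $A_i\in\mathbb R^{n_1\times n_2}$, let $\Omega\subset\mathbb R^{n_1\times n_2}$ be compact and convex, let $\overline X\in\Omega$ have rank $r\ge1$, and let $b=\mathcal A\overline X+\xi$ with $\|\xi\|\le\delta$, $\delta>0$. For a positive integer $k$ let $$\vartheta_+(k)=\sup_{0<\mathrm{rank}(X)\le k}\frac{\langle X,\mathcal A^*\mathcal A X\rangle}{\|X\|_F^2},\qquad \vartheta_-(k)=\inf_{0<\mathrm{rank}(X)\le k}\frac{\langle X,\mathcal A^*\mathcal A X\rangle}{\|X\|_F^2}.$$ Let $\phi:\mathbb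 R\to(-\infty,+\infty]$ be closed, proper and convex with $\mathrm{int}(\mathrm{dom}\,\phi)\supseteq[0,1]$, with minimum over $[0,1]$ equal to $0$ and attained only at points $<1$. Put $\psi=\phi$ on $[0,1]$, $\psi=+\infty$ elsewhere; $\psi^*$ is its conjugate, with subdifferential $\partial\psi^*$ and one-sided derivatives $(\psi^*)'_\pm$. **Algorithm.** Set $W^0=0$. Given numbers $\rho_1>0$, $\mu_k\ge1$ and $\rho_k=\mu_k\rho_{k-1}$ for $k\ge2$, for $k=1,2,\dots$ let $$X^k\in\arg\min_X\{\|X\|_*-\langle W^{k-1},X\rangle:\ \|\mathcal A X-b\|\le\delta,\ X\in\Omega\},$$ and let $W^k$ be a solution of $\min_{\|W\|\le1}\{\sum_{i=1}^{n_1}\phi(\sigma_i(W))-\rho_k\langle W,X^k\rangle\}$ of the form $W^k=U^k[\mathrm{Diag}(w^k_1,\dots,w^k_{n_1})\ \,0](V^k)^{\mathbb T}$, where $X^k=U^k[\mathrm{Diag}(\sigma(X^k))\ \,0](V^k)^{\mathbb T}$ is a singular value decomposition and $w_i^k\in\partial\psi^*(\rho_k\sigma_i(X^k))$. **Restricted eigenvalue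 assumption.** $c\in[0,\sqrt2)$ is a constant and $s\ge1$ an integer with $2r+2s\le n_1$, such that $\vartheta_-(2r+2s)>0$ and $\dfrac{\vartheta_+(s)}{\vartheta_-(2r+2s)}\le1+\dfrac{2c^2s}{r}$. **Notation.** For $ct<1$ put $$\Xi(t)=\frac{2\delta\sqrt{\vartheta_+(2r+s)}}{\vartheta_-(2r+s)}\cdot\frac1{1-ct}\sqrt{1+\frac{rt^2}{2s}}.$$ Let $\overline U_1,\overline V_1$ be formed by the first $r$ left and right singular vectors in a singular value decomposition of $\overline X$, let $\mathcal T=\{Z:\ Z=\overline U_1\overline U_1^{\mathbb T}Z+Z\overline V_1\overline V_1^{\mathbb T}-\overline U_1\overline U_1^{\mathbb T}Z\overline V_1\overline V_1^{\mathbb T}\}$, and let $$\gamma_0=\frac{\|\mathcal P_{\mathcal T}(W^0-\overline U_1\overline V_1^{\mathbb T})\|_F}{\sqrt{2r}\,(1-\|\mathcal P_{\mathcal T^\perp}(W^0)\|)}\quad\Big(=\tfrac1{\sqrt2}\Big).$$ Put $\widetilde\gamma_0=\gamma_0$ and, for $k\ge1$, $$\widetilde a_k=(\psi^*)'_+[\rho_k\Xi(\widetilde\gamma_{k-1})],\quad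 \widetilde b_k=(\psi^*)'_-[\rho_k(\sigma_r(\overline X)-\Xi(\widetilde\gamma_{k-1}))],\quad \widetilde\beta_k=-\tfrac1{\sqrt2}\ln\Big[1-\frac{\sqrt2\,\Xi(\widetilde\gamma_{k-1})}{\sigma_r(\overline X)}\Big],$$ $$\widetilde\gamma_k=\frac{\sqrt r(1-\widetilde b_k)+(\sqrt2\,\widetilde a_k+1)\widetilde\beta_k}{\sqrt{2r}(1-\widetilde a_k)(1-\widetilde\beta_k^2)},\qquad \alpha=\frac{1+\sqrt2\,\widetilde a_1}{(1-\widetilde a_1)(1-\widetilde\beta_1^2)\sqrt{r+4s}}.$$ **Theorem.** Suppose that, in addition, $\sigma_r(\overline X)>\max(2,\sqrt2+\alpha)\,\Xi(\gamma_0)$, that $\rho_1$ is such that $$\widetilde a_1<\frac{(\widetilde b_1-\widetilde\beta_1^2)\sqrt r-\widetilde\beta_1}{(1-\widetilde\beta_1^2)\sqrt r+\sqrt2\,\widetilde\beta_1},$$ and that $\mu_k\in\big[1,\Xi(\widetilde\gamma_{k-2})/\Xi(\widetilde\gamma_{k-1})\big]$ for all $k\ge2$. Then $$0\le\frac{\alpha\,\Xi(\gamma_0)}{\sigma_r(\overline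 X)-\sqrt2\,\Xi(\gamma_0)}<1,$$ and for every $k\ge1$ $$\|X^k-\overline X\|_F\le\frac{\Xi(0)}{1-c\widetilde\gamma_1}\Big[1+\frac{(1-\widetilde b_1)\sqrt r}{2(1-\widetilde a_1)(1-\widetilde\beta_1^2)\sqrt s}\Big]+\Big[\frac{\alpha\,\Xi(\gamma_0)}{\sigma_r(\overline X)-\sqrt2\,\Xi(\gamma_0)}\Big]^{k-1}\|X^1-\overline X\|_F.$$ -/

import Mathlib

open Set

noncomputable section

namespace MultiStage

/-! ### Matrices: inner product, norms, singular values -/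

/-- The trace inner product `⟨X, Y⟩ = trace (Xᵀ Y)`. -/
def traceInner {n₁ n₂ : ℕ} (X Y : Matrix (Fin n₁) (Fin n₂) ℝ) : ℝ :=
  (X.transpose * Y).trace

/-- The Frobenius norm, induced by the trace inner product. -/
def frobNorm {n₁ n₂ : ℕ} (X : Matrix (Fin n₁) (Fin n₂) ℝ) : ℝ :=
  Real.sqrt (traceInner X X)

/-- The spectral norm: operator norm between Euclidean spaces. -/
def specNorm {n₁ n₂ : ℕ} (X : Matrix (Fin n₁) (Fin n₂) ℝ) : ℝ :=
  ‖LinearMap.toContinuousLinearMap (Matrix.toEuclideanLin X)‖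

/-- Singular values in non-increasing order. The index starts at `0`, so that the `i`-th largest
singular value is `singVal X (i - 1)`. -/
def singVal {n₁ n₂ : ℕ} (X : Matrix (Fin n₁) (Fin n₂) ℝ) (i : ℕ) : ℝ :=
  (Matrix.toEuclideanLin X).singularValues i

/-- The nuclear norm (for `n₁ ≤ n₂` there are `n₁` singular values). -/
def nuclearNorm {n₁ n₂ : ℕ} (X : Matrix (Fin n₁) (Fin n₂) ℝ) : ℝ :=
  ∑ i : Fin n₁, singVal X i

/-- The `n₁ × n₂` matrix `[Diag(w)  0]`. -/
def rectDiag {n₁ n₂ : ℕ} (w : Fin n₁ → ℝ) : Matrix (Fin n₁) (Fin n₂) ℝ :=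
  Matrix.of fun i j => if (i : ℕ) = (j : ℕ) then w i else 0

/-- `X = U [Diag(σ(X))  0] Vᵀ` with `U`, `V` orthogonal and `σ(X)` in non-increasing order. -/
def IsSVD {n₁ n₂ : ℕ} (X : Matrix (Fin n₁) (Fin n₂) ℝ)
    (U : Matrix (Fin n₁) (Fin n₁) ℝ) (V : Matrix (Fin n₂) (Fin n₂) ℝ) : Prop :=
  U ∈ Matrix.orthogonalGroup (Fin n₁) ℝ ∧ V ∈ Matrix.orthogonalGroup (Fin n₂) ℝ ∧
    X = U * (rectDiag (fun i => singVal X i) : Matrix (Fin n₁) (Fin n₂) ℝ) * V.transpose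

/-- The matrix formed by the first `r` columns (used only for `r ≤ n`). -/
def firstCols {n : ℕ} (r : ℕ) (U : Matrix (Fin n) (Fin n) ℝ) : Matrix (Fin n) (Fin r) ℝ :=
  Matrix.of fun i j => if h : (j : ℕ) < n then U i ⟨j, h⟩ else 0

/-- The orthogonal projection onto the tangent space
`T = {Z | Z = U₁U₁ᵀZ + ZV₁V₁ᵀ - U₁U₁ᵀZV₁V₁ᵀ}`, where `U₁`, `V₁` have orthonormal columns. -/
def projT {n₁ n₂ r : ℕ} (U₁ : Matrix (Fin n₁) (Fin r) ℝ) (V₁ : Matrix (Fin n₂) (Fin r) ℝ)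
    (Z : Matrix (Fin n₁) (Fin n₂) ℝ) : Matrix (Fin n₁) (Fin n₂) ℝ :=
  U₁ * U₁.transpose * Z + Z * (V₁ * V₁.transpose)
    - U₁ * U₁.transpose * Z * (V₁ * V₁.transpose)

/-- The orthogonal projection onto the orthogonal complement of `T`. -/
def projTperp {n₁ n₂ r : ℕ} (U₁ : Matrix (Fin n₁) (Fin r) ℝ) (V₁ : Matrix (Fin n₂) (Fin r) ℝ)
    (Z : Matrix (Fin n₁) (Fin n₂) ℝ) : Matrix (Fin n₁) (Fin n₂) ℝ :=
  Z - projT U₁ V₁ Z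

/-- `‖P_T(W - U₁V₁ᵀ)‖_F / (√(2r) (1 - ‖P_{T^⊥}(W)‖))`. -/
def gammaOf {n₁ n₂ r : ℕ} (U₁ : Matrix (Fin n₁) (Fin r) ℝ) (V₁ : Matrix (Fin n₂) (Fin r) ℝ)
    (W : Matrix (Fin n₁) (Fin n₂) ℝ) : ℝ :=
  frobNorm (projT U₁ V₁ (W - U₁ * V₁.transpose)) /
    (Real.sqrt (2 * r) * (1 - specNorm (projTperp U₁ V₁ W)))

/-! ### The sampling operator and its restricted eigenvalues -/

/-- The sampling operator `X ↦ (⟨A₁, X⟩, …, ⟨A_m, X⟩)`. -/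
def sample {m n₁ n₂ : ℕ} (A : Fin m → Matrix (Fin n₁) (Fin n₂) ℝ)
    (X : Matrix (Fin n₁) (Fin n₂) ℝ) : EuclideanSpace ℝ (Fin m) :=
  WithLp.toLp 2 fun i => traceInner (A i) X

/-- The adjoint of the sampling operator, `y ↦ ∑ yᵢ Aᵢ`. -/
def sampleAdj {m n₁ n₂ : ℕ} (A : Fin m → Matrix (Fin n₁) (Fin n₂) ℝ)
    (y : EuclideanSpace ℝ (Fin m)) : Matrix (Fin n₁) (Fin n₂) ℝ :=
  ∑ i, y i • A i

/-- The values of the Rayleigh quotient of `𝒜*𝒜` on nonzero matrices of rank at most `k`. -/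
def rayleighSet {m n₁ n₂ : ℕ} (A : Fin m → Matrix (Fin n₁) (Fin n₂) ℝ) (k : ℕ) : Set ℝ :=
  (fun X : Matrix (Fin n₁) (Fin n₂) ℝ =>
    traceInner X (sampleAdj A (sample A X)) / frobNorm X ^ 2) '' {X | 0 < X.rank ∧ X.rank ≤ k}

/-- The largest rank-`k` restricted eigenvalue of `𝒜*𝒜`. -/
def thetaMax {m n₁ n₂ : ℕ} (A : Fin m → Matrix (Fin n₁) (Fin n₂) ℝ) (k : ℕ) : ℝ :=
  sSup (rayleighSet A k)

/-- The smallest rank-`k` restricted eigenvalue of `𝒜*𝒜`. -/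
def thetaMin {m n₁ n₂ : ℕ} (A : Fin m → Matrix (Fin n₁) (Fin n₂) ℝ) (k : ℕ) : ℝ :=
  sInf (rayleighSet A k)

/-- The error bound function `Ξ`. -/
def Xi {m n₁ n₂ : ℕ} (A : Fin m → Matrix (Fin n₁) (Fin n₂) ℝ) (δ c : ℝ) (r s : ℕ) (t : ℝ) : ℝ :=
  2 * δ * Real.sqrt (thetaMax A (2 * r + s)) / thetaMin A (2 * r + s) *
    (1 / (1 - c * t)) * Real.sqrt (1 + r * t ^ 2 / (2 * s))

/-! ### The function class `Φ` and the conjugate function -/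

/-- The class `Φ` of closed proper convex functions `φ : ℝ → (-∞, +∞]` with
`int (dom φ) ⊇ [0,1]` whose minimum over `[0,1]` equals `0` and is attained only at points `< 1`.
(Finiteness of the left derivative at `1` follows, as `1` is interior to the domain.) -/
structure IsPhi (φ : ℝ → EReal) : Prop where
  ne_bot : ∀ t, φ t ≠ ⊥
  convex : Convex ℝ {p : ℝ × ℝ | φ p.1 ≤ (p.2 : EReal)}
  closed : LowerSemicontinuous φ
  dom : Icc (0 : ℝ) 1 ⊆ interior {t | φ t < ⊤}
  nonneg : ∀ t ∈ Icc (0 : ℝ) 1, 0 ≤ φ t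
  exists_zero : ∃ t ∈ Ico (0 : ℝ) 1, φ t = 0
  pos_one : 0 < φ 1

/-- The conjugate `ψ*(u) = sup_t (u t - ψ(t))` of the function `ψ` that equals `φ` on `[0,1]` and
`+∞` elsewhere; the supremum thus runs over `[0,1]`, where `φ` is finite. -/
def psiConj (φ : ℝ → EReal) (u : ℝ) : ℝ :=
  sSup ((fun t : ℝ => u * t - (φ t).toReal) '' Icc (0 : ℝ) 1)

/-- Right derivative of the finite convex function `ψ*`. -/
def psiConjRight (φ : ℝ → EReal) (u : ℝ) : ℝ := derivWithin (psiConj φ) (Ioi u) u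

/-- Left derivative of the finite convex function `ψ*`. -/
def psiConjLeft (φ : ℝ → EReal) (u : ℝ) : ℝ := derivWithin (psiConj φ) (Iio u) u

/-- The subdifferential of `ψ*`. -/
def psiConjSubdiff (φ : ℝ → EReal) (u : ℝ) : Set ℝ :=
  {w | ∀ v, psiConj φ u + w * (v - u) ≤ psiConj φ v}

/-! ### The multi-stage convex relaxation algorithm -/

/-- The feasible set of the convex subproblems in `X`. -/
def feasible {m n₁ n₂ : ℕ} (A : Fin m → Matrix (Fin n₁) (Fin n₂) ℝ)
    (b : EuclideanSpace ℝ (Fin m)) (δ : ℝ) (Ω : Set (Matrix (Fin n₁) (Fin n₂) ℝ)) :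
    Set (Matrix (Fin n₁) (Fin n₂) ℝ) :=
  {X | ‖sample A X - b‖ ≤ δ ∧ X ∈ Ω}

/-- `X k` and `W k` are iterates of the algorithm with parameters `ρ k` and ratio factors `μ k`.
The sequences `X`, `ρ` are used from index `1` on, `μ` from index `2` on, `W` from index `0` on.
`W k` is the solution of the subproblem in `W` that is given in closed form by an SVD of `X k`. -/
structure IsMultiStage {m n₁ n₂ : ℕ} (A : Fin m → Matrix (Fin n₁) (Fin n₂) ℝ)
    (b : EuclideanSpace ℝ (Fin m)) (δ : ℝ) (Ω : Set (Matrix (Fin n₁) (Fin n₂) ℝ))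
    (φ : ℝ → EReal) (ρ μ : ℕ → ℝ) (X W : ℕ → Matrix (Fin n₁) (Fin n₂) ℝ) : Prop where
  W_zero : W 0 = 0
  X_mem : ∀ k, X (k + 1) ∈ feasible A b δ Ω
  X_min : ∀ k, IsMinOn (fun Y => nuclearNorm Y - traceInner (W k) Y) (feasible A b δ Ω) (X (k + 1))
  rho_one : 0 < ρ 1
  mu_ge : ∀ k, 1 ≤ μ (k + 2)
  rho_succ : ∀ k, ρ (k + 2) = μ (k + 2) * ρ (k + 1)
  W_mem : ∀ k, specNorm (W (k + 1)) ≤ 1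
  W_min : ∀ k, IsMinOn
    (fun Y => (∑ i : Fin n₁, (φ (singVal Y i)).toReal) - ρ (k + 1) * traceInner Y (X (k + 1)))
    {Y | specNorm Y ≤ 1} (W (k + 1))
  W_form : ∀ k, ∃ U V w, IsSVD (X (k + 1)) U V ∧ 
      W (k + 1) = U * (rectDiag w : Matrix (Fin n₁) (Fin n₂) ℝ) * V.transpose ∧
    ∀ i : Fin n₁, w i ∈ psiConjSubdiff φ (ρ (k + 1) * singVal (X (k + 1)) i)

/-! ### The comparison sequences; `x` stands for `Ξ` at the previous term -/

/-- `ã = (ψ*)'₊(ρ x)`. -/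
def aTilde (φ : ℝ → EReal) (ρ x : ℝ) : ℝ := psiConjRight φ (ρ * x)

/-- `b̃ = (ψ*)'₋(ρ (σ_r - x))`. -/
def bTilde (φ : ℝ → EReal) (σr ρ x : ℝ) : ℝ := psiConjLeft φ (ρ * (σr - x))

/-- `β̃ = -(1/√2) ln(1 - √2 x / σ_r)`. -/
def betaTilde (σr x : ℝ) : ℝ :=
  -(1 / Real.sqrt 2) * Real.log (1 - Real.sqrt 2 * x / σr)

/-- The value of `γ̃_k` in terms of `ã_k`, `b̃_k`, `β̃_k`. -/
def gammaStep (r : ℕ) (a b β : ℝ) : ℝ :=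
  (Real.sqrt r * (1 - b) + (Real.sqrt 2 * a + 1) * β) /
    (Real.sqrt (2 * r) * (1 - a) * (1 - β ^ 2))

/-- The sequence `γ̃_k`, started at `γ̃_0 = γ₀`. -/
def gammaTilde (Ξ : ℝ → ℝ) (φ : ℝ → EReal) (r : ℕ) (σr : ℝ) (ρ : ℕ → ℝ) (γ₀ : ℝ) : ℕ → ℝ
  | 0 => γ₀
  | k + 1 =>
    gammaStep r
      (aTilde φ (ρ (k + 1)) (Ξ (gammaTilde Ξ φ r σr ρ γ₀ k)))
      (bTilde φ σr (ρ (k + 1)) (Ξ (gammaTilde Ξ φ r σr ρ γ₀ k)))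
      (betaTilde σr (Ξ (gammaTilde Ξ φ r σr ρ γ₀ k)))

end MultiStage

end

/-!
Let `e k = ‖X k - X̄‖_F`. Testing the optimality of `X k` at `X̄` shows that the error `Z = X k - X̄`
lies in a cone: the nuclear norm of its part normal to the tangent space at `X̄` is at most
`√(2r) γ` times the Frobenius norm of its tangent part. For the first iterate `γ = 1 / √2`;
afterwards (`cone_le`) `γ` is small if `W (k - 1) = ∑ wᵢ uᵢ vᵢᵀ` is close to `Ū₁ V̄₁ᵀ`, that is, if
`wᵢ` is close to `1` for `i ≤ r` and to `0` for `i > r`, and if the leading singular vectors of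
`X (k - 1)` are close to those of `X̄`. The weights are controlled by the one-sided derivatives of
`ψ*`, since singular values are `1`-Lipschitz, and the rotation of the singular vectors by
`β̃ (e (k - 1))` (`SingFam.lead_sub_le`, which uses the gap after the `r`-th singular value, and
`lead_bound_le_betaTilde`).

In the other direction, the restricted eigenvalue condition bounds the error of any matrix in the
cone (`error_bounds`). The main part `J` of `Z` consists of the tangent part and the first `s`
singular values of the normal part, the tail of the other ones, in blocks of `s`. As the form
`⟨𝒜 X, 𝒜 Y⟩ - ϑ₋ ⟨X, Y⟩` is positive semidefinite on small ranks, it obeys a Cauchy-Schwarz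
inequality between `J` and the blocks (`neg_mul_le_defect`), and `‖𝒜 Z‖ ≤ 2 δ` turns into the two
scalar inequalities assumed in `numeric_bound`. One consequence is `e ≤ Ξ(γ)`, which by induction
gives `e k ≤ Ξ(γ̃_{k-1})` with the decreasing sequence `γ̃` (`gammaTilde_antitone`).

The geometric decay needs more than inserting a linear bound on `γ` into `Ξ`, because `Ξ` is not
linear. Write `K = Ξ(0) / (1 - c γ̃₁)`, and let `x` and `x₁` be the cone parameter `γ` of the current
stage and `γ̃₁`, both scaled by `√(r / (2 s))`. The refined bound in `error_bounds` is `e ≤ m K`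
whenever `m ≥ 1` and `x + 1 ≤ m (1 + x₁ / √(1 + x₁²))`. On the other hand `x ≤ P + Q β̃(e')`, where
`e'` is the previous error and `x₁ = P + Q β̃₁`. As `β̃` is convex and vanishes at `0`, and its
derivative is at most `1 / (σ_r - √2 Ξ(γ₀))` on the relevant interval, the induction hypothesis
`e' ≤ K (1 + P) + F` allows the choice `m = 1 + P + q F / K`, with `q` the ratio of the theorem
(`recursion_step`); this is the bound `e ≤ K (1 + P) + q F`.
-/

namespace MultiStage

/-! ### Polynomial inequalities from discriminants -/

/-- Nonnegativity of a quadratic on `[0, ∞)`. Only a negative `B` matters, and then `B ^ 2 ≤ B *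
(B - τ)`; the slack `τ` serves to turn the discriminant condition into a polynomial inequality
that holds for both signs of `B`. -/
lemma quadratic_nonneg_of_discrim {A B C τ h : ℝ} (hA : 0 < A) (hC : 0 ≤ C) (hτ : 0 ≤ τ)
    (hh : 0 ≤ h) (hd : 0 ≤ 4 * A * C - B * (B - τ)) : 0 ≤ A * h ^ 2 + B * h + C := by
  rcases le_or_gt 0 B with hB | hB
  · positivity
  · have h1 : B ^ 2 ≤ 4 * A * C := by nlinarith
    have h2 : 0 ≤ 4 * A * (A * h ^ 2 + B * h + C) := by nlinarith [sq_nonneg (2 * A * h + B)]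
    exact nonneg_of_mul_nonneg_right h2 (by positivity)

/-- The discriminant condition for cone parameters `x < 23 / 50`. The substitutions `x = (23 / 50)
p / (1 + p)` and `k = (1 / (2 + 3 x) + s) / (1 + s)` with `p, s ≥ 0` parametrize the domain, and
the numerator then is a polynomial in `p` and `s` with positive coefficients. The two lemmas that
follow follow the same pattern on their ranges of `x`. -/
lemma discrim_small {x k : ℝ} (hx : 0 ≤ x) (hx1 : x < 23 / 50) (hk : 1 ≤ k * (2 + 3 * x))
    (hk1 : k < 1) :
    0 ≤ 2 * k * x * (1 - k) ^ 2 * (1 + k ^ 2 + k * x * (1 - k) ^ 2)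
      - ((1 + k ^ 2) * (1 - k * x) * x - k ^ 2 / 2)
        * ((1 + k ^ 2) * (1 - k * x) * x - k ^ 2 / 2 + k ^ 2 / 2 * (1 - 2 * x) ^ 2) := by
  obtain ⟨p, hp, hxp⟩ : ∃ p : ℝ, 0 ≤ p ∧ x = 23 / 50 * p / (1 + p) := by
    have h0 : 0 < 23 / 50 - x := by linarith
    refine ⟨x / (23 / 50 - x), by positivity, ?_⟩
    have : 1 + x / (23 / 50 - x) = (23 / 50) / (23 / 50 - x) := by
      rw [eq_div_iff h0.ne', add_mul, div_mul_cancel₀ _ h0.ne']; ring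
    rw [this, eq_div_iff (by positivity)]
    ring
  obtain ⟨s, hs, hks⟩ : ∃ s : ℝ, 0 ≤ s ∧ k = (1 + (2 + 3 * x) * s) / ((2 + 3 * x) * (1 + s)) := by
    have h0 : 0 < 1 - k := by linarith
    have h1 : 0 < 2 + 3 * x := by linarith
    refine ⟨(k * (2 + 3 * x) - 1) / ((2 + 3 * x) * (1 - k)), div_nonneg (by linarith)
      (by positivity), ?_⟩
    have h2 : 0 < (2 + 3 * x) * (1 - k) := by positivity
    have h4 : 0 < 1 + 3 * x := by linarith
    have h3 : 1 + (k * (2 + 3 * x) - 1) / ((2 + 3 * x) * (1 - k))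
      = (1 + 3 * x) / ((2 + 3 * x) * (1 - k)) := by field_simp; ring
    rw [h3]; field_simp; ring
  have e1 : 1 + p ≠ 0 := by positivity
  have e2 : 1 + s ≠ 0 := by positivity
  have e3 : 100 + 169 * p ≠ 0 := by positivity
  have hk' : k = (50 * (1 + p) + (100 + 169 * p) * s) / ((100 + 169 * p) * (1 + s)) := by
    have : 2 + 3 * x = (100 + 169 * p) / (50 * (1 + p)) := by rw [hxp]; field_simp; ring
    rw [hks, this]; field_simp
  rw [hk', hxp]
  have h1 : (1 : ℝ) - (50 * (1 + p) + (100 + 169 * p) * s) / ((100 + 169 * p) * (1 + s))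
      = (50 + 119 * p) / ((100 + 169 * p) * (1 + s)) := by
    field_simp; ring
  have h2 : (1 : ℝ) - 2 * (23 / 50 * p / (1 + p)) = (50 + 4 * p) / (50 * (1 + p)) := by
    field_simp; ring
  rw [h1, h2]
  field_simp
  ring_nf
  positivity

lemma discrim_middle {x k : ℝ} (hx : 23 / 50 ≤ x) (hx1 : x < 1) (hk : 1 ≤ k * (2 + 3 * x))
    (hk1 : k < 1) :
    0 ≤ 4 * ((1 + k ^ 2) * ((71 + 20 * x) - 80 * (1 - k * x) / 2) - k ^ 2 * x * (71 + 20 * x))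
        * ((1 + k ^ 2) * ((71 + 20 * x) - 80 * (1 - k * x)) - 2 * k ^ 2 * x * (71 + 20 * x))
      - ((1 + k ^ 2) * (80 * (1 - k * x)) * x - k ^ 2 * (71 + 20 * x) / 2)
        * ((1 + k ^ 2) * (80 * (1 - k * x)) * x - k ^ 2 * (71 + 20 * x) / 2
          + k ^ 2 * (71 + 20 * x) / 2 * (2 * x - 23 / 25)) := by
  obtain ⟨p, hp, hxp⟩ : ∃ p : ℝ, 0 ≤ p ∧ x = (23 / 50 + p) / (1 + p) := by
    have h0 : 0 < 1 - x := by linarith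
    refine ⟨(x - 23 / 50) / (1 - x), div_nonneg (by linarith) h0.le, ?_⟩
    have : 1 + (x - 23 / 50) / (1 - x) = (27 / 50) / (1 - x) := by field_simp; ring
    rw [this]; field_simp; ring
  obtain ⟨s, hs, hks⟩ : ∃ s : ℝ, 0 ≤ s ∧ k = (1 + (2 + 3 * x) * s) / ((2 + 3 * x) * (1 + s)) := by
    have h0 : 0 < 1 - k := by linarith
    have h1 : 0 < 2 + 3 * x := by linarith
    refine ⟨(k * (2 + 3 * x) - 1) / ((2 + 3 * x) * (1 - k)), div_nonneg (by linarith)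
      (by positivity), ?_⟩
    have h2 : 0 < (2 + 3 * x) * (1 - k) := by positivity
    have h4 : 0 < 1 + 3 * x := by linarith
    have h3 : 1 + (k * (2 + 3 * x) - 1) / ((2 + 3 * x) * (1 - k))
      = (1 + 3 * x) / ((2 + 3 * x) * (1 - k)) := by field_simp; ring
    rw [h3]; field_simp; ring
  have e1 : 1 + p ≠ 0 := by positivity
  have e2 : 1 + s ≠ 0 := by positivity
  have e3 : 169 + 250 * p ≠ 0 := by positivity
  have hk' : k = (50 * (1 + p) + (169 + 250 * p) * s) / ((169 + 250 * p) * (1 + s)) := by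
    have : 2 + 3 * x = (169 + 250 * p) / (50 * (1 + p)) := by rw [hxp]; field_simp; ring
    rw [hks, this]; field_simp
  rw [hk', hxp]
  field_simp
  ring_nf
  positivity

lemma discrim_large {x k : ℝ} (hx : 1 ≤ x) (hk : 1 ≤ k * (2 + 3 * x)) (hk1 : k * x < 1) :
    0 ≤ 4 * (4 * (6 + 3 * x) - 16 * (1 - k * x) * (1 + k ^ 2) - k ^ 2 * (6 + 3 * x) / 4)
        * (4 * (6 + 3 * x) - 32 * (1 - k * x) * (1 + k ^ 2) - 4 * k ^ 2 * x ^ 2 * (6 + 3 * x))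
      - (32 * x * (1 - k * x) * (1 + k ^ 2) - 2 * k ^ 2 * x * (6 + 3 * x))
        * (32 * x * (1 - k * x) * (1 + k ^ 2)) := by
  obtain ⟨p, hp, hxp⟩ : ∃ p : ℝ, 0 ≤ p ∧ x = 1 + p := ⟨x - 1, by linarith, by ring⟩
  have hx0 : 0 < x := by linarith
  obtain ⟨s, hs, hks⟩ : ∃ s : ℝ, 0 ≤ s ∧ k = (x + (2 + 3 * x) * s) / ((2 + 3 * x) * (1 + s) * x) := by
    have h0 : 0 < 1 - k * x := by linarith
    have h1 : 0 < 2 + 3 * x := by linarith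
    refine ⟨x * (k * (2 + 3 * x) - 1) / ((2 + 3 * x) * (1 - k * x)), div_nonneg
      (mul_nonneg hx0.le (by linarith)) (by positivity), ?_⟩
    have h4 : 0 < 2 + 2 * x := by linarith
    have h3 : 1 + x * (k * (2 + 3 * x) - 1) / ((2 + 3 * x) * (1 - k * x))
      = (2 + 2 * x) / ((2 + 3 * x) * (1 - k * x)) := by
      rw [eq_div_iff (by positivity), add_mul, div_mul_cancel₀ _ (by positivity)]; ring
    have h5 : 1 - x * k ≠ 0 := by rw [mul_comm]; exact h0.ne'
    rw [h3]; field_simp; ring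
  have e1 : 1 + p ≠ 0 := by positivity
  have e2 : 1 + s ≠ 0 := by positivity
  have e3 : 5 + 3 * p ≠ 0 := by positivity
  have hk' : k = ((1 + p) + (5 + 3 * p) * s) / ((5 + 3 * p) * (1 + s) * (1 + p)) := by
    have : 2 + 3 * x = (5 + 3 * p) := by rw [hxp]; ring
    rw [hks, this, hxp]
  have hkx : 1 - k * x = (4 + 2 * p) / ((5 + 3 * p) * (1 + s)) := by
    rw [hk', hxp]; field_simp; ring
  rw [hkx, hk', hxp]
  field_simp
  ring_nf
  positivity

/-! ### The gain from a larger reference parameter -/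

section gain
variable {κ x X m ζ : ℝ}

lemma zeta_le_rational (hX : 0 ≤ X) : X / √(1 + X ^ 2) ≤ 5 * X / (4 + 3 * X) := by
  have h1 : (4 + 3 * X) / 5 ≤ √(1 + X ^ 2) := by
    apply Real.le_sqrt_of_sq_le
    nlinarith [sq_nonneg (4 * X - 3)]
  have h2 : 0 < (4 + 3 * X) / 5 := by positivity
  calc X / √(1 + X ^ 2) ≤ X / ((4 + 3 * X) / 5) := by gcongr
    _ = 5 * X / (4 + 3 * X) := by field_simp

lemma zeta_le_one : X / √(1 + X ^ 2) ≤ 1 := by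
  rw [div_le_one (by positivity)]
  apply Real.le_sqrt_of_sq_le
  nlinarith

/-- The factor `(1 - κ X) / m` is at most `2 / G` times `1 - κ x`. In the lemmas that follow, `G`
is affine in `x` on the middle and on the upper range of `x`. -/
lemma gain_aux {G : ℝ} (hx : 0 ≤ x) (hxX : x ≤ X) (hκ : 1 ≤ κ * (2 + 3 * x)) (hX : κ * X < 1)
    (hζ0 : 0 ≤ ζ) (hm : x + 1 ≤ m * (1 + ζ))
    (hG : G * (1 + ζ) ≤ 2 + x + X) : (1 - κ * X) * G ≤ 2 * m * (1 - κ * x) := by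
  have h1 : (2 + x + X) * (1 - κ * X) ≤ (2 + 2 * x) * (1 - κ * x) := by
    have : 0 ≤ (X - x) * (κ * (2 + 2 * x + X) - 1) := by
      apply mul_nonneg (by linarith)
      nlinarith
    nlinarith
  have h2 : 0 < 1 - κ * X := by linarith
  have h3 : 0 ≤ 1 - κ * x := by nlinarith
  have h4 : (1 - κ * X) * (G * (1 + ζ)) ≤ (1 - κ * X) * (2 + x + X) := by gcongr
  have h5 : 2 * (x + 1) * (1 - κ * x) ≤ 2 * (m * (1 + ζ)) * (1 - κ * x) := by gcongr
  have h6 : (1 - κ * X) * G * (1 + ζ) ≤ (2 * m * (1 - κ * x)) * (1 + ζ) := by nlinarith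
  exact le_of_mul_le_mul_right h6 (by linarith)

lemma gain_middle (hx : 23 / 50 ≤ x) (hxX : x ≤ X) (hκ : 1 ≤ κ * (2 + 3 * x)) (hX : κ * X < 1)
    (hζ0 : 0 ≤ ζ) (hζ : ζ ≤ 5 * X / (4 + 3 * X)) (hm : x + 1 ≤ m * (1 + ζ))
    (hx1 : x ≤ 1) : (1 - κ * X) * (71 + 20 * x) ≤ 80 * m * (1 - κ * x) := by
  have key : (71 + 20 * x) / 40 * (1 + ζ) ≤ 2 + x + X := by
    have h0 : 0 < 4 + 3 * X := by linarith
    have h1 : (71 + 20 * x) / 40 * (1 + ζ) ≤ (71 + 20 * x) / 40 * (1 + 5 * X / (4 + 3 * X)) := by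
      gcongr
    refine h1.trans ?_
    rw [show 1 + 5 * X / (4 + 3 * X) = (4 + 8 * X) / (4 + 3 * X) by
        rw [eq_div_iff h0.ne', add_mul, div_mul_cancel₀ _ h0.ne']; ring,
      mul_div_assoc', div_le_iff₀ h0]
    nlinarith [sq_nonneg (X - (168 + 40 * x) / 240), mul_nonneg (sub_nonneg.2 hx) (sub_nonneg.2 hx1)]
  have := gain_aux (by linarith) hxX hκ hX hζ0 hm key
  linarith

lemma gain_large (hx : 1 ≤ x) (hxX : x ≤ X) (hκ : 1 ≤ κ * (2 + 3 * x)) (hX : κ * X < 1)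
    (hζ0 : 0 ≤ ζ) (hζ : ζ ≤ 5 * X / (4 + 3 * X)) (hζ1 : ζ ≤ 1)
    (hm : x + 1 ≤ m * (1 + ζ)) : (1 - κ * X) * (6 + 3 * x) ≤ 8 * m * (1 - κ * x) := by
  have key : (6 + 3 * x) / 4 * (1 + ζ) ≤ 2 + x + X := by
    rcases le_total x 2 with h2 | h2
    · have h0 : 0 < 4 + 3 * X := by linarith
      have h1 : (6 + 3 * x) / 4 * (1 + ζ) ≤ (6 + 3 * x) / 4 * (1 + 5 * X / (4 + 3 * X)) := by
        gcongr
      refine h1.trans ?_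
      rw [show 1 + 5 * X / (4 + 3 * X) = (4 + 8 * X) / (4 + 3 * X) by
        rw [eq_div_iff h0.ne', add_mul, div_mul_cancel₀ _ h0.ne']; ring,
        mul_div_assoc', div_le_iff₀ h0]
      nlinarith [sq_nonneg (X - x), mul_nonneg (sub_nonneg.2 hxX) (sub_nonneg.2 hx)]
    · nlinarith
  have := gain_aux (by linarith) hxX hκ hX hζ0 hm key
  linarith

end gain

/-! ### The scalar inequality behind the error bound -/

section full
variable {κ x h g D H u u0 q : ℝ}

/-- The second-moment test for small `x`: the inequality that makes the bound on `‖𝒜 Z‖²` suffice.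
The left side grows with `u0` and the right side is a quadratic in `u`, so that both may be evaluated
at `min u κ`. -/
lemma full_test_small (hκ : 0 ≤ κ) (hx : 0 ≤ x) (hκx : κ * (2 + 3 * x) ≤ 1) (hx1 : x ≤ 1 / 3)
    (hD : 0 < D) (hD1 : 1 ≤ D ^ 2) (hg : g ^ 2 ≤ x ^ 2) (hH0 : 0 ≤ H) (hH : H ≤ κ * (2 * x))
    (hu0 : 0 ≤ u0) (hu0u : u0 ≤ u) (hu0κ : u0 ≤ κ) :
    (D ^ 2 + g ^ 2) * (1 - κ * x) ^ 2 * (1 + u0 ^ 2)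
      ≤ D ^ 2 + g ^ 2 + D ^ 2 * u ^ 2 - 2 * D * u * H - H ^ 2 := by
  have hD' : 1 ≤ D := by nlinarith
  have hw : κ * x ≤ 1 := by nlinarith
  -- reduce to `v = min u κ`
  obtain ⟨v, hv0, hvκ, huv, hf⟩ : ∃ v, 0 ≤ v ∧ v ≤ κ ∧ u0 ≤ v ∧
      D ^ 2 * v ^ 2 - 2 * D * v * H ≤ D ^ 2 * u ^ 2 - 2 * D * u * H := by
    rcases le_total u κ with h1 | h1
    · exact ⟨u, hu0.trans hu0u, h1, hu0u, le_rfl⟩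
    · refine ⟨κ, hκ, le_rfl, hu0κ, ?_⟩
      have h2 : H ≤ D * κ := by nlinarith
      have h3 : 0 ≤ D * (u - κ) * (D * (u + κ) - 2 * H) := by
        apply mul_nonneg (mul_nonneg hD.le (by linarith))
        nlinarith
      nlinarith
  have h1 : (D ^ 2 + g ^ 2) * (1 - κ * x) ^ 2 * (1 + u0 ^ 2)
      ≤ (D ^ 2 + g ^ 2) * (1 - κ * x) ^ 2 * (1 + v ^ 2) := by gcongr
  have hq : (1 - κ * x) ^ 2 ≤ 1 := by
    have : 0 ≤ κ * x := by positivity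
    nlinarith
  have h2 : (D ^ 2 + g ^ 2) * (1 - κ * x) ^ 2 * v ^ 2 ≤ (D ^ 2 + g ^ 2) * v ^ 2 := by
    nlinarith [mul_nonneg (by positivity : 0 ≤ (D ^ 2 + g ^ 2) * v ^ 2) (sub_nonneg.2 hq)]
  have h3 : g ^ 2 * v ^ 2 ≤ x ^ 2 * κ ^ 2 := by gcongr
  have h4 : H ^ 2 ≤ (κ * (2 * x)) ^ 2 := by gcongr
  have h5 : 2 * D * v * H ≤ 2 * D * κ * (κ * (2 * x)) := by gcongr
  have h6 : κ * x * (2 - κ * x) * D ^ 2 ≥ 5 * κ ^ 2 * x ^ 2 + 4 * D * κ ^ 2 * x := by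
    have h7 : 0 ≤ κ * x := by positivity
    have h8 : 0 ≤ D ^ 2 - D := by nlinarith
    have h9 : 5 * κ * x + 4 * D * κ ≤ (2 - κ * x) * D ^ 2 := by
      nlinarith [mul_nonneg hκ h8, mul_nonneg h7 (sub_nonneg.2 hD1),
        mul_nonneg (sub_nonneg.2 hκx) (sub_nonneg.2 hD1)]
    nlinarith
  have h7 : 0 ≤ κ * x * (2 - κ * x) * g ^ 2 := by
    apply mul_nonneg (mul_nonneg (by positivity) (by linarith)) (by positivity)
  nlinarith

/-- The left side is convex in `κ`, so that it suffices to look at both ends of the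
interval `[0, 1 / (2 + 3 x)]`. -/
lemma crude_numeric (hκ : 0 ≤ κ) (hx : 1 ≤ x) (hκx : κ * (2 + 3 * x) ≤ 1) :
    4 * (1 - κ * x) ^ 2 + (1 + x) ^ 2 * (κ ^ 2 * (8 * x ^ 2 + 1)) ≤ (1 + x) ^ 2 := by
  have hd : 0 < 2 + 3 * x := by linarith
  set P := 4 * x ^ 2 + (1 + x) ^ 2 * (8 * x ^ 2 + 1) with hP
  have hP0 : 0 ≤ P := by positivity
  have h8 : κ ^ 2 * (2 + 3 * x) ≤ κ := by nlinarith
  have h9 : κ ^ 2 * (2 + 3 * x) * P ≤ κ * P := by gcongr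
  have h10 : κ * P ≤ ((1 + x) ^ 2 - 4) * (2 + 3 * x) + 8 * κ * x * (2 + 3 * x) := by
    have e1 : P - 8 * x * (2 + 3 * x) ≤ ((1 + x) ^ 2 - 4) * (2 + 3 * x) * (2 + 3 * x) := by
      obtain ⟨y, hy, rfl⟩ : ∃ y, 0 ≤ y ∧ x = 1 + y := ⟨x - 1, by linarith, by ring⟩
      rw [hP, ← sub_nonneg]
      ring_nf
      positivity
    have e2 : 0 ≤ ((1 + x) ^ 2 - 4) * (2 + 3 * x) := by
      apply mul_nonneg _ hd.le; nlinarith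
    have e3 := mul_le_mul_of_nonneg_left e1 hκ
    have e4 := mul_le_mul_of_nonneg_left hκx e2
    linear_combination e3 + e4
  have h11 : (κ ^ 2 * P) * (2 + 3 * x) ≤ ((1 + x) ^ 2 - 4 + 8 * κ * x) * (2 + 3 * x) := by
    linear_combination h9 + h10
  have h12 := le_of_mul_le_mul_right h11 hd
  linear_combination h12

/-- The second-moment test for the other values of `x`, by completing the square in `u`. -/
lemma full_test_crude (hκ : 0 ≤ κ) (hx : 1 / 3 ≤ x) (hκx : κ * (2 + 3 * x) ≤ 1)
    (hD1 : 1 ≤ D ^ 2) (hH0 : 0 ≤ H) (hH : H ≤ κ * (2 * x))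
    (hu0 : 0 ≤ u0) (hu0κ : u0 ≤ κ) (hq0 : 0 ≤ q) (hq : q ≤ 1 - κ * x)
    (hq2 : q * (1 + x) ≤ 2 * (1 - κ * x)) :
    (D ^ 2 + g ^ 2) * q ^ 2 * (1 + u0 ^ 2)
      ≤ D ^ 2 + g ^ 2 + D ^ 2 * u ^ 2 - 2 * D * u * H - H ^ 2 := by
  have hκx0 : 0 ≤ κ * x := mul_nonneg hκ (by linarith)
  have h1 : D ^ 2 + g ^ 2 - 2 * H ^ 2 ≤ D ^ 2 + g ^ 2 + D ^ 2 * u ^ 2 - 2 * D * u * H - H ^ 2 := by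
    nlinarith [sq_nonneg (D * u - H)]
  refine le_trans ?_ h1
  have h2 : H ^ 2 ≤ (κ * (2 * x)) ^ 2 := by gcongr
  have hq1 : q ^ 2 ≤ 1 := by nlinarith
  -- it suffices to treat `D ^ 2 + g ^ 2 = 1`
  have h3 : q ^ 2 + κ ^ 2 + 8 * (κ * x) ^ 2 ≤ 1 := by
    rcases le_total x 1 with h4 | h4
    · have h5 : q ^ 2 ≤ (1 - κ * x) ^ 2 := by gcongr
      have h6 : κ * (9 * x ^ 2 + 1) ≤ 2 * x := by
        have : 9 * x ^ 2 + 1 ≤ 2 * x * (2 + 3 * x) := by nlinarith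
        nlinarith
      nlinarith
    · have h5 : (q * (1 + x)) ^ 2 ≤ (2 * (1 - κ * x)) ^ 2 := by gcongr
      have h6 : 0 < (1 + x) ^ 2 := by positivity
      have h7 := crude_numeric hκ h4 hκx
      have h8 : (1 + x) ^ 2 * (q ^ 2 + κ ^ 2 + 8 * (κ * x) ^ 2) ≤ (1 + x) ^ 2 * 1 := by
        linear_combination h5 + h7
      exact le_of_mul_le_mul_left h8 h6
  have h4 : u0 ^ 2 ≤ κ ^ 2 := by gcongr
  have h5 : q ^ 2 * (1 + u0 ^ 2) ≤ q ^ 2 + κ ^ 2 := by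
    nlinarith [mul_nonneg (sub_nonneg.2 hq1) (sq_nonneg u0)]
  have h6 : (D ^ 2 + g ^ 2) * (q ^ 2 * (1 + u0 ^ 2)) ≤ (D ^ 2 + g ^ 2) * (1 - 8 * (κ * x) ^ 2) := by
    gcongr; linarith
  nlinarith [mul_nonneg (sq_nonneg (κ * x)) (by nlinarith [sq_nonneg g] : 0 ≤ D ^ 2 + g ^ 2 - 1)]

end full
section moment
variable {κ x h g D e H G u u0 q : ℝ}

/-- `√(D² + g²) ≤ D + g² / (2 D)`, written without the division. -/
lemma two_mul_sqrt_le (hD : 0 < D) : 2 * D * √(D ^ 2 + g ^ 2) ≤ 2 * D ^ 2 + g ^ 2 := by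
  have h1 : √(D ^ 2 + g ^ 2) ^ 2 = D ^ 2 + g ^ 2 := Real.sq_sqrt (by positivity)
  nlinarith [sq_nonneg (√(D ^ 2 + g ^ 2) - D)]

/-- The first-moment test: the inequality that makes the bound on `⟨𝒜 J, 𝒜 Z⟩` suffice, where `J`
is the main part of `Z`. This lemma and the two similar ones below deduce it, for all `u ≥ u0`,
from a condition that does not involve `u`. -/
lemma first_test_of_le_half (hE : H / 2 ≤ D - q * e) (hu0 : 0 ≤ u0) (hu0u : u0 ≤ u) (hq : 0 ≤ q)
    (he : 0 ≤ e) (hH : 0 ≤ H) :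
    q * e * (1 + u0 ^ 2) ≤ D * (1 + u ^ 2) - H * u := by
  have h1 : q * e * (1 + u0 ^ 2) ≤ q * e * (1 + u ^ 2) := by gcongr
  nlinarith [mul_nonneg hH (sq_nonneg (u - 1)), mul_nonneg (sub_nonneg.2 hE) (sq_nonneg u)]

lemma first_test_kappa_large (hκ : 1 ≤ κ) (hx : 0 ≤ x) (hh : 0 ≤ h)
    (hD : 1 ≤ D) (hg : g ^ 2 ≤ h * (2 * x - h)) (hH : H ≤ κ * (2 * x - h / 2))
    (he : 2 * D * e ≤ 2 * D ^ 2 + g ^ 2) (hq0 : 0 ≤ q) (hq : q ≤ 1 - κ * x) :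
    H / 2 ≤ D - q * e := by
  have h1 : 2 * D * (q * e) ≤ q * (2 * D ^ 2 + g ^ 2) := by nlinarith
  have h2 : q * (2 * D ^ 2 + g ^ 2) ≤ (1 - κ * x) * (2 * D ^ 2 + g ^ 2) := by gcongr
  have hw : 0 ≤ 1 - κ * x := hq0.trans hq
  have h3 : (1 - κ * x) * g ^ 2 ≤ (1 - κ * x) * (h * (2 * x)) := by
    gcongr; nlinarith
  have h4 : (1 - κ * x) * (4 * x) ≤ κ := by
    have : κ * ((1 - κ * x) * (4 * x)) ≤ κ * κ := by nlinarith [sq_nonneg (2 * κ * x - 1)]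
    exact le_of_mul_le_mul_left this (by linarith)
  have h5 : (1 - κ * x) * (h * (2 * x)) ≤ κ * h / 2 := by nlinarith
  have h6 : κ * h / 2 ≤ D * (κ * h / 2) := by
    have : 0 ≤ κ * h / 2 := by positivity
    nlinarith
  have h7 : 2 * D * (κ * x) ≤ 2 * D ^ 2 * (κ * x) := by
    have h9 : 0 ≤ κ * x := by positivity
    have h8 : 0 ≤ D * (D - 1) := by apply mul_nonneg <;> linarith
    nlinarith [mul_nonneg h9 h8]
  have h8 : D * H ≤ D * (κ * (2 * x - h / 2)) := by gcongr
  have h9 : (2 * D) * (H / 2) ≤ (2 * D) * (D - q * e) := by linarith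
  exact le_of_mul_le_mul_left h9 (by linarith)

/-- For `u ≤ κ` one may replace `u0` by `u`, and `u / (1 + u ^ 2)` is largest at `u = κ`; beyond
`κ` the right side of the test increases in `u`. -/
lemma first_test_of_interior (hκ0 : 0 < κ) (hE : κ * H ≤ (D - q * e) * (1 + κ ^ 2))
    (hHD : H ≤ 2 * κ * D) (hH : 0 ≤ H)
    (hu0 : 0 ≤ u0) (hu0u : u0 ≤ u) (hu0κ : u0 ≤ κ) (hκ1 : κ ≤ 1) (hq : 0 ≤ q) (he : 0 ≤ e) :
    q * e * (1 + u0 ^ 2) ≤ D * (1 + u ^ 2) - H * u := by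
  have hDE : 0 ≤ D - q * e := by
    have : 0 ≤ (D - q * e) * (1 + κ ^ 2) := le_trans (by positivity) hE
    exact nonneg_of_mul_nonneg_left this (by positivity)
  rcases le_total u κ with h1 | h1
  · have hu : 0 ≤ u := hu0.trans hu0u
    have h2 : u * (1 + κ ^ 2) ≤ κ * (1 + u ^ 2) := by
      have h3 : 0 ≤ (κ - u) * (1 - κ * u) := by
        apply mul_nonneg (by linarith)
        nlinarith
      nlinarith
    have h3 : κ * (H * u) ≤ κ * ((D - q * e) * (1 + u ^ 2)) := by
      nlinarith [mul_le_mul_of_nonneg_left h2 hDE, mul_le_mul_of_nonneg_right hE hu]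
    have h4 := le_of_mul_le_mul_left h3 hκ0
    have h5 : q * e * (1 + u0 ^ 2) ≤ q * e * (1 + u ^ 2) := by gcongr
    linarith
  · have h2 : 0 ≤ (u - κ) * (D * (u + κ) - H) := by
      apply mul_nonneg (by linarith)
      nlinarith
    have h5 : q * e * (1 + u0 ^ 2) ≤ q * e * (1 + κ ^ 2) := by gcongr
    nlinarith

/-- With `g ^ 2 ≤ h (2 x - h)` and `1 + h ^ 2 ≤ D ^ 2` the condition of `first_test_of_interior`
follows from the nonnegativity of a quadratic in `h`. -/
lemma interior_of_quadratic (hh : 0 ≤ h) (hhx : h ≤ 2 * x)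
    (hD : 0 < D) (hDh : 1 + h ^ 2 ≤ D ^ 2) (hg : g ^ 2 ≤ h * (2 * x - h))
    (hH : H ≤ κ * (2 * x - h / 2)) (he : 2 * D * e ≤ 2 * D ^ 2 + g ^ 2) (hq0 : 0 ≤ q)
    (hκ : 0 ≤ κ)
    (hC : 0 ≤ (1 - q) * (1 + κ ^ 2) - 2 * x * κ ^ 2)
    (hQ : 0 ≤ ((1 + κ ^ 2) * (1 - q / 2) - κ ^ 2 * x) * h ^ 2 +
      (-((1 + κ ^ 2) * q * x - κ ^ 2 / 2)) * h + ((1 - q) * (1 + κ ^ 2) - 2 * x * κ ^ 2)) :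
    κ * H ≤ (D - q * e) * (1 + κ ^ 2) := by
  have h1 : 2 * D * (q * e) ≤ q * (2 * D ^ 2 + g ^ 2) := by nlinarith
  have h2 : κ * H ≤ κ ^ 2 * (2 * x - h / 2) := by nlinarith
  have hG : 0 ≤ κ ^ 2 * (2 * x - h / 2) := mul_nonneg (by positivity) (by linarith)
  have h3 : 2 * D * (κ ^ 2 * (2 * x - h / 2)) ≤ κ ^ 2 * (2 * x - h / 2) * (1 + D ^ 2) := by
    nlinarith [mul_nonneg hG (sq_nonneg (D - 1))]
  have h4 : 0 ≤ 2 * (1 + κ ^ 2) * (1 - q) - κ ^ 2 * (2 * x - h / 2) := by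
    have : 0 ≤ κ ^ 2 * h := by positivity
    have : 0 ≤ κ ^ 2 * x := by apply mul_nonneg (by positivity); linarith
    nlinarith
  have h5 := mul_nonneg h4 (sub_nonneg.2 hDh)
  have h6 : (1 + κ ^ 2) * q * g ^ 2 ≤ (1 + κ ^ 2) * q * (h * (2 * x - h)) := by gcongr
  have h7 : 0 ≤ κ ^ 2 * h ^ 3 := by positivity
  have h8 : κ ^ 2 * (2 * x - h / 2) * (1 + D ^ 2)
      ≤ (2 * D ^ 2 - q * (2 * D ^ 2 + g ^ 2)) * (1 + κ ^ 2) := by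
    linear_combination h5 + h6 + 2 * hQ + h7 / 2
  have h9 : 2 * D * (κ * H) ≤ 2 * D * ((D - q * e) * (1 + κ ^ 2)) := by
    have e1 : 2 * D * (κ * H) ≤ 2 * D * (κ ^ 2 * (2 * x - h / 2)) := by gcongr
    have e2 := mul_le_mul_of_nonneg_right h1 (by positivity : 0 ≤ 1 + κ ^ 2)
    linear_combination e1 + h3 + h8 + e2
  exact le_of_mul_le_mul_left h9 (by linarith)

lemma interior_small (hκ1 : κ < 1) (hκ : 1 ≤ κ * (2 + 3 * x)) (hx : 0 ≤ x) (hx1 : x < 23 / 50)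
    (hh : 0 ≤ h) (hhx : h ≤ 2 * x)
    (hD : 0 < D) (hDh : 1 + h ^ 2 ≤ D ^ 2) (hg : g ^ 2 ≤ h * (2 * x - h))
    (hH : H ≤ κ * (2 * x - h / 2)) (he : 2 * D * e ≤ 2 * D ^ 2 + g ^ 2) (hκ0 : 0 ≤ κ) :
    κ * H ≤ (D - (1 - κ * x) * e) * (1 + κ ^ 2) := by
  have hC : 0 ≤ κ * x * (1 - κ) ^ 2 := by positivity
  have hC' : 0 ≤ (1 - (1 - κ * x)) * (1 + κ ^ 2) - 2 * x * κ ^ 2 := by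
    linear_combination hC
  refine interior_of_quadratic hh hhx hD hDh hg hH he ?_ hκ0 hC' ?_
  · nlinarith
  refine quadratic_nonneg_of_discrim (τ := κ ^ 2 / 2 * (1 - 2 * x) ^ 2) ?_ hC' (by positivity) hh ?_
  · have : 0 < (1 + κ ^ 2) / 2 + κ * x * (1 - κ) ^ 2 / 2 := by positivity
    linear_combination this
  · have := discrim_small hx hx1 hκ hκ1
    linear_combination this

lemma interior_middle_const (hx : 23 / 50 ≤ x) (hx1 : x < 1) (hκ : 1 ≤ κ * (2 + 3 * x))
    (hκ1 : κ < 1) :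
    0 ≤ (1 + κ ^ 2) * ((71 + 20 * x) - 80 * (1 - κ * x)) - 2 * κ ^ 2 * x * (71 + 20 * x) := by
  have hκ0 : 0 < κ := by
    by_contra hc
    nlinarith
  obtain ⟨p, hp, hxp⟩ : ∃ p : ℝ, 0 ≤ p ∧ x = (23 / 50 + p) / (1 + p) := by
    have h0 : 0 < 1 - x := by linarith
    refine ⟨(x - 23 / 50) / (1 - x), div_nonneg (by linarith) h0.le, ?_⟩
    have : 1 + (x - 23 / 50) / (1 - x) = (27 / 50) / (1 - x) := by field_simp; ring
    rw [this]; field_simp; ring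
  obtain ⟨s, hs, hks⟩ : ∃ s : ℝ, 0 ≤ s ∧ κ = s / (1 + s) := by
    have h0 : 0 < 1 - κ := by linarith
    refine ⟨κ / (1 - κ), by positivity, ?_⟩
    have : 1 + κ / (1 - κ) = 1 / (1 - κ) := by field_simp; ring
    rw [this]; field_simp
  have e1 : 1 + p ≠ 0 := by positivity
  have e2 : 1 + s ≠ 0 := by positivity
  have h1 : 1 - κ * x = (1 + p + s * (27 / 50)) / ((1 + s) * (1 + p)) := by
    rw [hks, hxp]; field_simp; ring
  rw [h1, hks, hxp]
  field_simp
  ring_nf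
  positivity

lemma interior_middle (hκ1 : κ < 1) (hκ : 1 ≤ κ * (2 + 3 * x)) (hx : 23 / 50 ≤ x) (hx1 : x < 1)
    (hh : 0 ≤ h) (hhx : h ≤ 2 * x)
    (hD : 0 < D) (hDh : 1 + h ^ 2 ≤ D ^ 2) (hg : g ^ 2 ≤ h * (2 * x - h))
    (hH : H ≤ κ * (2 * x - h / 2)) (he : 2 * D * e ≤ 2 * D ^ 2 + g ^ 2) (hκ0 : 0 ≤ κ)
    (hκx : κ * x ≤ 1) :
    κ * H ≤ (D - 80 * (1 - κ * x) / (71 + 20 * x) * e) * (1 + κ ^ 2) := by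
  have hΓ : 0 < 71 + 20 * x := by linarith
  obtain ⟨q, hq⟩ : ∃ q, q = 80 * (1 - κ * x) / (71 + 20 * x) := ⟨_, rfl⟩
  have hqΓ : q * (71 + 20 * x) = 80 * (1 - κ * x) := by rw [hq]; field_simp
  have hq0 : 0 ≤ q := by rw [hq]; apply div_nonneg _ hΓ.le; linarith
  rw [← hq]
  have hC := interior_middle_const hx hx1 hκ hκ1
  have hC' : 0 ≤ (1 - q) * (1 + κ ^ 2) - 2 * x * κ ^ 2 := by
    refine nonneg_of_mul_nonneg_left (b := 71 + 20 * x) ?_ hΓ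
    linear_combination hC + (1 + κ ^ 2) * hqΓ
  refine interior_of_quadratic hh hhx hD hDh hg hH he hq0 hκ0 hC' ?_
  refine quadratic_nonneg_of_discrim (τ := κ ^ 2 / 2 * (2 * x - 23 / 25)) ?_ hC' ?_ hh ?_
  · have : 0 < (1 + κ ^ 2) / 2 := by positivity
    linear_combination this + hC' / 2
  · apply mul_nonneg (by positivity); linarith
  · refine nonneg_of_mul_nonneg_left (b := (71 + 20 * x) ^ 2) ?_ (by positivity)
    have := discrim_middle hx hx1 hκ hκ1
    rw [← hqΓ] at this
    linear_combination this

/-- The right side of the test, as a quadratic in `u`, is smallest at `u = H / (2 D)`. -/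
lemma first_test_of_vertex (hE : 4 * D * (q * e) * (1 + κ ^ 2) ≤ 4 * D ^ 2 - H ^ 2) (hD : 0 < D)
    (hu0 : 0 ≤ u0) (hu0κ : u0 ≤ κ) (hq : 0 ≤ q) (he : 0 ≤ e) :
    q * e * (1 + u0 ^ 2) ≤ D * (1 + u ^ 2) - H * u := by
  have h5 : q * e * (1 + u0 ^ 2) ≤ q * e * (1 + κ ^ 2) := by gcongr
  refine h5.trans ?_
  have : (4 * D) * (q * e * (1 + κ ^ 2)) ≤ (4 * D) * (D * (1 + u ^ 2) - H * u) := by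
    linear_combination hE + sq_nonneg (2 * D * u - H)
  exact le_of_mul_le_mul_left this (by linarith)

/-- The condition of `first_test_of_vertex` for `x ≥ 1`, again by a quadratic in `h`. -/
lemma vertex_large (hκ : 1 ≤ κ * (2 + 3 * x)) (hx : 1 ≤ x) (hκx : κ * x < 1)
    (hh : 0 ≤ h)
    (hDh : 1 + h ^ 2 ≤ D ^ 2) (hg : g ^ 2 ≤ h * (2 * x - h)) (hH0 : 0 ≤ H)
    (hH : H ≤ κ * (2 * x - h / 2)) (he : 2 * D * e ≤ 2 * D ^ 2 + g ^ 2) (hκ0 : 0 ≤ κ) :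
    4 * D * (8 * (1 - κ * x) / (6 + 3 * x) * e) * (1 + κ ^ 2) ≤ 4 * D ^ 2 - H ^ 2 := by
  have hΓ : 0 < 6 + 3 * x := by linarith
  have hκ1 : κ ≤ 1 := by nlinarith
  obtain ⟨q, hq⟩ : ∃ q, q = 8 * (1 - κ * x) / (6 + 3 * x) := ⟨_, rfl⟩
  have hqΓ : q * (6 + 3 * x) = 8 * (1 - κ * x) := by rw [hq]; field_simp
  have hq0 : 0 < q := by rw [hq]; apply div_pos _ hΓ; linarith
  rw [← hq]
  have hC : 0 ≤ 4 - 4 * (q * (1 + κ ^ 2)) - 4 * κ ^ 2 * x ^ 2 := by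
    refine nonneg_of_mul_nonneg_left (b := 6 + 3 * x) ?_ hΓ
    have h1 : 0 ≤ (6 + 3 * x) * (1 + κ * x) - 8 * (1 + κ ^ 2) := by nlinarith
    have h2 := mul_nonneg (by linarith : 0 ≤ 1 - κ * x) h1
    linear_combination 4 * h2 + 4 * (1 + κ ^ 2) * hqΓ
  have hQ : 0 ≤ (4 - 2 * (q * (1 + κ ^ 2)) - κ ^ 2 / 4) * h ^ 2 +
      (-(4 * x * (q * (1 + κ ^ 2)) - 2 * κ ^ 2 * x)) * h +
      (4 - 4 * (q * (1 + κ ^ 2)) - 4 * κ ^ 2 * x ^ 2) := by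
    refine quadratic_nonneg_of_discrim (τ := 2 * κ ^ 2 * x) ?_ hC (by positivity) hh ?_
    · have h1 : 0 < q * (1 + κ ^ 2) := by positivity
      have h2 : κ ^ 2 * 1 ≤ κ ^ 2 * x ^ 2 := by gcongr; nlinarith
      nlinarith [sq_nonneg κ]
    · refine nonneg_of_mul_nonneg_left (b := (6 + 3 * x) ^ 2) ?_ (by positivity)
      have := discrim_large hx hκ hκx
      have e16 : 16 * (1 - κ * x) = 2 * (q * (6 + 3 * x)) := by rw [hqΓ]; ring
      have e32 : 32 * (1 - κ * x) = 4 * (q * (6 + 3 * x)) := by rw [hqΓ]; ring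
      have e32x : 32 * x * (1 - κ * x) = 4 * x * (q * (6 + 3 * x)) := by rw [hqΓ]; ring
      rw [e16, e32, e32x] at this
      linear_combination this
  have h1 : 4 * D * (q * e) ≤ q * (4 * D ^ 2 + 2 * g ^ 2) := by nlinarith
  have h2 : H ^ 2 ≤ (κ * (2 * x - h / 2)) ^ 2 := by gcongr
  have h3 : 0 ≤ 4 - 4 * (q * (1 + κ ^ 2)) := by nlinarith [sq_nonneg (κ * x)]
  have h4 := mul_nonneg h3 (sub_nonneg.2 hDh)
  have h5 : q * (1 + κ ^ 2) * g ^ 2 ≤ q * (1 + κ ^ 2) * (h * (2 * x - h)) := by gcongr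
  have h6 := mul_le_mul_of_nonneg_right h1 (by positivity : 0 ≤ 1 + κ ^ 2)
  linear_combination h6 + h2 + h4 + 2 * h5 + hQ

end moment
lemma one_le_of_one_add_sq_le {D h : ℝ} (hD : 0 < D) (hDh : 1 + h ^ 2 ≤ D ^ 2) : 1 ≤ D :=
  (one_le_sq_iff₀ hD.le).1 (by linarith [sq_nonneg h])

/-- The second-moment test succeeds if `κ (2 + 3 x) ≤ 1`. -/
lemma full_test {κ x m X h g D H u u0 q : ℝ} (hκ : 0 ≤ κ) (hx : 0 ≤ x)
    (hκx : κ * (2 + 3 * x) ≤ 1) (hm1 : 1 ≤ m)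
    (hm : x + 1 ≤ m * (1 + X / √(1 + X ^ 2)))
    (hh : 0 ≤ h) (hD : 0 < D) (hDh : 1 + h ^ 2 ≤ D ^ 2)
    (hg : g ^ 2 ≤ h * (2 * x - h)) (hH0 : 0 ≤ H)
    (hH : H ≤ κ * (2 * x - h / 2)) (hu0 : 0 ≤ u0) (hu0u : u0 ≤ u) (hu0κ : u0 ≤ κ)
    (hq0 : 0 ≤ q) (hq1 : q ≤ 1 - κ * x) (hqm : q * m ≤ 1 - κ * x) :
    (D ^ 2 + g ^ 2) * q ^ 2 * (1 + u0 ^ 2)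
      ≤ D ^ 2 + g ^ 2 + D ^ 2 * u ^ 2 - 2 * D * u * H - H ^ 2 := by
  have hH' : H ≤ κ * (2 * x) := by linarith [mul_nonneg hκ hh]
  have hD1 : 1 ≤ D ^ 2 := by linarith [sq_nonneg h]
  rcases le_total x (1 / 3) with h3 | h3
  · have hgx : g ^ 2 ≤ x ^ 2 := by linarith [sq_nonneg (x - h)]
    have := full_test_small hκ hx hκx h3 hD hD1 hgx hH0 hH' hu0 hu0u hu0κ
    refine le_trans ?_ this
    gcongr
  · refine full_test_crude hκ h3 hκx hD1 hH0 hH' hu0 hu0κ hq0 hq1 ?_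
    have h4 := zeta_le_one (X := X)
    have h5 : m * (1 + X / √(1 + X ^ 2)) ≤ m * 2 := by gcongr; linarith
    have h6 : q * (x + 1) ≤ q * (m * 2) := by gcongr; linarith
    linarith

/-- The first-moment test succeeds if `κ (2 + 3 x) ≥ 1`. -/
lemma first_test {κ x m X h g D e H u u0 q : ℝ} (hκ0 : 0 < κ) (hx : 0 ≤ x) (hxX : x ≤ X)
    (hκX : κ * X < 1) (hcase : 1 ≤ κ * (2 + 3 * x)) (hm1 : 1 ≤ m)
    (hm : x + 1 ≤ m * (1 + X / √(1 + X ^ 2)))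
    (hh : 0 ≤ h) (hhx : h ≤ 2 * x) (hD : 0 < D) (hDh : 1 + h ^ 2 ≤ D ^ 2)
    (hg : g ^ 2 ≤ h * (2 * x - h)) (hH0 : 0 ≤ H)
    (hH : H ≤ κ * (2 * x - h / 2)) (hu0 : 0 ≤ u0) (hu0u : u0 ≤ u) (hu0κ : u0 ≤ κ)
    (he0 : 0 ≤ e) (he : 2 * D * e ≤ 2 * D ^ 2 + g ^ 2)
    (hq : q = (1 - κ * X) / m) (hq0 : 0 ≤ q) (hq1 : q ≤ 1 - κ * x) :
    q * e * (1 + u0 ^ 2) ≤ D * (1 + u ^ 2) - H * u := by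
  have hX : 0 ≤ X := hx.trans hxX
  have hm0 : 0 < m := by linarith
  have hζ0 : 0 ≤ X / √(1 + X ^ 2) := by positivity
  have hH' : H ≤ κ * (2 * x) := by linarith [mul_nonneg hκ0.le hh]
  have hD1 : 1 ≤ D := one_le_of_one_add_sq_le hD hDh
  have hκx : κ * x < 1 := lt_of_le_of_lt (by gcongr) hκX
  rcases le_or_gt 1 κ with hκ1 | hκ1
  · exact first_test_of_le_half
      (first_test_kappa_large hκ1 hx hh hD1 hg hH he hq0 hq1) hu0 hu0u hq0 he0 hH0
  · rcases lt_or_ge x 1 with hx1 | hx1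
    · have hHD : H ≤ 2 * κ * D := by
        have : κ * (2 * x) ≤ κ * (2 * D) := by gcongr; linarith
        linarith
      have hE : κ * H ≤ (D - q * e) * (1 + κ ^ 2) := by
        rcases lt_or_ge x (23 / 50) with hx2 | hx2
        · refine (interior_small hκ1 hcase hx hx2 hh hhx hD hDh hg hH he hκ0.le).trans ?_
          gcongr
        · refine (interior_middle hκ1 hcase hx2 hx1 hh hhx hD hDh hg hH he hκ0.le hκx.le).trans ?_
          gcongr
          rw [hq, div_le_div_iff₀ hm0 (by linarith)]
          linarith [gain_middle hx2 hxX hcase hκX hζ0 (zeta_le_rational hX) hm hx1.le]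
      exact first_test_of_interior hκ0 hE hHD hH0 hu0 hu0u hu0κ hκ1.le hq0 he0
    · have hE := vertex_large hcase hx1 hκx hh hDh hg hH0 hH he hκ0.le
      refine first_test_of_vertex (κ := κ) (le_trans ?_ hE) hD hu0 hu0κ hq0 he0
      gcongr
      rw [hq, div_le_div_iff₀ hm0 (by linarith)]
      linarith [gain_large hx1 hxX hcase hκX hζ0 (zeta_le_rational hX) zeta_le_one hm]

/-- A successful second-moment test gives the bound. -/
lemma sqrt_test {q e u u0 B S : ℝ} (hB : 0 ≤ B) (hu0 : 0 ≤ u0) (hu0u : u0 ≤ u) (hS0 : 0 ≤ S)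
    (h1 : (q * e) ^ 2 * (1 + u0 ^ 2) ≤ B ^ 2) (hS : B * √(1 + u ^ 2) ≤ S * (1 + u0 ^ 2)) :
    q * e ≤ S := by
  have h2 : B * √(1 + u0 ^ 2) ≤ S * (1 + u0 ^ 2) := by
    refine le_trans ?_ hS
    gcongr
  have h3 : √(1 + u0 ^ 2) ^ 2 = 1 + u0 ^ 2 := Real.sq_sqrt (by positivity)
  have h4 : B ≤ S * √(1 + u0 ^ 2) := by
    have h5 : 0 < √(1 + u0 ^ 2) := by positivity
    refine le_of_mul_le_mul_right ?_ h5
    rw [mul_assoc, ← pow_two, h3]; exact h2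
  have h5 : B ^ 2 ≤ S ^ 2 * (1 + u0 ^ 2) := by
    rw [← h3, ← mul_pow]; gcongr
  have h6 : (q * e) ^ 2 ≤ S ^ 2 :=
    le_of_mul_le_mul_right (h1.trans h5) (by positivity)
  exact abs_le_of_sq_le_sq' h6 hS0 |>.2

/-- The error bound in scalar form. In units of the norm of the tangent part of the error `Z` and of
`ϑ₋(2 r + 2 s)`, the numbers stand for the following: `D` and `g` are the norms of the main part `J`
(the tangent part and the leading `s` singular values of the normal part) and of the tail, `h` is
the sum of these singular values divided by `√s`, `H` is `κ` times the sum of the norms of the blocks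
of the tail, `1 + u ^ 2` is the Rayleigh quotient of `J`, `1 + u0 ^ 2` is `ϑ₋(2 r + s)`, and
`B` bounds `‖𝒜 Z‖`. The hypotheses `hV1` and `hV2` are the two consequences of that bound, for
`⟨𝒜 J, 𝒜 Z⟩` and for `‖𝒜 Z‖²`. -/
theorem numeric_bound {κ x X m h g D H u u0 B S : ℝ} (hκ : 0 ≤ κ) (hx : 0 ≤ x) (hxX : x ≤ X)
    (hκX : κ * X < 1) (hm1 : 1 ≤ m) (hm : x + 1 ≤ m * (1 + X / √(1 + X ^ 2)))
    (hh : 0 ≤ h) (hhx : h ≤ 2 * x) (hD : 0 < D) (hDh : 1 + h ^ 2 ≤ D ^ 2)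
    (hg : g ^ 2 ≤ h * (2 * x - h)) (hH0 : 0 ≤ H)
    (hH : H ≤ κ * (2 * x - h / 2)) (hu0 : 0 ≤ u0) (hu0u : u0 ≤ u) (hu0κ : u0 ≤ κ) (hB : 0 ≤ B)
    (hV1 : D * (1 + u ^ 2) - H * u ≤ B * √(1 + u ^ 2))
    (hV2 : D ^ 2 + g ^ 2 + D ^ 2 * u ^ 2 - 2 * D * u * H - H ^ 2 ≤ B ^ 2)
    (hS : B * √(1 + u ^ 2) ≤ S * (1 + u0 ^ 2)) :
    √(D ^ 2 + g ^ 2) * (1 - κ * X) ≤ m * S := by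
  have hX : 0 ≤ X := hx.trans hxX
  have hm0 : 0 < m := by linarith
  obtain ⟨q, hq⟩ : ∃ q, q = (1 - κ * X) / m := ⟨_, rfl⟩
  have hqm : q * m = 1 - κ * X := by rw [hq]; field_simp
  have hq0 : 0 ≤ q := by rw [hq]; apply div_nonneg _ hm0.le; linarith
  have hκxX : κ * x ≤ κ * X := by gcongr
  have hq1 : q ≤ 1 - κ * x := by
    have := mul_le_mul_of_nonneg_left hm1 hq0
    linarith
  have he0 : 0 ≤ √(D ^ 2 + g ^ 2) := Real.sqrt_nonneg _
  have he2 : √(D ^ 2 + g ^ 2) ^ 2 = D ^ 2 + g ^ 2 := Real.sq_sqrt (by positivity)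
  have he : 2 * D * √(D ^ 2 + g ^ 2) ≤ 2 * D ^ 2 + g ^ 2 := two_mul_sqrt_le hD
  generalize √(D ^ 2 + g ^ 2) = e at he0 he2 he ⊢
  have hS0 : 0 ≤ S := by
    have : 0 ≤ S * (1 + u0 ^ 2) := le_trans (by positivity) hS
    exact nonneg_of_mul_nonneg_left this (by positivity)
  suffices hmain : q * e ≤ S by
    rw [← hqm]
    have := mul_le_mul_of_nonneg_right hmain hm0.le
    linarith
  rcases le_total (κ * (2 + 3 * x)) 1 with hcase | hcase
  · have hfull := full_test hκ hx hcase hm1 hm hh hD hDh hg hH0 hH hu0 hu0u hu0κ hq0 hq1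
      (by linarith)
    refine sqrt_test hB hu0 hu0u hS0 ?_ hS
    rw [mul_pow, he2, mul_comm (q ^ 2)]
    exact hfull.trans hV2
  · have hκ0 : 0 < κ := by
      rcases hκ.eq_or_lt with h0 | h0
      · rw [← h0] at hcase; linarith
      · exact h0
    have hfirst := first_test hκ0 hx hxX hκX hcase hm1 hm hh hhx hD hDh hg hH0 hH hu0 hu0u hu0κ
      he0 he hq hq0 hq1
    exact le_of_mul_le_mul_right (hfirst.trans (hV1.trans hS)) (by positivity)

/-- The bound by the value of `Ξ` at the cone parameter itself, in the units of `numeric_bound`. -/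
theorem crude_bound {κ x h g D H u u0 B S : ℝ} (hκ : 0 ≤ κ) (hx : 0 ≤ x)
    (hκx : κ * x < 1)
    (hh : 0 ≤ h) (hD : 0 < D) (hDh : 1 + h ^ 2 ≤ D ^ 2)
    (hg : g ^ 2 ≤ h * (2 * x - h))
    (hH : H ≤ κ * (2 * x - h / 2)) (hu0 : 0 ≤ u0) (hu0u : u0 ≤ u)
    (hV1 : D * (1 + u ^ 2) - H * u ≤ B * √(1 + u ^ 2))
    (hS : B * √(1 + u ^ 2) ≤ S * (1 + u0 ^ 2)) :
    √(D ^ 2 + g ^ 2) * (1 - κ * x) ≤ S * √(1 + x ^ 2) := by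
  have hu : 0 ≤ u := hu0.trans hu0u
  have hD1 : 1 ≤ D := one_le_of_one_add_sq_le hD hDh
  have hgx : g ^ 2 ≤ x ^ 2 := by nlinarith [sq_nonneg (x - h)]
  have h1 : H * u ≤ D * (κ * x) * (1 + u ^ 2) := by
    have hH' : H ≤ κ * (2 * x) := by linarith [mul_nonneg hκ hh]
    have hκx0 : 0 ≤ κ * x := by positivity
    have h2 : H * u ≤ κ * x * (2 * u) := by nlinarith
    have h3 : κ * x * (2 * u) ≤ κ * x * (1 + u ^ 2) := by
      gcongr; nlinarith [sq_nonneg (u - 1)]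
    have h4 : κ * x * (1 + u ^ 2) ≤ D * (κ * x * (1 + u ^ 2)) := by
      have : 0 ≤ κ * x * (1 + u ^ 2) := by positivity
      nlinarith
    linarith
  have h2 : D * (1 - κ * x) * (1 + u0 ^ 2) ≤ S * (1 + u0 ^ 2) := by
    have h3 : D * (1 - κ * x) * (1 + u0 ^ 2) ≤ D * (1 - κ * x) * (1 + u ^ 2) := by
      have : 0 ≤ D * (1 - κ * x) := mul_nonneg hD.le (by linarith)
      gcongr
    linarith
  have h3 : D * (1 - κ * x) ≤ S := le_of_mul_le_mul_right h2 (by positivity)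
  have h4 : √(D ^ 2 + g ^ 2) ≤ D * √(1 + x ^ 2) := by
    apply Real.sqrt_le_iff.2 ⟨by positivity, ?_⟩
    rw [mul_pow, Real.sq_sqrt (by positivity)]
    have : 1 * g ^ 2 ≤ D ^ 2 * x ^ 2 := by
      apply mul_le_mul _ hgx (by positivity) (by positivity)
      nlinarith
    linarith
  calc √(D ^ 2 + g ^ 2) * (1 - κ * x) ≤ D * √(1 + x ^ 2) * (1 - κ * x) := by
        gcongr
    _ = D * (1 - κ * x) * √(1 + x ^ 2) := by ring
    _ ≤ S * √(1 + x ^ 2) := by gcongr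

/-! ### The trace inner product -/

section traceInner
open Matrix
variable {n₁ n₂ : ℕ} {ι : Type*} (X Y Z : Matrix (Fin n₁) (Fin n₂) ℝ)

lemma traceInner_eq_sum : traceInner X Y = ∑ i, ∑ j, X i j * Y i j := by
  simp only [traceInner, Matrix.trace, Matrix.diag, Matrix.mul_apply, Matrix.transpose_apply]
  exact Finset.sum_comm

/-- The entries of a matrix as a Euclidean vector; the trace inner product is the Euclidean one. -/
def entries (X : Matrix (Fin n₁) (Fin n₂) ℝ) : EuclideanSpace ℝ (Fin n₁ × Fin n₂) :=
  WithLp.toLp 2 fun p => X p.1 p.2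

lemma inner_entries : inner ℝ (entries X) (entries Y) = traceInner X Y := by
  rw [traceInner_eq_sum, PiLp.inner_apply, Fintype.sum_prod_type]
  simp [entries, mul_comm]

lemma traceInner_comm : traceInner X Y = traceInner Y X := by
  simp only [traceInner_eq_sum, mul_comm]

lemma traceInner_add_left : traceInner (X + Y) Z = traceInner X Z + traceInner Y Z := by
  simp [traceInner, Matrix.add_mul]

lemma traceInner_add_right : traceInner X (Y + Z) = traceInner X Y + traceInner X Z := by
  simp [traceInner, Matrix.mul_add]

lemma traceInner_sub_left : traceInner (X - Y) Z = traceInner X Z - traceInner Y Z := by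
  simp [traceInner, Matrix.sub_mul]

lemma traceInner_sub_right : traceInner X (Y - Z) = traceInner X Y - traceInner X Z := by
  simp [traceInner, Matrix.mul_sub]

lemma traceInner_smul_left (a : ℝ) : traceInner (a • X) Y = a * traceInner X Y := by
  simp [traceInner]

lemma traceInner_smul_right (a : ℝ) : traceInner X (a • Y) = a * traceInner X Y := by
  simp [traceInner]

lemma traceInner_sum_left (t : Finset ι) (F : ι → Matrix (Fin n₁) (Fin n₂) ℝ) :
    traceInner (∑ i ∈ t, F i) Y = ∑ i ∈ t, traceInner (F i) Y := by
  simp [traceInner, Matrix.transpose_sum, Matrix.sum_mul, Matrix.trace_sum]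

lemma traceInner_sum_right (t : Finset ι) (F : ι → Matrix (Fin n₁) (Fin n₂) ℝ) :
    traceInner X (∑ i ∈ t, F i) = ∑ i ∈ t, traceInner X (F i) := by
  simp [traceInner, Matrix.mul_sum, Matrix.trace_sum]

@[simp] lemma traceInner_zero_left : traceInner 0 X = 0 := by simp [traceInner]

@[simp] lemma traceInner_zero_right : traceInner X 0 = 0 := by simp [traceInner]

lemma frobNorm_eq_norm : frobNorm X = ‖entries X‖ := by
  rw [frobNorm, ← inner_entries, real_inner_self_eq_norm_sq, Real.sqrt_sq (norm_nonneg _)]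

lemma frobNorm_nonneg : 0 ≤ frobNorm X := Real.sqrt_nonneg _

lemma traceInner_self_eq : traceInner X X = frobNorm X ^ 2 := by
  rw [frobNorm_eq_norm, ← inner_entries, real_inner_self_eq_norm_sq]

lemma traceInner_le : traceInner X Y ≤ frobNorm X * frobNorm Y := by
  rw [frobNorm_eq_norm, frobNorm_eq_norm, ← inner_entries]
  exact real_inner_le_norm _ _

lemma frobNorm_neg : frobNorm (-X) = frobNorm X := by
  simp [frobNorm, traceInner]

lemma frobNorm_eq_zero : frobNorm X = 0 ↔ X = 0 := by
  rw [frobNorm_eq_norm, norm_eq_zero]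
  constructor
  · intro h
    ext i j
    exact congrArg (fun e : EuclideanSpace ℝ (Fin n₁ × Fin n₂) => e (i, j)) h
  · rintro rfl; rfl

lemma frobNorm_sq_sub : frobNorm (X - Y) ^ 2
    = frobNorm X ^ 2 - 2 * traceInner X Y + frobNorm Y ^ 2 := by
  simp only [← traceInner_self_eq, traceInner_sub_left, traceInner_sub_right]
  rw [traceInner_comm Y X]; ring

lemma frobNorm_sq_add : frobNorm (X + Y) ^ 2
    = frobNorm X ^ 2 + 2 * traceInner X Y + frobNorm Y ^ 2 := by
  simp only [← traceInner_self_eq, traceInner_add_left, traceInner_add_right]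
  rw [traceInner_comm Y X]; ring

lemma frobNorm_le_of_sq_le {a : ℝ} (ha : 0 ≤ a) (h : frobNorm X ^ 2 ≤ a ^ 2) : frobNorm X ≤ a :=
  abs_le_of_sq_le_sq' h ha |>.2

end traceInner

/-! ### Orthonormal families and rank-one matrices -/

section orth
open Matrix
variable {n n₁ n₂ : ℕ} {ι κ : Type*}

/-- The vectors `u i` are orthonormal. -/
structure Orth (u : ι → Fin n → ℝ) : Prop where
  self : ∀ i, u i ⬝ᵥ u i = 1
  ne : ∀ i j, i ≠ j → u i ⬝ᵥ u j = 0

lemma Orth.comp {u : ι → Fin n → ℝ} (hu : Orth u) {f : κ → ι} (hf : Function.Injective f) :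
    Orth (fun k => u (f k)) :=
  ⟨fun _ => hu.self _, fun _ _ hij => hu.ne _ _ (hf.ne hij)⟩

lemma Orth.sumElim {u : ι → Fin n → ℝ} {x : κ → Fin n → ℝ} (hu : Orth u) (hx : Orth x)
    (h : ∀ i k, u i ⬝ᵥ x k = 0) : Orth (Sum.elim u x) := by
  refine ⟨?_, ?_⟩
  · rintro (i | k)
    · exact hu.self i
    · exact hx.self k
  · rintro (i | k) (j | l) hij
    · exact hu.ne _ _ (by simpa using hij)
    · exact h _ _
    · exact (dotProduct_comm _ _).trans (h _ _)
    · exact hx.ne _ _ (by simpa using hij)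

lemma Orth.unique {x : Fin n → ℝ} (hx : x ⬝ᵥ x = 1) : Orth (fun _ : Unit => x) :=
  ⟨fun _ => hx, fun _ _ hij => (hij (Subsingleton.elim _ _)).elim⟩

/-- The rank-one matrices `u i (v i)ᵀ` are orthonormal for the trace inner product. -/
lemma Orth.mul_eq_ite [DecidableEq ι] {u : ι → Fin n₁ → ℝ} {v : ι → Fin n₂ → ℝ} (hu : Orth u)
    (hv : Orth v) (i j : ι) : (u i ⬝ᵥ u j) * (v i ⬝ᵥ v j) = if i = j then 1 else 0 := by
  split_ifs with h
  · rw [h, hu.self, hv.self, one_mul]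
  · rw [hu.ne i j h, zero_mul]

variable [Fintype ι] [Fintype κ]

lemma Orth.bessel {u : ι → Fin n → ℝ} (hu : Orth u) (x : Fin n → ℝ) :
    ∑ i, (u i ⬝ᵥ x) ^ 2 ≤ x ⬝ᵥ x := by
  have ho : Orthonormal ℝ (fun i => (WithLp.toLp 2 (u i) : EuclideanSpace ℝ (Fin n))) := by
    refine ⟨fun i => ?_, fun i j hij => ?_⟩
    · rw [norm_eq_sqrt_real_inner, EuclideanSpace.inner_toLp_toLp]
      simp [hu.self i]
    · change inner ℝ (WithLp.toLp 2 (u i)) (WithLp.toLp 2 (u j)) = (0 : ℝ)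
      rw [EuclideanSpace.inner_toLp_toLp]
      simpa using hu.ne j i hij.symm
  have h := ho.sum_inner_products_le (WithLp.toLp 2 x) (s := Finset.univ)
  have h2 : ‖(WithLp.toLp 2 x : EuclideanSpace ℝ (Fin n))‖ ^ 2 = x ⬝ᵥ x := by
    rw [← real_inner_self_eq_norm_sq, EuclideanSpace.inner_toLp_toLp]; simp
  rw [h2] at h
  refine le_trans (le_of_eq ?_) h
  refine Finset.sum_congr rfl fun i _ => ?_
  rw [EuclideanSpace.inner_toLp_toLp, Real.norm_eq_abs, sq_abs]
  simp [dotProduct_comm]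

lemma abs_mul_le_half (a b : ℝ) : |a * b| ≤ (a ^ 2 + b ^ 2) / 2 := by
  rw [abs_le]; constructor <;> nlinarith [sq_nonneg (a + b), sq_nonneg (a - b)]

/-- The Bessel inequality in both factors of a sum of products. -/
lemma sum_abs_mul_le_one {u : ι → Fin n₁ → ℝ} {v : ι → Fin n₂ → ℝ} (hu : Orth u) (hv : Orth v)
    {x : Fin n₁ → ℝ} {y : Fin n₂ → ℝ} (hx : x ⬝ᵥ x = 1) (hy : y ⬝ᵥ y = 1) :
    ∑ i, |(u i ⬝ᵥ x) * (v i ⬝ᵥ y)| ≤ 1 := by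
  have h1 := hu.bessel x
  have h2 := hv.bessel y
  calc ∑ i, |(u i ⬝ᵥ x) * (v i ⬝ᵥ y)| ≤ ∑ i, ((u i ⬝ᵥ x) ^ 2 + (v i ⬝ᵥ y) ^ 2) / 2 :=
        Finset.sum_le_sum fun i _ => abs_mul_le_half _ _
    _ ≤ 1 := by
        rw [← Finset.sum_div, Finset.sum_add_distrib]; linarith

lemma traceInner_vecMulVec (x : Fin n₁ → ℝ) (y : Fin n₂ → ℝ) (Z : Matrix (Fin n₁) (Fin n₂) ℝ) :
    traceInner (vecMulVec x y) Z = x ⬝ᵥ (Z *ᵥ y) := by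
  rw [traceInner_eq_sum]
  simp only [vecMulVec_apply, dotProduct, mulVec, Finset.mul_sum]
  refine Finset.sum_congr rfl fun i _ => Finset.sum_congr rfl fun j _ => by ring

lemma traceInner_vecMulVec_vecMulVec (x x' : Fin n₁ → ℝ) (y y' : Fin n₂ → ℝ) :
    traceInner (vecMulVec x y) (vecMulVec x' y') = (x ⬝ᵥ x') * (y ⬝ᵥ y') := by
  rw [traceInner_vecMulVec, vecMulVec_mulVec]
  simp [dotProduct_smul, dotProduct_comm y y', mul_comm]

/-- The matrix `∑ᵢ wᵢ uᵢ vᵢᵀ`. -/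
def tensorSum (w : ι → ℝ) (u : ι → Fin n₁ → ℝ) (v : ι → Fin n₂ → ℝ) :
    Matrix (Fin n₁) (Fin n₂) ℝ :=
  ∑ i, w i • vecMulVec (u i) (v i)

lemma traceInner_tensorSum_left (w : ι → ℝ) (u : ι → Fin n₁ → ℝ) (v : ι → Fin n₂ → ℝ)
    (Z : Matrix (Fin n₁) (Fin n₂) ℝ) :
    traceInner (tensorSum w u v) Z = ∑ i, w i * (u i ⬝ᵥ (Z *ᵥ v i)) := by
  simp only [tensorSum, traceInner_sum_left, traceInner_smul_left, traceInner_vecMulVec]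

lemma dotProduct_tensorSum_mulVec (w : ι → ℝ) (u : ι → Fin n₁ → ℝ) (v : ι → Fin n₂ → ℝ)
    (x : Fin n₁ → ℝ) (y : Fin n₂ → ℝ) :
    x ⬝ᵥ (tensorSum w u v *ᵥ y) = ∑ i, w i * ((u i ⬝ᵥ x) * (v i ⬝ᵥ y)) := by
  rw [← traceInner_vecMulVec, traceInner_comm]
  simp only [tensorSum, traceInner_sum_left, traceInner_smul_left, traceInner_vecMulVec_vecMulVec]

lemma traceInner_tensorSum_tensorSum (w : ι → ℝ) (u : ι → Fin n₁ → ℝ) (v : ι → Fin n₂ → ℝ)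
    (w' : κ → ℝ) (u' : κ → Fin n₁ → ℝ) (v' : κ → Fin n₂ → ℝ) :
    traceInner (tensorSum w u v) (tensorSum w' u' v')
      = ∑ i, ∑ j, w i * w' j * ((u i ⬝ᵥ u' j) * (v i ⬝ᵥ v' j)) := by
  rw [traceInner_tensorSum_left]
  refine Finset.sum_congr rfl fun i _ => ?_
  rw [dotProduct_tensorSum_mulVec, Finset.mul_sum]
  refine Finset.sum_congr rfl fun j _ => ?_
  rw [dotProduct_comm (u' j), dotProduct_comm (v' j)]; ring

lemma frobNorm_sq_tensorSum [DecidableEq ι] {u : ι → Fin n₁ → ℝ} {v : ι → Fin n₂ → ℝ} {w : ι → ℝ}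
    (h : ∀ i j, w i ≠ 0 → w j ≠ 0 → (u i ⬝ᵥ u j) * (v i ⬝ᵥ v j) = if i = j then 1 else 0) :
    frobNorm (tensorSum w u v) ^ 2 = ∑ i, w i ^ 2 := by
  rw [← traceInner_self_eq, traceInner_tensorSum_tensorSum]
  refine Finset.sum_congr rfl fun i _ => ?_
  rw [Finset.sum_eq_single i]
  · by_cases hi : w i = 0
    · simp [hi]
    · rw [h i i hi hi]; simp [pow_two]
  · intro j _ hji
    by_cases hi : w i = 0
    · simp [hi]
    by_cases hj : w j = 0
    · simp [hj]
    rw [h i j hi hj, if_neg hji.symm, mul_zero]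
  · simp

end orth

/-! ### Perturbation of singular values and of leading singular vectors -/

section indicator
variable {n : ℕ}

/-- The indicator of the first `r` indices. -/
def ind {n : ℕ} (r : ℕ) (i : Fin n) : ℝ := if (i : ℕ) < r then 1 else 0

lemma ind_nonneg (r : ℕ) (i : Fin n) : 0 ≤ ind r i := by unfold ind; split_ifs <;> norm_num

lemma ind_le_one (r : ℕ) (i : Fin n) : ind r i ≤ 1 := by unfold ind; split_ifs <;> norm_num

lemma ind_sq (r : ℕ) (i : Fin n) : ind r i ^ 2 = ind r i := by unfold ind; split_ifs <;> norm_num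

lemma sum_ind {r : ℕ} (hr : r ≤ n) : ∑ i : Fin n, ind r i = r := by
  unfold ind
  rw [Fin.sum_univ_eq_sum_range (fun i => if i < r then (1 : ℝ) else 0), Finset.sum_ite,
    Finset.sum_const_zero, add_zero, Finset.sum_const, nsmul_eq_mul, mul_one]
  congr 1
  rw [show (Finset.range n).filter (· < r) = Finset.range r by ext; simp; omega, Finset.card_range]

lemma sum_ind_mul_ind (r l : ℕ) : ∑ i : Fin n, ind r i * ind l i = ∑ i : Fin n, ind (min r l) i := by
  refine Finset.sum_congr rfl fun i _ => ?_
  unfold ind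
  by_cases h1 : (i : ℕ) < r <;> by_cases h2 : (i : ℕ) < l <;> simp [h1, h2]

/-- Summation by parts: an antitone sequence as a combination of indicators. -/
lemma eq_sum_ind {σ : ℕ → ℝ} (h0 : σ n = 0) (i : Fin n) :
    σ i = ∑ k : Fin n, (σ k - σ (k + 1)) * ind (k + 1) i := by
  have h1 : ∀ N, (i : ℕ) ≤ N → ∑ k ∈ Finset.range N, (σ k - σ (k + 1)) * (if (i : ℕ) < k + 1 then 1 else 0)
      = σ i - σ N := by
    intro N hN
    induction N, hN using Nat.le_induction with
    | base =>
      rw [sub_self]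
      refine Finset.sum_eq_zero fun k hk => ?_
      rw [if_neg (by have := Finset.mem_range.1 hk; omega), mul_zero]
    | succ N hN ih => rw [Finset.sum_range_succ, ih, if_pos (by omega)]; ring
  have h2 := h1 n i.2.le
  rw [h0, sub_zero] at h2
  rw [← h2, ← Fin.sum_univ_eq_sum_range (fun k => (σ k - σ (k + 1)) * (if (i : ℕ) < k + 1 then 1 else 0))]
  rfl

end indicator

section substochastic
variable {n : ℕ}

/-- A doubly substochastic matrix does not increase the pairing of two decreasing sequences. -/
lemma sum_substochastic_le {σ τ : ℕ → ℝ} (hσ : Antitone σ) (hτ : Antitone τ) (hσn : σ n = 0)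
    (hτn : τ n = 0) {S : Fin n → Fin n → ℝ} (hS : ∀ i j, 0 ≤ S i j) (hrow : ∀ i, ∑ j, S i j ≤ 1)
    (hcol : ∀ j, ∑ i, S i j ≤ 1) :
    ∑ i : Fin n, ∑ j : Fin n, σ i * τ j * S i j ≤ ∑ i : Fin n, σ i * τ i := by
  -- expand both sides over pairs of indicators
  have key : ∀ F : Fin n → Fin n → ℝ, ∑ i : Fin n, ∑ j : Fin n, σ i * τ j * F i j =
      ∑ k : Fin n, ∑ l : Fin n, (σ k - σ (k + 1)) * (τ l - τ (l + 1)) *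
        ∑ i : Fin n, ∑ j : Fin n, ind (k + 1) i * ind (l + 1) j * F i j := by
    intro F
    calc ∑ i : Fin n, ∑ j : Fin n, σ i * τ j * F i j
        = ∑ i : Fin n, ∑ j : Fin n, ∑ k : Fin n, ∑ l : Fin n,
          (σ k - σ (k + 1)) * (τ l - τ (l + 1)) * (ind (k + 1) i * ind (l + 1) j * F i j) := by
          refine Finset.sum_congr rfl fun i _ => Finset.sum_congr rfl fun j _ => ?_
          rw [eq_sum_ind hσn i, eq_sum_ind hτn j, Finset.sum_mul_sum, Finset.sum_mul]
          refine Finset.sum_congr rfl fun k _ => ?_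
          rw [Finset.sum_mul]
          refine Finset.sum_congr rfl fun l _ => by ring
      _ = _ := by
          simp only [Finset.mul_sum]
          rw [Finset.sum_congr rfl fun i _ => Finset.sum_comm, Finset.sum_comm]
          refine Finset.sum_congr rfl fun k _ => ?_
          rw [Finset.sum_congr rfl fun i _ => Finset.sum_comm, Finset.sum_comm]
  have hdiag : ∑ i : Fin n, σ i * τ i =
      ∑ i : Fin n, ∑ j : Fin n, σ i * τ j * (if i = j then 1 else 0) := by
    refine Finset.sum_congr rfl fun i _ => ?_
    simp
  rw [hdiag, key, key]
  refine Finset.sum_le_sum fun k _ => Finset.sum_le_sum fun l _ => ?_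
  refine mul_le_mul_of_nonneg_left ?_
    (mul_nonneg (sub_nonneg.2 (hσ (Nat.le_succ _))) (sub_nonneg.2 (hτ (Nat.le_succ _))))
  have h1 : ∑ i : Fin n, ∑ j : Fin n, ind (k + 1) i * ind (l + 1) j * (if i = j then 1 else 0)
      = ((min (k + 1) (l + 1) : ℕ) : ℝ) := by
    rw [← sum_ind (n := n) (r := min (k + 1) (l + 1)) (by have := k.2; omega), ← sum_ind_mul_ind]
    refine Finset.sum_congr rfl fun i _ => ?_
    simp
  rw [h1, Nat.cast_min]
  refine le_min ?_ ?_
  · rw [← sum_ind (n := n) (r := k + 1) k.2]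
    refine Finset.sum_le_sum fun i _ => ?_
    calc ∑ j, ind (k + 1 : ℕ) i * ind (l + 1) j * S i j ≤ ∑ j, ind (k + 1 : ℕ) i * S i j := by
          refine Finset.sum_le_sum fun j _ => ?_
          have := mul_le_of_le_one_right (ind_nonneg (k + 1) i) (ind_le_one (l + 1) j)
          exact mul_le_mul_of_nonneg_right this (hS i j)
      _ ≤ ind (k + 1) i := by
          rw [← Finset.mul_sum]
          exact mul_le_of_le_one_right (ind_nonneg _ _) (hrow i)
  · rw [Finset.sum_comm, ← sum_ind (n := n) (r := l + 1) l.2]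
    refine Finset.sum_le_sum fun j _ => ?_
    calc ∑ i, ind (k + 1 : ℕ) i * ind (l + 1) j * S i j ≤ ∑ i, ind (l + 1 : ℕ) j * S i j := by
          refine Finset.sum_le_sum fun i _ => ?_
          have := mul_le_of_le_one_left (ind_nonneg (l + 1) j) (ind_le_one (k + 1) i)
          exact mul_le_mul_of_nonneg_right this (hS i j)
      _ ≤ ind (l + 1) j := by
          rw [← Finset.mul_sum]
          exact mul_le_of_le_one_right (ind_nonneg _ _) (hcol j)

end substochastic

section singular
open Matrix
variable {n₁ n₂ : ℕ} {X Y : Matrix (Fin n₁) (Fin n₂) ℝ} {σ τ : ℕ → ℝ}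
  {u x : Fin n₁ → Fin n₁ → ℝ} {v y : Fin n₁ → Fin n₂ → ℝ}

/-- A singular value decomposition `X = ∑ᵢ σᵢ uᵢ vᵢᵀ` in vector form, with `σ` decreasing and
vanishing from the index `n₁` on. -/
structure SingFam (X : Matrix (Fin n₁) (Fin n₂) ℝ) (σ : ℕ → ℝ) (u : Fin n₁ → Fin n₁ → ℝ)
    (v : Fin n₁ → Fin n₂ → ℝ) : Prop where
  anti : Antitone σ
  zero : σ n₁ = 0
  nonneg : ∀ i, 0 ≤ σ i
  left : Orth u
  right : Orth v
  eq : X = tensorSum (fun i : Fin n₁ => σ i) u v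

/-- The averaged squares of the inner products of two pairs of orthonormal families form a doubly
substochastic matrix. -/
lemma Orth.half_sum_sq_le_one (hu : Orth u) (hv : Orth v) (hx : Orth x) (hy : Orth y) (i : Fin n₁) :
    ∑ j, ((u i ⬝ᵥ x j) ^ 2 + (v i ⬝ᵥ y j) ^ 2) / 2 ≤ 1 := by
  have h1 := hx.bessel (u i)
  have h2 := hy.bessel (v i)
  rw [hu.self] at h1
  rw [hv.self] at h2
  rw [← Finset.sum_div, Finset.sum_add_distrib]
  simp only [dotProduct_comm (u i), dotProduct_comm (v i)]
  linarith

/-- Von Neumann's trace inequality. -/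
lemma SingFam.traceInner_le (hX : SingFam X σ u v) (hY : SingFam Y τ x y) :
    traceInner X Y ≤ ∑ i : Fin n₁, σ i * τ i := by
  rw [hX.eq, hY.eq, traceInner_tensorSum_tensorSum]
  refine le_trans ?_ (sum_substochastic_le hX.anti hY.anti hX.zero hY.zero
    (S := fun i j => ((u i ⬝ᵥ x j) ^ 2 + (v i ⬝ᵥ y j) ^ 2) / 2) (fun i j => by positivity)
    (hX.left.half_sum_sq_le_one hX.right hY.left hY.right) fun j => ?_)
  · refine Finset.sum_le_sum fun i _ => Finset.sum_le_sum fun j _ => ?_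
    exact mul_le_mul_of_nonneg_left ((le_abs_self _).trans (abs_mul_le_half _ _))
      (mul_nonneg (hX.nonneg _) (hY.nonneg _))
  · have := hY.left.half_sum_sq_le_one hY.right hX.left hX.right j
    simpa only [dotProduct_comm (x j), dotProduct_comm (y j)] using this

lemma SingFam.frobNorm_sq (hX : SingFam X σ u v) : frobNorm X ^ 2 = ∑ i : Fin n₁, σ i ^ 2 := by
  rw [hX.eq]
  exact frobNorm_sq_tensorSum fun i j _ _ => hX.left.mul_eq_ite hX.right i j

/-- The singular values are `1`-Lipschitz in the Euclidean norm. -/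
lemma SingFam.sum_sq_sub_le (hX : SingFam X σ u v) (hY : SingFam Y τ x y) :
    ∑ i : Fin n₁, (σ i - τ i) ^ 2 ≤ frobNorm (X - Y) ^ 2 := by
  rw [frobNorm_sq_sub, hX.frobNorm_sq, hY.frobNorm_sq]
  have h1 := hX.traceInner_le hY
  have h2 : ∑ i : Fin n₁, (σ i - τ i) ^ 2 =
      ∑ i : Fin n₁, σ i ^ 2 - 2 * ∑ i : Fin n₁, σ i * τ i + ∑ i : Fin n₁, τ i ^ 2 := by
    rw [Finset.mul_sum, ← Finset.sum_sub_distrib, ← Finset.sum_add_distrib]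
    exact Finset.sum_congr rfl fun i _ => by ring
  linarith

/-- Each singular value is `1`-Lipschitz in the Frobenius norm. -/
lemma SingFam.abs_sub_le (hX : SingFam X σ u v) (hY : SingFam Y τ x y) (i : Fin n₁) :
    |σ i - τ i| ≤ frobNorm (X - Y) := by
  have h := (Finset.single_le_sum (f := fun i : Fin n₁ => (σ i - τ i) ^ 2)
    (fun i _ => sq_nonneg _) (Finset.mem_univ i)).trans (hX.sum_sq_sub_le hY)
  exact abs_le_of_sq_le_sq h (frobNorm_nonneg _)

/-- The gap after the `r`-th singular value moves at speed at most `√2`. -/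
lemma SingFam.gap_le (hX : SingFam X σ u v) (hY : SingFam Y τ x y) {r : ℕ} (hr0 : 0 < r)
    (hr : r < n₁) :
    τ (r - 1) - τ r - √2 * frobNorm (X - Y) ≤ σ (r - 1) - σ r := by
  have h := hX.sum_sq_sub_le hY
  have h1 : (σ (r - 1) - τ (r - 1)) ^ 2 + (σ r - τ r) ^ 2 ≤ frobNorm (X - Y) ^ 2 := by
    refine le_trans ?_ h
    have := Finset.sum_le_sum_of_subset_of_nonneg
      (Finset.subset_univ ({⟨r - 1, by omega⟩, ⟨r, hr⟩} : Finset (Fin n₁)))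
      (f := fun i : Fin n₁ => (σ i - τ i) ^ 2) (fun i _ _ => sq_nonneg _)
    rwa [Finset.sum_pair (by simp [Fin.ext_iff]; omega)] at this
  have h2 : (√2 * frobNorm (X - Y)) ^ 2 = 2 * frobNorm (X - Y) ^ 2 := by
    rw [mul_pow, Real.sq_sqrt (by norm_num)]
  have h3 : τ (r - 1) - σ (r - 1) + (σ r - τ r) ≤ √2 * frobNorm (X - Y) := by
    refine abs_le_of_sq_le_sq' ?_ (mul_nonneg (Real.sqrt_nonneg _) (frobNorm_nonneg _)) |>.2
    rw [h2]
    nlinarith [sq_nonneg (τ (r - 1) - σ (r - 1) - (σ r - τ r))]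
  linarith

/-- The partial isometry `∑_{i < r} uᵢ vᵢᵀ`. -/
def lead {n n₁ n₂ : ℕ} (r : ℕ) (u : Fin n → Fin n₁ → ℝ) (v : Fin n → Fin n₂ → ℝ) :
    Matrix (Fin n₁) (Fin n₂) ℝ :=
  tensorSum (ind r) u v

lemma frobNorm_sq_lead {r : ℕ} (hr : r ≤ n₁) (hu : Orth u) (hv : Orth v) :
    frobNorm (lead r u v) ^ 2 = r := by
  rw [lead, frobNorm_sq_tensorSum fun i j _ _ => hu.mul_eq_ite hv i j]
  simp only [ind_sq, sum_ind hr]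

lemma frobNorm_sq_lead_sub {r : ℕ} (hr : r ≤ n₁) (hu : Orth u) (hv : Orth v) (hx : Orth x)
    (hy : Orth y) :
    frobNorm (lead r u v - lead r x y) ^ 2 = 2 * (r - traceInner (lead r u v) (lead r x y)) := by
  rw [frobNorm_sq_sub, frobNorm_sq_lead hr hu hv, frobNorm_sq_lead hr hx hy]; ring

/-- `lead r u v` maximizes `⟨X, ·⟩` over the partial isometries of rank `r`, with quadratic growth
governed by the gap of `X`. -/
lemma SingFam.growth (hX : SingFam X σ u v) (hx : Orth x) (hy : Orth y) {r : ℕ}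
    (hr : r ≤ n₁) :
    (σ (r - 1) - σ r) / 2 * frobNorm (lead r u v - lead r x y) ^ 2
      ≤ traceInner X (lead r u v - lead r x y) := by
  rw [frobNorm_sq_lead_sub hr hX.left hX.right hx hy]
  set z : Fin n₁ → ℝ := fun i => u i ⬝ᵥ (lead r x y *ᵥ v i) with hz
  set s : Fin n₁ → ℝ := fun i => ∑ j, ind r j * (((u i ⬝ᵥ x j) ^ 2 + (v i ⬝ᵥ y j) ^ 2) / 2) with hs
  have hzs : ∀ i, z i ≤ s i := by
    intro i
    rw [hz, hs]
    simp only [lead, dotProduct_tensorSum_mulVec]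
    refine Finset.sum_le_sum fun j _ => mul_le_mul_of_nonneg_left ?_ (ind_nonneg r j)
    rw [dotProduct_comm (x j), dotProduct_comm (y j)]
    exact (le_abs_self _).trans (abs_mul_le_half _ _)
  have hs1 : ∀ i, s i ≤ 1 := fun i => le_trans (Finset.sum_le_sum fun j _ =>
    mul_le_of_le_one_left (by positivity) (ind_le_one r j))
    (hX.left.half_sum_sq_le_one hX.right hx hy i)
  have hs0 : ∀ i, 0 ≤ s i := fun i => Finset.sum_nonneg fun j _ =>
    mul_nonneg (ind_nonneg r j) (by positivity)
  have hsum : ∑ i, s i ≤ r := by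
    rw [hs, Finset.sum_comm, ← sum_ind hr]
    refine Finset.sum_le_sum fun j _ => ?_
    rw [← Finset.mul_sum]
    refine mul_le_of_le_one_right (ind_nonneg r j) ?_
    have := hx.half_sum_sq_le_one hy hX.left hX.right j
    simpa only [dotProduct_comm (x j), dotProduct_comm (y j)] using this
  have hEZ : traceInner (lead r u v) (lead r x y) = ∑ i, ind r i * z i :=
    traceInner_tensorSum_left _ _ _ _
  have hXZ : traceInner X (lead r x y) = ∑ i : Fin n₁, σ i * z i := by
    rw [hX.eq]; exact traceInner_tensorSum_left _ _ _ _
  have hXE : traceInner X (lead r u v) = ∑ i : Fin n₁, σ i * ind r i := by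
    rw [hX.eq, lead, traceInner_tensorSum_tensorSum]
    refine Finset.sum_congr rfl fun i _ => ?_
    simp [hX.left.mul_eq_ite hX.right]
  have hpt : ∀ i : Fin n₁, σ (r - 1) * (ind r i - ind r i * z i) - σ r * (s i - ind r i * s i)
      ≤ σ i * ind r i - σ i * z i := by
    intro i
    unfold ind
    split_ifs with h
    · have h1 : σ (r - 1) ≤ σ i := hX.anti (by omega)
      have h2 : 0 ≤ 1 - z i := by linarith [hzs i, hs1 i]
      nlinarith
    · have h1 : σ i ≤ σ r := hX.anti (by omega)
      have h2 : σ i * z i ≤ σ i * s i := mul_le_mul_of_nonneg_left (hzs i) (hX.nonneg _)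
      have h3 : σ i * s i ≤ σ r * s i := mul_le_mul_of_nonneg_right h1 (hs0 i)
      linarith
  have hle := Finset.sum_le_sum fun i (_ : i ∈ Finset.univ) => hpt i
  simp only [Finset.sum_sub_distrib, ← Finset.mul_sum] at hle
  rw [sum_ind hr] at hle
  have hind : ∑ i, ind r i * z i ≤ ∑ i, ind r i * s i :=
    Finset.sum_le_sum fun i _ => mul_le_mul_of_nonneg_left (hzs i) (ind_nonneg r i)
  have h5 : σ r * (∑ i, s i - ∑ i, ind r i * s i) ≤ σ r * (r - ∑ i, ind r i * z i) :=
    mul_le_mul_of_nonneg_left (by linarith) (hX.nonneg r)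
  rw [traceInner_sub_right, hEZ, hXZ, hXE]
  linarith

/-- Perturbation of the leading singular vectors, controlled by the mean of both gaps: add the
growth inequalities of `X` and of `Y`. -/
lemma SingFam.lead_sub_le (hX : SingFam X σ u v) (hY : SingFam Y τ x y) {r : ℕ} (hr : r ≤ n₁) :
    ((σ (r - 1) - σ r) + (τ (r - 1) - τ r)) / 2 * frobNorm (lead r u v - lead r x y)
      ≤ frobNorm (X - Y) := by
  have h1 := hX.growth hY.left hY.right hr
  have h2 := hY.growth hX.left hX.right hr
  have h3 := MultiStage.traceInner_le (X - Y) (lead r u v - lead r x y)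
  have h4 : frobNorm (lead r x y - lead r u v) = frobNorm (lead r u v - lead r x y) := by
    rw [← frobNorm_neg, neg_sub]
  rw [h4] at h2
  rw [traceInner_sub_left] at h3
  rw [traceInner_sub_right] at h1 h2 h3
  rw [traceInner_sub_right] at h3
  rcases (frobNorm_nonneg (lead r u v - lead r x y)).eq_or_lt with h0 | h0
  · rw [← h0, mul_zero]; exact frobNorm_nonneg _
  · refine le_of_mul_le_mul_right ?_ h0
    linarith

end singular

/-! ### Existence and vector form of singular value decompositions -/

section svd
open Matrix
variable {n₁ n₂ : ℕ}

lemma mul_rectDiag_mul_transpose (hn : n₁ ≤ n₂) (w : Fin n₁ → ℝ) (U : Matrix (Fin n₁) (Fin n₁) ℝ)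
    (V : Matrix (Fin n₂) (Fin n₂) ℝ) :
    U * (rectDiag w : Matrix (Fin n₁) (Fin n₂) ℝ) * V.transpose
      = tensorSum w (fun i k => U k i) (fun i k => V k (Fin.castLE hn i)) := by
  ext i j
  simp only [tensorSum, Matrix.sum_apply, Matrix.smul_apply, vecMulVec_apply, Matrix.mul_apply,
    rectDiag, Matrix.of_apply, Matrix.transpose_apply, smul_eq_mul, Finset.sum_mul]
  rw [Finset.sum_comm]
  refine Finset.sum_congr rfl fun k _ => ?_
  rw [Finset.sum_eq_single (Fin.castLE hn k)]
  · simp; ring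
  · intro l _ hl
    rw [if_neg (fun h => hl (Fin.ext (by simpa using h.symm)))]; simp
  · simp

lemma orth_cols {n : ℕ} {U : Matrix (Fin n) (Fin n) ℝ} (hU : U ∈ Matrix.orthogonalGroup (Fin n) ℝ) :
    Orth (fun i k => U k i) := by
  have h : ∀ i j, (fun k => U k i) ⬝ᵥ (fun k => U k j) = (1 : Matrix (Fin n) (Fin n) ℝ) i j := by
    intro i j
    rw [← (Matrix.mem_orthogonalGroup_iff' (Fin n) ℝ).1 hU]
    rfl
  exact ⟨fun i => by rw [h, one_apply_eq], fun i j hij => by rw [h, one_apply_ne hij]⟩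

lemma singVal_eq_zero_iff (X : Matrix (Fin n₁) (Fin n₂) ℝ) (i : ℕ) :
    singVal X i = 0 ↔ X.rank ≤ i := by
  rw [singVal, LinearMap.singularValues_eq_zero_iff_le_finrank_range,
    Matrix.rank_eq_finrank_range_toLin X (EuclideanSpace.basisFun (Fin n₁) ℝ).toBasis
      (EuclideanSpace.basisFun (Fin n₂) ℝ).toBasis, Matrix.toEuclideanLin_eq_toLin_orthonormal]

lemma IsSVD.singFam (hn : n₁ ≤ n₂) {X : Matrix (Fin n₁) (Fin n₂) ℝ}
    {U : Matrix (Fin n₁) (Fin n₁) ℝ} {V : Matrix (Fin n₂) (Fin n₂) ℝ} (h : IsSVD X U V) :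
    SingFam X (singVal X) (fun i k => U k i) (fun i k => V k (Fin.castLE hn i)) where
  anti := LinearMap.singularValues_antitone _
  zero := (singVal_eq_zero_iff X n₁).2 (by simpa using X.rank_le_height)
  nonneg := LinearMap.singularValues_nonneg _
  left := orth_cols h.1
  right := (orth_cols h.2.1).comp (Fin.castLE_injective hn)
  eq := by rw [← mul_rectDiag_mul_transpose hn]; exact h.2.2

/-- A singular value decomposition `M = ∑ⱼ sⱼ xⱼ yⱼᵀ` in which the singular vectors matter only
where `sⱼ > 0`. -/
structure PartSVD (M : Matrix (Fin n₁) (Fin n₂) ℝ) (s : Fin n₁ → ℝ) (x : Fin n₁ → Fin n₁ → ℝ)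
    (y : Fin n₁ → Fin n₂ → ℝ) : Prop where
  anti : Antitone s
  nonneg : ∀ j, 0 ≤ s j
  left : Orth (fun j : {j // 0 < s j} => x j)
  right : Orth (fun j : {j // 0 < s j} => y j)
  eq : M = tensorSum s x y

/-- The left singular vectors are eigenvectors of `M Mᵀ`; the right ones are `Mᵀ xᵢ / sᵢ`, and `0`
if `sᵢ = 0`. -/
lemma exists_partSVD (M : Matrix (Fin n₁) (Fin n₂) ℝ) : ∃ s x y, PartSVD M s x y := by
  have hsym : (Matrix.toEuclideanLin (M * Mᵀ)).IsSymmetric := by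
    rw [Matrix.isSymmetric_toEuclideanLin_iff]
    exact Matrix.isHermitian_mul_conjTranspose_self M
  have hfin : Module.finrank ℝ (EuclideanSpace ℝ (Fin n₁)) = n₁ := by simp
  set e := hsym.eigenvectorBasis hfin with he
  set l := hsym.eigenvalues hfin with hl
  have hanti : Antitone l := hsym.eigenvalues_antitone hfin
  obtain ⟨x, hx⟩ : ∃ x : Fin n₁ → Fin n₁ → ℝ, ∀ i, x i = (e i).ofLp := ⟨_, fun _ => rfl⟩
  have hxx : ∀ i j, x i ⬝ᵥ x j = if i = j then 1 else 0 := by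
    intro i j
    have := orthonormal_iff_ite.1 e.orthonormal j i
    rw [EuclideanSpace.inner_eq_star_dotProduct] at this
    simpa [hx, eq_comm] using this
  have hMx : ∀ i, M *ᵥ (Mᵀ *ᵥ x i) = l i • x i := by
    intro i
    have h1 := hsym.apply_eigenvectorBasis hfin i
    have h2 := congrArg WithLp.ofLp h1
    rw [Matrix.mulVec_mulVec, hx]
    exact h2
  have hMM : ∀ i j, (Mᵀ *ᵥ x i) ⬝ᵥ (Mᵀ *ᵥ x j) = l j * (x i ⬝ᵥ x j) := by
    intro i j
    rw [Matrix.mulVec_transpose, ← Matrix.dotProduct_mulVec, hMx, dotProduct_smul, smul_eq_mul]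
  have hl0 : ∀ i, 0 ≤ l i := by
    intro i
    have h1 := hMM i i
    rw [hxx, if_pos rfl, mul_one] at h1
    rw [← h1]
    exact Finset.sum_nonneg fun k _ => mul_self_nonneg _
  refine ⟨fun i => √(l i), x, fun i => (√(l i))⁻¹ • (Mᵀ *ᵥ x i), ?_, fun i => Real.sqrt_nonneg _,
    ?_, ?_, ?_⟩
  · exact fun i j hij => Real.sqrt_le_sqrt (hanti hij)
  · refine ⟨fun i => by rw [hxx, if_pos rfl], fun i j hij => by
      rw [hxx, if_neg (fun h => hij (Subtype.ext h))]⟩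
  · refine ⟨fun i => ?_, fun i j hij => ?_⟩
    · have h1 : 0 < √(l i) := i.2
      have h2 : √(l i) * √(l i) = l i := Real.mul_self_sqrt (hl0 _)
      simp only [smul_dotProduct, dotProduct_smul, smul_eq_mul]
      rw [hMM, hxx, if_pos rfl, mul_one]
      nth_rw 3 [← h2]
      field_simp
    · simp only [smul_dotProduct, dotProduct_smul, smul_eq_mul]
      rw [hMM, hxx, if_neg (fun h => hij (Subtype.ext h))]
      simp
  · have hterm : ∀ i, √(l i) • vecMulVec (x i) ((√(l i))⁻¹ • (Mᵀ *ᵥ x i))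
        = vecMulVec (x i) (Mᵀ *ᵥ x i) := by
      intro i
      rw [vecMulVec_smul]
      rcases (hl0 i).eq_or_lt with h | h
      · have h1 : Mᵀ *ᵥ x i = 0 := by
          rw [← dotProduct_self_eq_zero, hMM, ← h, zero_mul]
        rw [h1]
        ext a b
        simp [vecMulVec_apply]
      · rw [smul_smul, mul_inv_cancel₀ (Real.sqrt_pos.2 h).ne', one_smul]
    rw [tensorSum]
    simp only [hterm]
    have hid : ∀ z : Fin n₁ → ℝ, z = ∑ i, (x i ⬝ᵥ z) • x i := by
      intro z
      have h1 := e.sum_repr' (WithLp.toLp 2 z)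
      have h2 := congrArg WithLp.ofLp h1
      simp only [WithLp.ofLp_sum, WithLp.ofLp_smul] at h2
      rw [← h2]
      refine Finset.sum_congr rfl fun i _ => ?_
      rw [EuclideanSpace.inner_eq_star_dotProduct, ← hx, dotProduct_comm]
      simp [h2]
    ext i j
    rw [Matrix.sum_apply]
    have h3 := congrFun (hid (fun k => M k j)) i
    rw [Finset.sum_apply] at h3
    rw [h3]
    refine Finset.sum_congr rfl fun k _ => ?_
    rw [vecMulVec_apply, Pi.smul_apply, smul_eq_mul, mul_comm]
    congr 1
    exact dotProduct_comm _ _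

/-- `M yⱼ = sⱼ xⱼ`, tested against `z`. -/
lemma PartSVD.dotProduct_mulVec {M : Matrix (Fin n₁) (Fin n₂) ℝ} {s : Fin n₁ → ℝ}
    {x : Fin n₁ → Fin n₁ → ℝ} {y : Fin n₁ → Fin n₂ → ℝ} (h : PartSVD M s x y) {j : Fin n₁}
    (hj : 0 < s j) (z : Fin n₁ → ℝ) : z ⬝ᵥ (M *ᵥ y j) = s j * (x j ⬝ᵥ z) := by
  rw [h.eq, dotProduct_tensorSum_mulVec, Finset.sum_eq_single j]
  · rw [h.right.self ⟨j, hj⟩, mul_one]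
  · intro i _ hij
    rcases (h.nonneg i).eq_or_lt with h0 | h0
    · rw [← h0, zero_mul]
    · rw [h.right.ne ⟨i, h0⟩ ⟨j, hj⟩ (by simpa using hij)]; simp
  · simp

/-- `Mᵀ xⱼ = sⱼ yⱼ`, tested against `z`. -/
lemma PartSVD.mulVec_dotProduct {M : Matrix (Fin n₁) (Fin n₂) ℝ} {s : Fin n₁ → ℝ}
    {x : Fin n₁ → Fin n₁ → ℝ} {y : Fin n₁ → Fin n₂ → ℝ} (h : PartSVD M s x y) {j : Fin n₁}
    (hj : 0 < s j) (z : Fin n₂ → ℝ) : x j ⬝ᵥ (M *ᵥ z) = s j * (y j ⬝ᵥ z) := by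
  rw [h.eq, dotProduct_tensorSum_mulVec, Finset.sum_eq_single j]
  · rw [h.left.self ⟨j, hj⟩, one_mul]
  · intro i _ hij
    rcases (h.nonneg i).eq_or_lt with h0 | h0
    · rw [← h0, zero_mul]
    · rw [h.left.ne ⟨i, h0⟩ ⟨j, hj⟩ (by simpa using hij)]; simp
  · simp

end svd

/-! ### The cone inequality -/

section cone
open Matrix
variable {n n₁ n₂ : ℕ} {r : ℕ}

lemma matrix_rank_add_le (X Y : Matrix (Fin n₁) (Fin n₂) ℝ) :
    (X + Y).rank ≤ X.rank + Y.rank := by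
  unfold Matrix.rank
  rw [Matrix.mulVecLin_add]
  refine (Submodule.finrank_mono ?_).trans (Submodule.finrank_add_le_finrank_add_finrank _ _)
  exact LinearMap.range_add_le _ _

lemma sum_ind_mul (f : Fin n → ℝ) :
    ∑ j, ind r j * f j = ∑ j : {j : Fin n // (j : ℕ) < r}, f j := by
  rw [← Finset.sum_subtype (Finset.univ.filter fun j : Fin n => (j : ℕ) < r) (by simp),
    Finset.sum_filter]
  exact Finset.sum_congr rfl fun j _ => by unfold ind; split_ifs <;> simp

lemma sum_pos_eq {s : Fin n → ℝ} (hs : ∀ j, 0 ≤ s j) :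
    ∑ j : {j // 0 < s j}, s j = ∑ j, s j := by
  rw [← Finset.sum_subtype (Finset.univ.filter fun j => 0 < s j) (by simp), Finset.sum_filter]
  refine Finset.sum_congr rfl fun j _ => ?_
  split_ifs with h
  · rfl
  · exact le_antisymm (hs j) (not_lt.1 h)

section proj
variable {p : Fin n → Fin n₁ → ℝ} {q : Fin n → Fin n₂ → ℝ}

lemma lead_transpose : (lead r p p)ᵀ = lead r p p := by
  ext i j
  simp only [lead, tensorSum, Matrix.transpose_apply, Matrix.sum_apply, Matrix.smul_apply,
    vecMulVec_apply]
  exact Finset.sum_congr rfl fun k _ => by rw [mul_comm (p k j)]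

lemma mulVec_tensorSum_apply {ι : Type*} [Fintype ι] (w : ι → ℝ) (u : ι → Fin n₁ → ℝ)
    (v : ι → Fin n₂ → ℝ) (z : Fin n₂ → ℝ) : tensorSum w u v *ᵥ z = ∑ i, (w i * (v i ⬝ᵥ z)) • u i := by
  ext k
  simp only [tensorSum, Matrix.sum_mulVec, Matrix.smul_mulVec, vecMulVec_mulVec, Finset.sum_apply,
    Pi.smul_apply, smul_eq_mul, MulOpposite.smul_eq_mul_unop, MulOpposite.unop_op]
  exact Finset.sum_congr rfl fun i _ => by ring

lemma lead_mulVec_eq_zero {z : Fin n₁ → ℝ} (h : ∀ j : Fin n, (j : ℕ) < r → p j ⬝ᵥ z = 0) :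
    lead r p p *ᵥ z = 0 := by
  rw [lead, mulVec_tensorSum_apply]
  refine Finset.sum_eq_zero fun i _ => ?_
  unfold ind
  split_ifs with h1
  · rw [h i h1]; simp
  · simp

lemma lead_mulVec_self (hp : Orth p) {j : Fin n} (hj : (j : ℕ) < r) :
    lead r p p *ᵥ p j = p j := by
  rw [lead, mulVec_tensorSum_apply, Finset.sum_eq_single j]
  · rw [hp.self, ind, if_pos hj]; simp
  · intro i _ hij
    rw [hp.ne i j hij]; simp
  · simp

lemma mul_tensorSum {ι : Type*} [Fintype ι] (B : Matrix (Fin n₁) (Fin n₁) ℝ) (w : ι → ℝ)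
    (u : ι → Fin n₁ → ℝ) (v : ι → Fin n₂ → ℝ) :
    B * tensorSum w u v = tensorSum w (fun i => B *ᵥ u i) v := by
  simp only [tensorSum, Matrix.mul_sum, Matrix.mul_smul, mul_vecMulVec]

lemma tensorSum_transpose {ι : Type*} [Fintype ι] (w : ι → ℝ)
    (u : ι → Fin n₁ → ℝ) (v : ι → Fin n₂ → ℝ) : (tensorSum w u v)ᵀ = tensorSum w v u := by
  ext i j
  simp only [tensorSum, Matrix.transpose_apply, Matrix.sum_apply, Matrix.smul_apply,
    vecMulVec_apply]
  exact Finset.sum_congr rfl fun k _ => by rw [mul_comm (u k j)]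

lemma lead_mul_lead (hp : Orth p) (q : Fin n → Fin n₂ → ℝ) :
    lead r p p * lead r p q = lead r p q := by
  conv_lhs => rw [show lead r p q = tensorSum (ind r) p q from rfl]
  rw [mul_tensorSum]
  refine Finset.sum_congr rfl fun i _ => ?_
  unfold ind
  split_ifs with h
  · simp only [lead_mulVec_self hp h]
  · simp

/-- The orthogonal projection `Z ↦ (1 - P) Z (1 - Q)`, where `P` and `Q` project onto the span of
the first `r` vectors of `p` and of `q`. -/
def perpPart (r : ℕ) (p : Fin n → Fin n₁ → ℝ) (q : Fin n → Fin n₂ → ℝ)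
    (Z : Matrix (Fin n₁) (Fin n₂) ℝ) : Matrix (Fin n₁) (Fin n₂) ℝ :=
  (1 - lead r p p) * Z * (1 - lead r q q)

/-- The orthogonal projection onto the tangent space, complementary to `perpPart`. -/
def tanPart (r : ℕ) (p : Fin n → Fin n₁ → ℝ) (q : Fin n → Fin n₂ → ℝ)
    (Z : Matrix (Fin n₁) (Fin n₂) ℝ) : Matrix (Fin n₁) (Fin n₂) ℝ :=
  Z - perpPart r p q Z

lemma traceInner_mul_left (B : Matrix (Fin n₁) (Fin n₁) ℝ) (X Y : Matrix (Fin n₁) (Fin n₂) ℝ) :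
    traceInner (B * X) Y = traceInner X (Bᵀ * Y) := by
  simp [traceInner, Matrix.mul_assoc]

lemma traceInner_mul_right (B : Matrix (Fin n₂) (Fin n₂) ℝ) (X Y : Matrix (Fin n₁) (Fin n₂) ℝ) :
    traceInner (X * B) Y = traceInner X (Y * Bᵀ) := by
  simp only [traceInner, Matrix.transpose_mul]
  rw [Matrix.trace_mul_comm, ← Matrix.mul_assoc, ← Matrix.mul_assoc, Matrix.trace_mul_comm,
    ← Matrix.mul_assoc]

lemma one_sub_lead_sq (hp : Orth p) : (1 - lead r p p) * (1 - lead r p p) = 1 - lead r p p := by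
  rw [Matrix.mul_sub, Matrix.sub_mul, Matrix.sub_mul, lead_mul_lead hp]; simp

lemma one_sub_lead_transpose : (1 - lead r p p)ᵀ = 1 - lead r p p := by
  rw [Matrix.transpose_sub, lead_transpose, Matrix.transpose_one]

variable (Y Z : Matrix (Fin n₁) (Fin n₂) ℝ)

lemma traceInner_perpPart : traceInner (perpPart r p q Y) Z = traceInner Y (perpPart r p q Z) := by
  rw [perpPart, traceInner_mul_right, traceInner_mul_left, one_sub_lead_transpose,
    one_sub_lead_transpose, perpPart, Matrix.mul_assoc]

lemma perpPart_perpPart (hp : Orth p) (hq : Orth q) :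
    perpPart r p q (perpPart r p q Z) = perpPart r p q Z := by
  have : perpPart r p q (perpPart r p q Z) =
    ((1 - lead r p p) * (1 - lead r p p)) * Z * ((1 - lead r q q) * (1 - lead r q q)) := by
    simp only [perpPart, Matrix.mul_assoc]
  rw [this, one_sub_lead_sq hp, one_sub_lead_sq hq, perpPart]

lemma tanPart_add_perpPart : tanPart r p q Z + perpPart r p q Z = Z := by
  rw [tanPart, sub_add_cancel]

lemma traceInner_tanPart_perpPart (hp : Orth p) (hq : Orth q) :
    traceInner (tanPart r p q Y) (perpPart r p q Z) = 0 := by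
  rw [tanPart, traceInner_sub_left, traceInner_perpPart, perpPart_perpPart Z hp hq, sub_self]

lemma traceInner_eq_tanPart (hp : Orth p) (hq : Orth q) :
    traceInner Y Z = traceInner (tanPart r p q Y) (tanPart r p q Z)
      + traceInner Y (perpPart r p q Z) := by
  conv_lhs => rw [← tanPart_add_perpPart (r := r) (p := p) (q := q) Z]
  rw [traceInner_add_right]
  congr 1
  conv_lhs => rw [← tanPart_add_perpPart (r := r) (p := p) (q := q) Y]
  rw [traceInner_add_left, traceInner_comm (perpPart r p q Y),
    traceInner_tanPart_perpPart Z Y hp hq, add_zero]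

lemma frobNorm_one_sub_lead_mul_le (hp : Orth p) :
    frobNorm ((1 - lead r p p) * Z) ^ 2 ≤ frobNorm Z ^ 2 := by
  have h1 : traceInner ((1 - lead r p p) * Z) ((1 - lead r p p) * Z)
      = traceInner ((1 - lead r p p) * Z) Z := by
    rw [traceInner_mul_left, traceInner_mul_left, one_sub_lead_transpose, ← Matrix.mul_assoc,
      one_sub_lead_sq hp]
  have h2 : frobNorm (Z - (1 - lead r p p) * Z) ^ 2
      = frobNorm Z ^ 2 - frobNorm ((1 - lead r p p) * Z) ^ 2 := by
    rw [frobNorm_sq_sub, ← traceInner_self_eq ((1 - lead r p p) * Z), h1, traceInner_comm Z]; ring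
  nlinarith [sq_nonneg (frobNorm (Z - (1 - lead r p p) * Z))]

lemma frobNorm_sq_tanPart_le (hp : Orth p) :
    frobNorm (tanPart r p q Z) ^ 2
      ≤ frobNorm (lead r p p * Z) ^ 2 + frobNorm (Z * lead r q q) ^ 2 := by
  have h1 : tanPart r p q Z = lead r p p * Z + (1 - lead r p p) * (Z * lead r q q) := by
    rw [tanPart, perpPart]
    simp only [Matrix.sub_mul, Matrix.mul_sub, Matrix.one_mul, Matrix.mul_one, Matrix.mul_assoc]
    abel
  have h2 : traceInner (lead r p p * Z) ((1 - lead r p p) * (Z * lead r q q)) = 0 := by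
    rw [traceInner_comm, traceInner_mul_left, one_sub_lead_transpose, ← Matrix.mul_assoc,
      Matrix.sub_mul, lead_mul_lead hp]
    simp
  rw [h1, frobNorm_sq_add, h2]
  have := frobNorm_one_sub_lead_mul_le (r := r) (Z * lead r q q) hp
  linarith

lemma tanPart_rank_le (hr : r ≤ n) : (tanPart r p q Z).rank ≤ 2 * r := by
  have hlead : ∀ {k : ℕ} (x : Fin n → Fin k → ℝ), (lead r x x).rank ≤ r := by
    intro k x
    have : lead r x x = (Matrix.of fun i (j : Fin r) => x (Fin.castLE hr j) i) *
        (Matrix.of fun (j : Fin r) i => x (Fin.castLE hr j) i) := by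
      have e : lead r x x = ∑ j, ind r j • vecMulVec (x j) (x j) := rfl
      ext a b
      rw [e, Matrix.sum_apply, Matrix.mul_apply]
      simp only [Matrix.smul_apply, smul_eq_mul]
      rw [sum_ind_mul (fun j => vecMulVec (x j) (x j) a b)]
      refine Fintype.sum_equiv ⟨fun j => ⟨j.1, j.2⟩, fun j => ⟨Fin.castLE hr j, j.2⟩,
        fun j => rfl, fun j => rfl⟩ _ _ fun j => rfl
    rw [this]
    refine (Matrix.rank_mul_le_left _ _).trans ?_
    exact (Matrix.rank_le_card_width _).trans (by simp)
  have h1 : tanPart r p q Z = lead r p p * Z + (1 - lead r p p) * Z * lead r q q := by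
    rw [tanPart, perpPart]
    simp only [Matrix.sub_mul, Matrix.mul_sub, Matrix.one_mul, Matrix.mul_one, Matrix.mul_assoc]
    abel
  rw [h1]
  refine (matrix_rank_add_le _ _).trans ?_
  have e1 := (Matrix.rank_mul_le_left (lead r p p) Z).trans (hlead p)
  have e2 := (Matrix.rank_mul_le_right ((1 - lead r p p) * Z) (lead r q q)).trans (hlead q)
  omega

end proj

end cone

section alignment
open Matrix
variable {n₁ n₂ : ℕ} {r : ℕ} {u p : Fin n₁ → Fin n₁ → ℝ} {v q : Fin n₁ → Fin n₂ → ℝ}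

/-- The squared norm of the matrix of inner products between the leading vectors of two families. -/
def overlap {k n : ℕ} (r : ℕ) (p u : Fin n → Fin k → ℝ) : ℝ :=
  ∑ i, ∑ j, ind r i * ind r j * (p j ⬝ᵥ u i) ^ 2

/-- Partial isometries are close only if both pairs of leading subspaces are. -/
lemma overlap_le (hr : r ≤ n₁) (hu : Orth u) (hv : Orth v) (hp : Orth p) (hq : Orth q) :
    (r - overlap r p u) + (r - overlap r q v) ≤ frobNorm (lead r u v - lead r p q) ^ 2 := by
  rw [frobNorm_sq_lead_sub hr hu hv hp hq]
  have h : traceInner (lead r u v) (lead r p q) ≤ (overlap r p u + overlap r q v) / 2 := by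
    rw [lead, lead, traceInner_tensorSum_tensorSum, overlap, overlap, ← Finset.sum_add_distrib,
      Finset.sum_div]
    refine Finset.sum_le_sum fun i _ => ?_
    rw [← Finset.sum_add_distrib, Finset.sum_div]
    refine Finset.sum_le_sum fun j _ => ?_
    rw [dotProduct_comm (u i), dotProduct_comm (v i)]
    have h1 := (le_abs_self _).trans (abs_mul_le_half (p j ⬝ᵥ u i) (q j ⬝ᵥ v i))
    have h2 := mul_le_mul_of_nonneg_left h1 (mul_nonneg (ind_nonneg r i) (ind_nonneg r j))
    linarith
  linarith

/-- The vectors of `u` after the first `r`, seen from the leading vectors of `p`. -/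
lemma sum_tail_le {k n : ℕ} {p u : Fin n → Fin k → ℝ} (hr : r ≤ n) (hu : Orth u) (hp : Orth p) :
    ∑ i, ∑ j, (1 - ind r i) * (ind r j * (p j ⬝ᵥ u i) ^ 2) ≤ r - overlap r p u := by
  have h1 : ∑ i, ∑ j, ind r j * (p j ⬝ᵥ u i) ^ 2 ≤ r := by
    rw [Finset.sum_comm, ← sum_ind hr]
    refine Finset.sum_le_sum fun j _ => ?_
    rw [← Finset.mul_sum]
    refine mul_le_of_le_one_right (ind_nonneg r j) ?_
    have := hu.bessel (p j)
    rw [hp.self] at this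
    simpa only [dotProduct_comm (p j)] using this
  have h2 : ∑ i, ∑ j, (1 - ind r i) * (ind r j * (p j ⬝ᵥ u i) ^ 2)
      = ∑ i, ∑ j, ind r j * (p j ⬝ᵥ u i) ^ 2 - overlap r p u := by
    rw [overlap, ← Finset.sum_sub_distrib]
    refine Finset.sum_congr rfl fun i _ => ?_
    rw [← Finset.sum_sub_distrib]
    exact Finset.sum_congr rfl fun j _ => by ring
  linarith

/-- A unit vector orthogonal to the leading vectors of `p`, seen from those of `u`. -/
lemma sum_ind_sq_le {k n : ℕ} {p u : Fin n → Fin k → ℝ} (hr : r ≤ n) (hu : Orth u) (hp : Orth p)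
    {x : Fin k → ℝ} (hx : x ⬝ᵥ x = 1) (hpx : ∀ j : Fin n, (j : ℕ) < r → p j ⬝ᵥ x = 0) :
    ∑ i, ind r i * (u i ⬝ᵥ x) ^ 2 ≤ r - overlap r p u := by
  have hO : Orth (Sum.elim (fun j : {j : Fin n // (j : ℕ) < r} => p j) (fun _ : Unit => x)) :=
    (hp.comp Subtype.val_injective).sumElim (Orth.unique hx) fun i _ => hpx i i.2
  have h1 : ∀ i, ∑ j, ind r j * (p j ⬝ᵥ u i) ^ 2 + (u i ⬝ᵥ x) ^ 2 ≤ 1 := by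
    intro i
    have h := hO.bessel (u i)
    rw [Fintype.sum_sum_type, hu.self] at h
    simp only [Sum.elim_inl, Sum.elim_inr, Finset.univ_unique, Finset.sum_singleton] at h
    rw [sum_ind_mul fun j => (p j ⬝ᵥ u i) ^ 2, dotProduct_comm (u i)]
    exact h
  rw [← sum_ind hr, overlap, ← Finset.sum_sub_distrib]
  refine Finset.sum_le_sum fun i _ => ?_
  have h2 := mul_le_mul_of_nonneg_left (h1 i) (ind_nonneg r i)
  rw [mul_add, Finset.mul_sum] at h2
  simp only [mul_assoc]
  linarith

variable {w : Fin n₁ → ℝ} {a b d : ℝ}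

lemma frobNorm_sq_tensorSum_orth {ι : Type*} [Fintype ι] {c : ι → ℝ} {u : ι → Fin n₁ → ℝ}
    {v : ι → Fin n₂ → ℝ} (hv : Orth v) :
    frobNorm (tensorSum c u v) ^ 2 = ∑ i, c i ^ 2 * (u i ⬝ᵥ u i) := by
  rw [← traceInner_self_eq, traceInner_tensorSum_tensorSum]
  refine Finset.sum_congr rfl fun i _ => ?_
  rw [Finset.sum_eq_single i]
  · rw [hv.self]; ring
  · intro j _ hji
    rw [hv.ne i j hji.symm]; ring
  · simp

lemma frobNorm_transpose (Z : Matrix (Fin n₁) (Fin n₂) ℝ) : frobNorm Zᵀ = frobNorm Z := by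
  rw [frobNorm, frobNorm, traceInner_eq_sum, traceInner_eq_sum, Finset.sum_comm]
  rfl

lemma lead_mulVec_dotProduct_self {k n : ℕ} {p : Fin n → Fin k → ℝ} (hp : Orth p)
    (z : Fin k → ℝ) :
    (lead r p p *ᵥ z) ⬝ᵥ (lead r p p *ᵥ z) = ∑ j, ind r j * (p j ⬝ᵥ z) ^ 2 := by
  rw [Matrix.dotProduct_mulVec, ← Matrix.mulVec_transpose, lead_transpose, Matrix.mulVec_mulVec,
    lead_mul_lead hp, dotProduct_comm, lead, dotProduct_tensorSum_mulVec]
  exact Finset.sum_congr rfl fun j _ => by ring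

lemma frobNorm_sq_lead_mul_le {k l n : ℕ} {p u : Fin n → Fin k → ℝ} {v : Fin n → Fin l → ℝ}
    {w : Fin n → ℝ} (hr : r ≤ n) (hp : Orth p) (hu : Orth u) (hv : Orth v)
    (hw0 : ∀ i, 0 ≤ w i) (hwa : ∀ i : Fin n, r ≤ (i : ℕ) → w i ≤ a) :
    frobNorm (lead r p p * tensorSum (fun i => w i * (1 - ind r i)) u v) ^ 2
      ≤ a ^ 2 * (r - overlap r p u) := by
  rw [mul_tensorSum, frobNorm_sq_tensorSum_orth hv]
  refine le_trans ?_ (mul_le_mul_of_nonneg_left (sum_tail_le hr hu hp) (sq_nonneg a))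
  rw [Finset.mul_sum]
  refine Finset.sum_le_sum fun i _ => ?_
  rw [lead_mulVec_dotProduct_self hp, ← Finset.mul_sum, ← mul_assoc]
  refine mul_le_mul_of_nonneg_right ?_
    (Finset.sum_nonneg fun j _ => mul_nonneg (ind_nonneg r j) (sq_nonneg _))
  unfold ind
  split_ifs with h
  · simp
  · have h1 := hwa i (not_lt.1 h)
    have h2 := hw0 i
    simp only [sub_zero, mul_one]
    gcongr

/-- The tangent part of `∑_{i ≥ r} wᵢ uᵢ vᵢᵀ` is small when the leading subspaces of `u`, `v` are
close to those of `p`, `q`. -/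
lemma tanPart_tail_le (hr : r ≤ n₁) (hu : Orth u) (hv : Orth v) (hp : Orth p) (hq : Orth q)
    (ha : 0 ≤ a) (hw0 : ∀ i, 0 ≤ w i) (hwa : ∀ i : Fin n₁, r ≤ (i : ℕ) → w i ≤ a) :
    frobNorm (tanPart r p q (tensorSum (fun i => w i * (1 - ind r i)) u v))
      ≤ a * frobNorm (lead r u v - lead r p q) := by
  refine frobNorm_le_of_sq_le _ (mul_nonneg ha (frobNorm_nonneg _)) ?_
  refine (frobNorm_sq_tanPart_le _ hp).trans ?_
  have h1 := frobNorm_sq_lead_mul_le (v := v) hr hp hu hv hw0 hwa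
  have h2 := frobNorm_sq_lead_mul_le (v := u) hr hq hv hu hw0 hwa
  have h3 : frobNorm (tensorSum (fun i => w i * (1 - ind r i)) u v * lead r q q)
      = frobNorm (lead r q q * tensorSum (fun i => w i * (1 - ind r i)) v u) := by
    rw [← frobNorm_transpose, Matrix.transpose_mul, lead_transpose, tensorSum_transpose]
  rw [h3, mul_pow]
  have h4 := mul_le_mul_of_nonneg_left (overlap_le hr hu hv hp hq) (sq_nonneg a)
  linarith

/-- The part of `W` seen by unit vectors orthogonal to the leading subspaces. -/
lemma dotProduct_mulVec_le (hr : r ≤ n₁) (hu : Orth u) (hv : Orth v) (hp : Orth p) (hq : Orth q)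
    (ha : 0 ≤ a) (ha1 : a ≤ 1) (hw0 : ∀ i, 0 ≤ w i) (hw1 : ∀ i, w i ≤ 1)
    (hwa : ∀ i : Fin n₁, r ≤ (i : ℕ) → w i ≤ a)
    {x : Fin n₁ → ℝ} {y : Fin n₂ → ℝ} (hx : x ⬝ᵥ x = 1) (hy : y ⬝ᵥ y = 1)
    (hpx : ∀ j : Fin n₁, (j : ℕ) < r → p j ⬝ᵥ x = 0)
    (hqy : ∀ j : Fin n₁, (j : ℕ) < r → q j ⬝ᵥ y = 0) :
    x ⬝ᵥ (tensorSum w u v *ᵥ y) ≤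
      a + (1 - a) * (frobNorm (lead r u v - lead r p q) ^ 2 / 2) := by
  rw [dotProduct_tensorSum_mulVec]
  have h1 := sum_ind_sq_le hr hu hp hx hpx
  have h2 := sum_ind_sq_le hr hv hq hy hqy
  have h3 := overlap_le hr hu hv hp hq
  have h4 := sum_abs_mul_le_one hu hv hx hy
  have hpt : ∀ i, w i * ((u i ⬝ᵥ x) * (v i ⬝ᵥ y)) ≤ a * |(u i ⬝ᵥ x) * (v i ⬝ᵥ y)|
      + (1 - a) * ((ind r i * (u i ⬝ᵥ x) ^ 2 + ind r i * (v i ⬝ᵥ y) ^ 2) / 2) := by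
    intro i
    have e1 : w i * ((u i ⬝ᵥ x) * (v i ⬝ᵥ y)) ≤ w i * |(u i ⬝ᵥ x) * (v i ⬝ᵥ y)| :=
      mul_le_mul_of_nonneg_left (le_abs_self _) (hw0 i)
    have e2 := abs_mul_le_half (u i ⬝ᵥ x) (v i ⬝ᵥ y)
    have e3 := abs_nonneg ((u i ⬝ᵥ x) * (v i ⬝ᵥ y))
    unfold ind
    split_ifs with h
    · have e4 := mul_le_mul_of_nonneg_right (hw1 i) e3
      have e5 := mul_le_mul_of_nonneg_left e2 (sub_nonneg.2 ha1)
      linarith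
    · have e4 := mul_le_mul_of_nonneg_right (hwa i (not_lt.1 h)) e3
      linarith
  refine (Finset.sum_le_sum fun i _ => hpt i).trans ?_
  rw [Finset.sum_add_distrib, ← Finset.mul_sum, ← Finset.mul_sum, ← Finset.sum_div,
    Finset.sum_add_distrib]
  have e1 := mul_le_mul_of_nonneg_left h4 ha
  have e2 := mul_le_mul_of_nonneg_left (a := 1 - a)
    (by linarith : (∑ i, ind r i * (u i ⬝ᵥ x) ^ 2 + ∑ i, ind r i * (v i ⬝ᵥ y) ^ 2) / 2
      ≤ frobNorm (lead r u v - lead r p q) ^ 2 / 2) (by linarith)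
  linarith

/-- The dual certificate acting on the tangent part of `Z`. -/
lemma traceInner_tanPart_le (hr : r ≤ n₁) (hu : Orth u) (hv : Orth v) (hp : Orth p) (hq : Orth q)
    (ha : 0 ≤ a) (hb : b ≤ 1) (hw0 : ∀ i, 0 ≤ w i) (hw1 : ∀ i, w i ≤ 1)
    (hwa : ∀ i : Fin n₁, r ≤ (i : ℕ) → w i ≤ a) (hwb : ∀ i : Fin n₁, (i : ℕ) < r → b ≤ w i)
    (Z : Matrix (Fin n₁) (Fin n₂) ℝ) :
    traceInner (tanPart r p q (tensorSum w u v - lead r p q)) (tanPart r p q Z) ≤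
      (√r * (1 - b) + (a + 1) * frobNorm (lead r u v - lead r p q)) *
        frobNorm (tanPart r p q Z) := by
  set T := tanPart r p q Z with hT
  set R := tensorSum (fun i => (w i - 1) * ind r i) u v with hR
  set G := tensorSum (fun i => w i * (1 - ind r i)) u v with hG
  have hsplit : tensorSum w u v - lead r p q = (lead r u v - lead r p q) + R + G := by
    have : tensorSum w u v = lead r u v + R + G := by
      rw [hR, hG, lead]
      simp only [tensorSum]
      rw [← Finset.sum_add_distrib, ← Finset.sum_add_distrib]
      refine Finset.sum_congr rfl fun i _ => ?_
      rw [← add_smul, ← add_smul]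
      congr 1
      ring
    rw [this]; abel
  have htan : ∀ Y, traceInner (tanPart r p q Y) T = traceInner Y T := by
    intro Y
    have h := traceInner_tanPart_perpPart (r := r) Z Y hp hq
    rw [tanPart, traceInner_sub_left, hT, traceInner_comm (perpPart r p q Y), h, sub_zero]
  have hRle : frobNorm R ≤ √r * (1 - b) := by
    refine frobNorm_le_of_sq_le _ (mul_nonneg (Real.sqrt_nonneg _) (by linarith)) ?_
    rw [hR, frobNorm_sq_tensorSum fun i j _ _ => hu.mul_eq_ite hv i j, mul_pow,
      Real.sq_sqrt (Nat.cast_nonneg r), ← sum_ind hr, Finset.sum_mul]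
    refine Finset.sum_le_sum fun i _ => ?_
    rw [mul_pow, ind_sq, mul_comm]
    unfold ind
    split_ifs with h
    · have := hwb i h
      have := hw1 i
      rw [one_mul, one_mul]
      nlinarith
    · simp
  rw [htan, hsplit, traceInner_add_left, traceInner_add_left, ← htan G]
  have h1 := traceInner_le (lead r u v - lead r p q) T
  have h2 := (traceInner_le R T).trans (mul_le_mul_of_nonneg_right hRle (frobNorm_nonneg T))
  have h3 := (traceInner_le (tanPart r p q G) T).trans (mul_le_mul_of_nonneg_right
    (tanPart_tail_le hr hu hv hp hq ha hw0 hwa) (frobNorm_nonneg T))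
  linarith

end alignment

section descent
open Matrix
variable {n₁ n₂ : ℕ} {r : ℕ} {p : Fin n₁ → Fin n₁ → ℝ} {q : Fin n₁ → Fin n₂ → ℝ}
  {Z : Matrix (Fin n₁) (Fin n₂) ℝ} {s : Fin n₁ → ℝ} {x : Fin n₁ → Fin n₁ → ℝ}
  {y : Fin n₁ → Fin n₂ → ℝ}

lemma perpPart_left (hp : Orth p) (h : PartSVD (perpPart r p q Z) s x y) {i j : Fin n₁}
    (hi : (i : ℕ) < r) (hj : 0 < s j) : p i ⬝ᵥ x j = 0 := by
  have h1 := h.dotProduct_mulVec hj (p i)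
  have h2 : p i ⬝ᵥ (perpPart r p q Z *ᵥ y j) = 0 := by
    rw [perpPart, Matrix.mul_assoc, ← Matrix.mulVec_mulVec, Matrix.dotProduct_mulVec,
      ← Matrix.mulVec_transpose, one_sub_lead_transpose, Matrix.sub_mulVec, lead_mulVec_self hp hi]
    simp
  rw [h2] at h1
  rw [dotProduct_comm]
  exact (mul_eq_zero.1 h1.symm).resolve_left hj.ne'

lemma perpPart_right (hq : Orth q) (h : PartSVD (perpPart r p q Z) s x y) {i j : Fin n₁}
    (hi : (i : ℕ) < r) (hj : 0 < s j) : q i ⬝ᵥ y j = 0 := by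
  have h1 := h.mulVec_dotProduct hj (q i)
  have h2 : perpPart r p q Z *ᵥ q i = 0 := by
    rw [perpPart, ← Matrix.mulVec_mulVec, Matrix.sub_mulVec, lead_mulVec_self hq hi]
    simp
  rw [h2, dotProduct_zero] at h1
  rw [dotProduct_comm]
  exact (mul_eq_zero.1 h1.symm).resolve_left hj.ne'

/-- The singular pairs of the normal part do not see the tangent part. -/
lemma dotProduct_tanPart_mulVec (hp : Orth p) (hq : Orth q) (h : PartSVD (perpPart r p q Z) s x y)
    {j : Fin n₁} (hj : 0 < s j) : x j ⬝ᵥ (tanPart r p q Z *ᵥ y j) = 0 := by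
  have e2 : (1 - lead r p p) *ᵥ x j = x j := by
    rw [Matrix.sub_mulVec, lead_mulVec_eq_zero fun i hi => perpPart_left hp h hi hj]
    simp
  have e3 : (1 - lead r q q) *ᵥ y j = y j := by
    rw [Matrix.sub_mulVec, lead_mulVec_eq_zero fun i hi => perpPart_right hq h hi hj]
    simp
  rw [tanPart, Matrix.sub_mulVec, dotProduct_sub, perpPart, ← Matrix.mulVec_mulVec,
    ← Matrix.mulVec_mulVec, Matrix.dotProduct_mulVec (x j) (1 - lead r p p),
    ← Matrix.mulVec_transpose, one_sub_lead_transpose, e2, e3, sub_self]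

/-- A subgradient inequality for the nuclear norm at `Xb`, evaluated in terms of the singular values
of `X` and `Xb`. -/
lemma sum_singular_sub_ge {X Xb : Matrix (Fin n₁) (Fin n₂) ℝ} {σ τ : ℕ → ℝ}
    {u : Fin n₁ → Fin n₁ → ℝ} {v : Fin n₁ → Fin n₂ → ℝ} (hX : SingFam X σ u v)
    (hXb : SingFam Xb τ p q) (hτ : ∀ i, r ≤ i → τ i = 0)
    (h : PartSVD (perpPart r p q (X - Xb)) s x y) :
    traceInner (lead r p q) (X - Xb) + ∑ j, s j
      ≤ ∑ i : Fin n₁, σ i - ∑ i : Fin n₁, τ i := by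
  have hp := hXb.left
  have hq := hXb.right
  set F : Matrix (Fin n₁) (Fin n₂) ℝ :=
    tensorSum (fun _ : {j // 0 < s j} => (1 : ℝ)) (fun j => x j) (fun j => y j) with hF
  have hO1 : Orth (Sum.elim (fun j : {j : Fin n₁ // (j : ℕ) < r} => p j)
      (fun j : {j // 0 < s j} => x j)) :=
    (hp.comp Subtype.val_injective).sumElim h.left fun i k => perpPart_left hp h i.2 k.2
  have hO2 : Orth (Sum.elim (fun j : {j : Fin n₁ // (j : ℕ) < r} => q j)
      (fun j : {j // 0 < s j} => y j)) :=
    (hq.comp Subtype.val_injective).sumElim h.right fun i k => perpPart_right hq h i.2 k.2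
  have hsum : lead r p q + F = tensorSum (fun _ => (1 : ℝ))
      (Sum.elim (fun j : {j : Fin n₁ // (j : ℕ) < r} => p j) (fun j : {j // 0 < s j} => x j))
      (Sum.elim (fun j : {j : Fin n₁ // (j : ℕ) < r} => q j) (fun j : {j // 0 < s j} => y j)) := by
    rw [tensorSum, Fintype.sum_sum_type]
    congr 1
    ext a b
    rw [lead, tensorSum, Matrix.sum_apply, Matrix.sum_apply]
    simp only [Matrix.smul_apply, smul_eq_mul, one_mul, Sum.elim_inl]
    exact sum_ind_mul fun j => vecMulVec (p j) (q j) a b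
  have h1 : traceInner (lead r p q + F) X ≤ ∑ i : Fin n₁, σ i := by
    rw [hsum, traceInner_comm, hX.eq, traceInner_tensorSum_left]
    refine Finset.sum_le_sum fun i _ => mul_le_of_le_one_right (hX.nonneg i) ?_
    rw [dotProduct_tensorSum_mulVec]
    refine le_trans ?_ (sum_abs_mul_le_one hO1 hO2 (hX.left.self i) (hX.right.self i))
    exact Finset.sum_le_sum fun k _ => by rw [one_mul]; exact le_abs_self _
  have h2 : traceInner (lead r p q) Xb = ∑ i : Fin n₁, τ i := by
    rw [hXb.eq, lead, traceInner_tensorSum_tensorSum]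
    refine Finset.sum_congr rfl fun i _ => ?_
    simp only [hp.mul_eq_ite hq, mul_ite, mul_one, mul_zero, Finset.sum_ite_eq, Finset.mem_univ,
      if_true]
    unfold ind
    split_ifs with hi
    · rw [one_mul]
    · rw [zero_mul, hτ i (not_lt.1 hi)]
  have h3 : traceInner F Xb = 0 := by
    rw [hF, traceInner_tensorSum_left]
    refine Finset.sum_eq_zero fun j _ => ?_
    rw [one_mul, hXb.eq, dotProduct_tensorSum_mulVec]
    refine Finset.sum_eq_zero fun i _ => ?_
    rcases lt_or_ge (i : ℕ) r with hi | hi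
    · rw [perpPart_left hp h hi j.2]; simp
    · rw [hτ i hi]; simp
  have h4 : traceInner F (X - Xb) = ∑ j, s j := by
    rw [hF, traceInner_tensorSum_left, ← sum_pos_eq h.nonneg]
    refine Finset.sum_congr rfl fun j _ => ?_
    rw [one_mul]
    have e1 := h.dotProduct_mulVec j.2 (x j)
    have e2 := dotProduct_tanPart_mulVec hp hq h j.2
    rw [h.left.self j, mul_one] at e1
    rw [tanPart, Matrix.sub_mulVec, dotProduct_sub, sub_eq_zero] at e2
    rw [e2, e1]
  rw [traceInner_add_left] at h1
  rw [traceInner_sub_right] at h4 ⊢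
  linarith

/-- The error lies in a cone: the nuclear norm of its normal part is controlled by the Frobenius
norm of its tangent part. -/
lemma cone_le {u : Fin n₁ → Fin n₁ → ℝ} {v : Fin n₁ → Fin n₂ → ℝ} {w : Fin n₁ → ℝ} {a b β : ℝ}
    (hr : r ≤ n₁) (hu : Orth u) (hv : Orth v) (hp : Orth p) (hq : Orth q)
    (ha : 0 ≤ a) (ha1 : a ≤ 1) (hb : b ≤ 1) (hw0 : ∀ i, 0 ≤ w i) (hw1 : ∀ i, w i ≤ 1)
    (hwa : ∀ i : Fin n₁, r ≤ (i : ℕ) → w i ≤ a) (hwb : ∀ i : Fin n₁, (i : ℕ) < r → b ≤ w i)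
    (hβ : frobNorm (lead r u v - lead r p q) ≤ β)
    (h : PartSVD (perpPart r p q Z) s x y)
    (hN : traceInner (lead r p q) Z + ∑ j, s j ≤ traceInner (tensorSum w u v) Z) :
    (∑ j, s j) * ((1 - a) * (1 - β ^ 2)) ≤
      (√r * (1 - b) + (√2 * a + 1) * β) * frobNorm (tanPart r p q Z) := by
  set E := lead r p q with hE
  set W := tensorSum w u v with hW
  set d := frobNorm (lead r u v - lead r p q) with hd
  have hd0 : 0 ≤ d := frobNorm_nonneg _
  have h1 : ∑ j, s j ≤ traceInner (W - E) Z := by rw [traceInner_sub_left]; linarith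
  rw [traceInner_eq_tanPart (r := r) (p := p) (q := q) (W - E) Z hp hq, traceInner_sub_left] at h1
  have h2 := traceInner_tanPart_le hr hu hv hp hq ha hb hw0 hw1 hwa hwb Z
  have h3 : traceInner E (perpPart r p q Z) = 0 := by
    rw [← traceInner_perpPart, perpPart, Matrix.sub_mul, hE, lead_mul_lead hp]
    simp
  have h4 : traceInner W (perpPart r p q Z) ≤ (∑ j, s j) * (a + (1 - a) * (d ^ 2 / 2)) := by
    rw [traceInner_comm, h.eq, traceInner_tensorSum_left, Finset.sum_mul]
    refine Finset.sum_le_sum fun j _ => ?_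
    rcases (h.nonneg j).eq_or_lt with h0 | h0
    · rw [← h0]; simp
    · refine mul_le_mul_of_nonneg_left ?_ h0.le
      exact dotProduct_mulVec_le hr hu hv hp hq ha ha1 hw0 hw1 hwa (h.left.self ⟨j, h0⟩)
        (h.right.self ⟨j, h0⟩) (fun i hi => perpPart_left hp h hi h0)
        (fun i hi => perpPart_right hq h hi h0)
  have hN0 : 0 ≤ ∑ j, s j := Finset.sum_nonneg fun j _ => h.nonneg j
  have ht := frobNorm_nonneg (tanPart r p q Z)
  have h5 : (√r * (1 - b) + (a + 1) * d) * frobNorm (tanPart r p q Z)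
      ≤ (√r * (1 - b) + (√2 * a + 1) * β) * frobNorm (tanPart r p q Z) := by
    have : (1 : ℝ) ≤ √2 := Real.one_le_sqrt.2 (by norm_num)
    have : a + 1 ≤ √2 * a + 1 := by nlinarith
    have : (a + 1) * d ≤ (√2 * a + 1) * β := by
      apply mul_le_mul this hβ hd0; positivity
    gcongr ?_ * _
    linarith
  have h6 : (∑ j, s j) * ((1 - a) * (d ^ 2 / 2)) ≤ (∑ j, s j) * ((1 - a) * β ^ 2) := by
    have h7 : d ^ 2 ≤ β ^ 2 := by gcongr
    have h8 : d ^ 2 / 2 ≤ β ^ 2 := by nlinarith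
    have h9 : 0 ≤ 1 - a := by linarith
    gcongr
  linarith

end descent

/-! ### Restricted eigenvalues -/

section sampling
open Matrix
variable {m n₁ n₂ : ℕ} (A : Fin m → Matrix (Fin n₁) (Fin n₂) ℝ) (X Y : Matrix (Fin n₁) (Fin n₂) ℝ)

lemma sample_add : sample A (X + Y) = sample A X + sample A Y := by
  ext i; simp [sample, traceInner_add_right]

lemma sample_sub : sample A (X - Y) = sample A X - sample A Y := by
  ext i; simp [sample, traceInner_sub_right]

lemma sample_smul (c : ℝ) : sample A (c • X) = c • sample A X := by
  ext i; simp [sample, traceInner_smul_right]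

lemma sample_sum {ι : Type*} (t : Finset ι) (F : ι → Matrix (Fin n₁) (Fin n₂) ℝ) :
    sample A (∑ i ∈ t, F i) = ∑ i ∈ t, sample A (F i) := by
  classical
  induction t using Finset.induction_on with
  | empty => ext i; simp [sample]
  | insert a t ha ih => rw [Finset.sum_insert ha, Finset.sum_insert ha, sample_add, ih]

lemma traceInner_sampleAdj : traceInner X (sampleAdj A (sample A X)) = ‖sample A X‖ ^ 2 := by
  rw [sampleAdj, traceInner_sum_right, EuclideanSpace.norm_sq_eq]
  refine Finset.sum_congr rfl fun i _ => ?_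
  rw [traceInner_smul_right, traceInner_comm X, Real.norm_eq_abs, sq_abs, pow_two]
  rfl

lemma norm_sample_sq_le : ‖sample A X‖ ^ 2 ≤ (∑ i, frobNorm (A i) ^ 2) * frobNorm X ^ 2 := by
  rw [EuclideanSpace.norm_sq_eq, Finset.sum_mul]
  refine Finset.sum_le_sum fun i _ => ?_
  rw [Real.norm_eq_abs, sq_abs, ← mul_pow]
  refine sq_le_sq' ?_ (traceInner_le _ _)
  have := traceInner_le (-A i) X
  rw [frobNorm_neg] at this
  have h2 : traceInner (-A i) X = - traceInner (A i) X := by simp [traceInner]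
  have h3 : (sample A X) i = traceInner (A i) X := rfl
  rw [h3]
  linarith

lemma rank_pos_of_ne_zero (hX : X ≠ 0) : 0 < X.rank := by
  rw [Nat.pos_iff_ne_zero]
  intro h
  apply hX
  have h1 : LinearMap.range X.mulVecLin = ⊥ := Submodule.finrank_eq_zero.1 h
  rw [LinearMap.range_eq_bot] at h1
  ext i j
  have h2 := congrFun (LinearMap.congr_fun h1 (Pi.single j 1)) i
  simpa using h2

lemma rayleighSet_bddBelow (k : ℕ) : BddBelow (rayleighSet A k) := by
  refine ⟨0, ?_⟩
  rintro _ ⟨X, -, rfl⟩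
  simp only [traceInner_sampleAdj]
  positivity

lemma rayleighSet_bddAbove (k : ℕ) : BddAbove (rayleighSet A k) := by
  refine ⟨∑ i, frobNorm (A i) ^ 2, ?_⟩
  rintro _ ⟨X, -, rfl⟩
  simp only [traceInner_sampleAdj]
  exact div_le_of_le_mul₀ (sq_nonneg _) (Finset.sum_nonneg fun i _ => sq_nonneg _)
    (norm_sample_sq_le A X)

lemma mem_rayleighSet {k : ℕ} (hX : X ≠ 0) (hk : X.rank ≤ k) :
    ‖sample A X‖ ^ 2 / frobNorm X ^ 2 ∈ rayleighSet A k :=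
  ⟨X, ⟨rank_pos_of_ne_zero X hX, hk⟩, by simp only [traceInner_sampleAdj]⟩

variable {X}

lemma thetaMin_mul_le {k : ℕ} (hk : X.rank ≤ k) :
    thetaMin A k * frobNorm X ^ 2 ≤ ‖sample A X‖ ^ 2 := by
  by_cases hX : X = 0
  · rw [(frobNorm_eq_zero X).2 hX]; simp
  · have h := csInf_le (rayleighSet_bddBelow A k) (mem_rayleighSet A X hX hk)
    have h0 : 0 < frobNorm X :=
      (frobNorm_nonneg X).lt_of_ne' fun h => hX ((frobNorm_eq_zero X).1 h)
    rwa [le_div_iff₀ (by positivity)] at h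

lemma le_thetaMax_mul {k : ℕ} (hk : X.rank ≤ k) :
    ‖sample A X‖ ^ 2 ≤ thetaMax A k * frobNorm X ^ 2 := by
  by_cases hX : X = 0
  · subst hX
    have h : sample A (0 : Matrix (Fin n₁) (Fin n₂) ℝ) = 0 := by ext i; simp [sample]
    rw [(frobNorm_eq_zero (0 : Matrix (Fin n₁) (Fin n₂) ℝ)).2 rfl, h]; simp
  · have h := le_csSup (rayleighSet_bddAbove A k) (mem_rayleighSet A X hX hk)
    have h0 : 0 < frobNorm X :=
      (frobNorm_nonneg X).lt_of_ne' fun h => hX ((frobNorm_eq_zero X).1 h)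
    rwa [div_le_iff₀ (by positivity)] at h

lemma thetaMin_le_of_rank_le {k l : ℕ} (hkl : k ≤ l) (hX : X ≠ 0) (hk : X.rank ≤ k) :
    thetaMin A l ≤ thetaMin A k := by
  refine csInf_le_csInf (rayleighSet_bddBelow A l) ⟨_, mem_rayleighSet A X hX hk⟩ ?_
  rintro _ ⟨Z, ⟨h0, h1⟩, rfl⟩
  exact ⟨Z, ⟨h0, h1.trans hkl⟩, rfl⟩

/-- The form `⟨𝒜X, 𝒜Y⟩ - L ⟨X, Y⟩`, nonnegative on matrices of small rank. -/
noncomputable def defect (L : ℝ) (X Y : Matrix (Fin n₁) (Fin n₂) ℝ) : ℝ :=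
  inner ℝ (sample A X) (sample A Y) - L * traceInner X Y

lemma defect_self (L : ℝ) (X : Matrix (Fin n₁) (Fin n₂) ℝ) :
    defect A L X X = ‖sample A X‖ ^ 2 - L * frobNorm X ^ 2 := by
  rw [defect, real_inner_self_eq_norm_sq, traceInner_self_eq]

lemma defect_self_nonneg {k : ℕ} (hk : X.rank ≤ k) : 0 ≤ defect A (thetaMin A k) X X := by
  rw [defect_self]
  exact sub_nonneg.2 (thetaMin_mul_le A hk)

lemma defect_self_sum (L : ℝ) {ι : Type*} (t : Finset ι) (F : ι → Matrix (Fin n₁) (Fin n₂) ℝ) :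
    defect A L (∑ i ∈ t, F i) (∑ i ∈ t, F i) = ∑ i ∈ t, ∑ j ∈ t, defect A L (F i) (F j) := by
  simp only [defect, sample_sum, traceInner_sum_left, traceInner_sum_right, sum_inner, inner_sum,
    Finset.mul_sum, Finset.sum_sub_distrib]
  congr 1 <;> exact Finset.sum_comm

/-- Cauchy-Schwarz for the defect form, on pairs whose combinations have small rank. -/
lemma neg_mul_le_defect {K k l : ℕ} (hkl : k + l ≤ K) {X Y : Matrix (Fin n₁) (Fin n₂) ℝ}
    (hX : X.rank ≤ k) (hY : Y.rank ≤ l) {a b : ℝ} (ha : 0 ≤ a) (hb : 0 ≤ b)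
    (hXa : defect A (thetaMin A K) X X ≤ a ^ 2) (hYb : defect A (thetaMin A K) Y Y ≤ b ^ 2) :
    -(a * b) ≤ defect A (thetaMin A K) X Y := by
  set L := thetaMin A K with hL
  have hquad : ∀ t : ℝ, 0 ≤ defect A L Y Y * (t * t) + (2 * defect A L X Y) * t
      + defect A L X X := by
    intro t
    have hrk : (X + t • Y).rank ≤ K := by
      refine (matrix_rank_add_le _ _).trans ?_
      have : (t • Y).rank ≤ Y.rank := by
        rw [show t • Y = (t • (1 : Matrix (Fin n₁) (Fin n₁) ℝ)) * Y by simp]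
        exact Matrix.rank_mul_le_right _ _
      omega
    have h := defect_self_nonneg A hrk
    refine h.trans (le_of_eq ?_)
    simp only [defect, ← hL, sample_add, sample_smul, inner_add_left, inner_add_right,
      inner_smul_left, inner_smul_right, traceInner_add_left, traceInner_add_right,
      traceInner_smul_left, traceInner_smul_right, traceInner_comm Y X,
      real_inner_comm (sample A X) (sample A Y)]
    simp
    ring
  have hd := discrim_le_zero hquad
  rw [discrim] at hd
  have h0 : 0 ≤ defect A L X X := defect_self_nonneg A (hX.trans (by omega))
  have h1 : 0 ≤ defect A L Y Y := defect_self_nonneg A (hY.trans (by omega))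
  have h2 : defect A L X X * defect A L Y Y ≤ a ^ 2 * b ^ 2 := by gcongr
  refine (abs_le_of_sq_le_sq' (b := a * b) ?_ (mul_nonneg ha hb)).1
  nlinarith

end sampling

/-! ### Blocks of a decreasing sequence -/

section blocks
variable {S : ℕ → ℝ} {s : ℕ}

/-- The sum of the `k`-th block of length `s`. -/
def blockSum (S : ℕ → ℝ) (s k : ℕ) : ℝ := ∑ i : Fin s, S (k * s + i)

lemma sum_range_mul_eq {E : Type*} [AddCommMonoid E] (f : ℕ → E) (s K : ℕ) :
    ∑ j ∈ Finset.range (K * s), f j = ∑ k ∈ Finset.range K, ∑ i : Fin s, f (k * s + i) := by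
  induction K with
  | zero => simp
  | succ K ih =>
    rw [Nat.succ_mul, Finset.sum_range_add, ih, Finset.sum_range_succ,
      Fin.sum_univ_eq_sum_range (fun i => f (K * s + i))]

lemma blockSum_nonneg (h0 : ∀ j, 0 ≤ S j) (k : ℕ) : 0 ≤ blockSum S s k :=
  Finset.sum_nonneg fun _ _ => h0 _

lemma mul_le_blockSum (hS : Antitone S) (k : ℕ) (i : Fin s) :
    s * S ((k + 1) * s + i) ≤ blockSum S s k := by
  have : ∑ _j : Fin s, S ((k + 1) * s + i) ≤ blockSum S s k :=
    Finset.sum_le_sum fun j _ => hS (by have := j.2; rw [Nat.succ_mul]; omega)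
  simpa using this

lemma blockSum_anti (hS : Antitone S) (k : ℕ) : blockSum S s k ≤ blockSum S s 0 :=
  Finset.sum_le_sum fun j _ => hS (by omega)

lemma sq_blockSum_le (S : ℕ → ℝ) (s k : ℕ) :
    blockSum S s k ^ 2 ≤ s * ∑ i : Fin s, S (k * s + i) ^ 2 := by
  have := sq_sum_le_card_mul_sum_sq (s := (Finset.univ : Finset (Fin s)))
    (f := fun i => S (k * s + i))
  simpa [blockSum] using this

/-- Each entry of a block is at most the mean of the preceding block. -/
lemma mul_sum_sq_le (hS : Antitone S) (h0 : ∀ j, 0 ≤ S j) (k : ℕ) :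
    s * ∑ i : Fin s, S ((k + 1) * s + i) ^ 2 ≤ blockSum S s k * blockSum S s (k + 1) := by
  rw [blockSum, blockSum, Finset.mul_sum, Finset.mul_sum]
  refine Finset.sum_le_sum fun i _ => ?_
  have h1 := mul_le_mul_of_nonneg_right (mul_le_blockSum hS k i) (h0 ((k + 1) * s + i))
  rw [blockSum] at h1
  calc (s : ℝ) * S ((k + 1) * s + i) ^ 2
      = s * S ((k + 1) * s + i) * S ((k + 1) * s + i) := by ring
    _ ≤ _ := h1

lemma sum_blockSum_mean (S : ℕ → ℝ) (h0 : ∀ j, 0 ≤ S j) (s K : ℕ) :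
    ∑ k ∈ Finset.range K, (blockSum S s k + blockSum S s (k + 1)) / 2
      ≤ ∑ k ∈ Finset.range (K + 1), blockSum S s k - blockSum S s 0 / 2 := by
  have : ∑ k ∈ Finset.range K, (blockSum S s k + blockSum S s (k + 1)) / 2
      = ∑ k ∈ Finset.range (K + 1), blockSum S s k - blockSum S s 0 / 2 - blockSum S s K / 2 := by
    induction K with
    | zero => simp only [Finset.sum_range_zero, zero_add, Finset.sum_range_one]; ring
    | succ K ih => rw [Finset.sum_range_succ, ih, Finset.sum_range_succ _ (K + 1)]; ring
  have := blockSum_nonneg (s := s) h0 K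
  linarith

end blocks

section blockDecomposition
open Matrix
variable {m n₁ n₂ : ℕ} {r : ℕ}

lemma rank_sum_smul_vecMulVec_le {ι : Type*} [Fintype ι] (w : ι → ℝ) (u : ι → Fin n₁ → ℝ)
    (v : ι → Fin n₂ → ℝ) : (tensorSum w u v).rank ≤ Fintype.card ι := by
  classical
  have h : ∀ t : Finset ι, (∑ i ∈ t, w i • vecMulVec (u i) (v i)).rank ≤ t.card := by
    intro t
    induction t using Finset.induction_on with
    | empty => simp
    | insert a t ha ih =>
      rw [Finset.sum_insert ha, Finset.card_insert_of_notMem ha, add_comm]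
      refine (matrix_rank_add_le _ _).trans (add_le_add ih ?_)
      rw [← smul_vecMulVec]
      exact Matrix.rank_vecMulVec_le _ _
  exact h Finset.univ

/-- The pieces of the normal part `M` of a matrix, cut into blocks of `s` singular values: a
decreasing sequence `S` of singular values, with the blocks as matrices `B k`. -/
lemma exists_blocks {M : Matrix (Fin n₁) (Fin n₂) ℝ} {σ : Fin n₁ → ℝ} {x : Fin n₁ → Fin n₁ → ℝ}
    {y : Fin n₁ → Fin n₂ → ℝ} (h : PartSVD M σ x y) {s : ℕ} (hs : 1 ≤ s)
    {T : Matrix (Fin n₁) (Fin n₂) ℝ} (hT : ∀ j, 0 < σ j → x j ⬝ᵥ (T *ᵥ y j) = 0) :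
    ∃ (S : ℕ → ℝ) (B : ℕ → Matrix (Fin n₁) (Fin n₂) ℝ), Antitone S ∧ (∀ j, 0 ≤ S j) ∧
      (∑ k ∈ Finset.range (n₁ + 1), blockSum S s k = ∑ j, σ j) ∧
      (M = ∑ k ∈ Finset.range (n₁ + 1), B k) ∧ (∀ k, (B k).rank ≤ s) ∧
      (∀ k, frobNorm (B k) ^ 2 = ∑ i : Fin s, S (k * s + i) ^ 2) ∧
      (∀ k l, k ≠ l → traceInner (B k) (B l) = 0) ∧ (∀ k, traceInner T (B k) = 0) := by
  obtain ⟨S, hS⟩ : ∃ S : ℕ → ℝ, ∀ j, S j = if hj : j < n₁ then σ ⟨j, hj⟩ else 0 := ⟨_, fun _ => rfl⟩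
  obtain ⟨x', hx⟩ : ∃ x' : ℕ → Fin n₁ → ℝ, ∀ j, x' j = if hj : j < n₁ then x ⟨j, hj⟩ else 0 :=
    ⟨_, fun _ => rfl⟩
  obtain ⟨y', hy⟩ : ∃ y' : ℕ → Fin n₂ → ℝ, ∀ j, y' j = if hj : j < n₁ then y ⟨j, hj⟩ else 0 :=
    ⟨_, fun _ => rfl⟩
  have hlt : ∀ j, S j ≠ 0 → ∃ hj : j < n₁, 0 < σ ⟨j, hj⟩ ∧ S j = σ ⟨j, hj⟩ ∧ x' j = x ⟨j, hj⟩ ∧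
      y' j = y ⟨j, hj⟩ := by
    intro j hj
    have hjn : j < n₁ := by
      by_contra hc
      exact hj (by rw [hS, dif_neg hc])
    have h1 : S j = σ ⟨j, hjn⟩ := by rw [hS, dif_pos hjn]
    refine ⟨hjn, ?_, h1, by rw [hx, dif_pos hjn], by rw [hy, dif_pos hjn]⟩
    exact (h.nonneg _).lt_of_ne' (by rwa [← h1])
  have hS0 : ∀ j, 0 ≤ S j := by
    intro j
    rw [hS]
    split_ifs
    · exact h.nonneg _
    · exact le_rfl
  have hortho : ∀ i j, S i ≠ 0 → S j ≠ 0 →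
      (x' i ⬝ᵥ x' j) * (y' i ⬝ᵥ y' j) = if i = j then 1 else 0 := by
    intro i j hi hj
    obtain ⟨hi1, hi2, -, hi3, hi4⟩ := hlt i hi
    obtain ⟨hj1, hj2, -, hj3, hj4⟩ := hlt j hj
    have := h.left.mul_eq_ite h.right ⟨⟨i, hi1⟩, hi2⟩ ⟨⟨j, hj1⟩, hj2⟩
    rw [hi3, hi4, hj3, hj4, this]
    simp [Subtype.ext_iff]
  have hsum : ∀ {E : Type} [AddCommMonoid E] (f : ℕ → E) (g : Fin n₁ → E),
      (∀ j : Fin n₁, f j = g j) → (∀ j, n₁ ≤ j → f j = 0) →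
      ∑ k ∈ Finset.range (n₁ + 1), ∑ i : Fin s, f (k * s + i) = ∑ j, g j := by
    intro E _ f g hfg hf0
    rw [← sum_range_mul_eq, ← Finset.sum_congr rfl fun j _ => hfg j, Fin.sum_univ_eq_sum_range]
    refine (Finset.sum_subset ?_ ?_).symm
    · intro j hj
      rw [Finset.mem_range] at hj ⊢
      nlinarith
    · intro j _ hj
      exact hf0 j (by simpa using hj)
  have hne : ∀ k l : ℕ, k ≠ l → ∀ i j : Fin s, k * s + (i : ℕ) ≠ l * s + j := by
    intro k l hkl i j he
    apply hkl
    have h1 : (k * s + (i : ℕ)) / s = k := by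
      rw [mul_comm, Nat.mul_add_div hs, Nat.div_eq_of_lt i.2, add_zero]
    have h2 : (l * s + (j : ℕ)) / s = l := by
      rw [mul_comm, Nat.mul_add_div hs, Nat.div_eq_of_lt j.2, add_zero]
    rw [← h1, he, h2]
  refine ⟨S, fun k => tensorSum (fun i : Fin s => S (k * s + i)) (fun i => x' (k * s + i))
    (fun i => y' (k * s + i)), ?_, hS0, ?_, ?_, ?_, ?_, ?_, ?_⟩
  · intro i j hij
    rw [hS j]
    split_ifs with hj
    · rw [hS, dif_pos (by omega)]
      exact h.anti hij
    · exact hS0 i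
  · exact hsum S σ (fun j => by rw [hS, dif_pos j.2]) fun j hj => by rw [hS, dif_neg (by omega)]
  · rw [h.eq]
    refine (hsum (fun j => S j • vecMulVec (x' j) (y' j)) _ (fun j => ?_) fun j hj => ?_).symm
    · simp only [hS, hx, hy, dif_pos j.2]
    · rw [hS, dif_neg (by omega), zero_smul]
  · intro k
    simpa using rank_sum_smul_vecMulVec_le (fun i : Fin s => S (k * s + i))
      (fun i => x' (k * s + i)) (fun i => y' (k * s + i))
  · intro k
    refine frobNorm_sq_tensorSum fun i j hi hj => ?_
    rw [hortho _ _ hi hj]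
    simp [Fin.ext_iff]
  · intro k l hkl
    rw [traceInner_tensorSum_tensorSum]
    refine Finset.sum_eq_zero fun i _ => Finset.sum_eq_zero fun j _ => ?_
    by_cases hi : S (k * s + i) = 0
    · rw [hi]; simp
    by_cases hj : S (l * s + j) = 0
    · rw [hj]; simp
    rw [hortho _ _ hi hj, if_neg (hne k l hkl i j), mul_zero]
  · intro k
    rw [traceInner_comm, traceInner_tensorSum_left]
    refine Finset.sum_eq_zero fun i _ => ?_
    by_cases hi : S (k * s + i) = 0
    · rw [hi]; simp
    obtain ⟨h1, h2, -, h3, h4⟩ := hlt _ hi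
    rw [h3, h4, hT _ h2, mul_zero]

end blockDecomposition

section restricted
variable {m n₁ n₂ : ℕ} {A : Fin m → Matrix (Fin n₁) (Fin n₂) ℝ}

/-- The two consequences of the restricted eigenvalue condition for `J + ∑ Bₖ` with a small image,
where `J` is the main part and the `Bₖ` are the remaining blocks. -/
lemma restricted_bounds {K k₀ s : ℕ} {κ L δ u : ℝ} (hL : L = thetaMin A K) (hL0 : 0 < L)
    (hκ : 0 ≤ κ) (hu : 0 ≤ u) (hs : thetaMax A s ≤ (1 + κ ^ 2) * L) (hK : k₀ + s ≤ K)
    (hK2 : s + s ≤ K) {J : Matrix (Fin n₁) (Fin n₂) ℝ} {t : Finset ℕ}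
    {B : ℕ → Matrix (Fin n₁) (Fin n₂) ℝ} (hJ : J.rank ≤ k₀) (hB : ∀ k, (B k).rank ≤ s)
    (hJB : ∀ k ∈ t, traceInner J (B k) = 0)
    (hAJ : ‖sample A J‖ ^ 2 = L * frobNorm J ^ 2 * (1 + u ^ 2))
    (hΔ : ‖sample A (J + ∑ k ∈ t, B k)‖ ≤ 2 * δ) :
    (L * frobNorm J ^ 2 * (1 + u ^ 2) - L * frobNorm J * u * (κ * ∑ k ∈ t, frobNorm (B k))
      ≤ 2 * δ * (√L * frobNorm J * √(1 + u ^ 2))) ∧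
    L * frobNorm J ^ 2 * (1 + u ^ 2) - 2 * (L * frobNorm J * u * (κ * ∑ k ∈ t, frobNorm (B k)))
      + L * frobNorm (∑ k ∈ t, B k) ^ 2 - L * (κ * ∑ k ∈ t, frobNorm (B k)) ^ 2
      ≤ (2 * δ) ^ 2 := by
  set R := ∑ k ∈ t, B k with hR
  set G := ∑ k ∈ t, frobNorm (B k) with hG
  have hLs : √L * √L = L := Real.mul_self_sqrt hL0.le
  have hLs2 : √L ^ 2 = L := Real.sq_sqrt hL0.le
  have hJ0 := frobNorm_nonneg J
  -- the blocks
  have hBB : ∀ k, defect A (thetaMin A K) (B k) (B k) ≤ (√L * κ * frobNorm (B k)) ^ 2 := by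
    intro k
    rw [defect_self, mul_pow, mul_pow, hLs2, ← hL]
    have h1 := le_thetaMax_mul A (hB k)
    have h2 := mul_le_mul_of_nonneg_right hs (sq_nonneg (frobNorm (B k)))
    linarith
  have hJJ : defect A (thetaMin A K) J J ≤ (√L * frobNorm J * u) ^ 2 := by
    rw [defect_self, hAJ, mul_pow, mul_pow, hLs2, ← hL]
    linarith
  have hJBk : ∀ k ∈ t, -(L * frobNorm J * u * (κ * frobNorm (B k)))
      ≤ inner ℝ (sample A J) (sample A (B k)) := by
    intro k hk
    have h := neg_mul_le_defect A hK hJ (hB k)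
      (mul_nonneg (mul_nonneg (Real.sqrt_nonneg L) hJ0) hu)
      (mul_nonneg (mul_nonneg (Real.sqrt_nonneg L) hκ) (frobNorm_nonneg (B k))) hJJ (hBB k)
    rw [defect, hJB k hk, mul_zero, sub_zero] at h
    refine le_trans (le_of_eq ?_) h
    linear_combination (frobNorm J * u * κ * frobNorm (B k)) * hLs
  have hJR : -(L * frobNorm J * u * (κ * G)) ≤ inner ℝ (sample A J) (sample A R) := by
    rw [hR, sample_sum, inner_sum, hG, Finset.mul_sum, Finset.mul_sum, ← Finset.sum_neg_distrib]
    exact Finset.sum_le_sum hJBk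
  have hRR : L * frobNorm R ^ 2 - L * (κ * G) ^ 2 ≤ ‖sample A R‖ ^ 2 := by
    have h1 : -(L * (κ * G) ^ 2) ≤ defect A (thetaMin A K) R R := by
      rw [hR, defect_self_sum]
      have h2 : -(L * (κ * G) ^ 2) = ∑ k ∈ t, ∑ l ∈ t,
          -((√L * κ * frobNorm (B k)) * (√L * κ * frobNorm (B l))) := by
        simp only [Finset.sum_neg_distrib]
        rw [← Finset.sum_mul_sum, ← Finset.mul_sum, ← hG]
        linear_combination (κ * G) ^ 2 * hLs
      rw [h2]
      refine Finset.sum_le_sum fun k _ => Finset.sum_le_sum fun l _ => ?_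
      exact neg_mul_le_defect A hK2 (hB k) (hB l)
        (mul_nonneg (mul_nonneg (Real.sqrt_nonneg L) hκ) (frobNorm_nonneg (B k)))
        (mul_nonneg (mul_nonneg (Real.sqrt_nonneg L) hκ) (frobNorm_nonneg (B l))) (hBB k) (hBB l)
    rw [defect_self, ← hL] at h1
    linarith
  have hnorm : ‖sample A J‖ = √L * frobNorm J * √(1 + u ^ 2) := by
    rw [← Real.sqrt_sq (norm_nonneg _), hAJ, Real.sqrt_mul (by positivity),
      Real.sqrt_mul hL0.le, Real.sqrt_sq hJ0]
  rw [sample_add] at hΔ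
  constructor
  · have h1 := real_inner_le_norm (sample A J) (sample A J + sample A R)
    rw [inner_add_right, real_inner_self_eq_norm_sq, hAJ] at h1
    have h2 : ‖sample A J‖ * ‖sample A J + sample A R‖ ≤ ‖sample A J‖ * (2 * δ) := by gcongr
    rw [← hnorm]
    linarith
  · have h1 : ‖sample A J + sample A R‖ ^ 2 ≤ (2 * δ) ^ 2 := by gcongr
    rw [norm_add_sq_real, hAJ] at h1
    linarith

end restricted

section error
open Matrix
variable {m n₁ n₂ : ℕ} {A : Fin m → Matrix (Fin n₁) (Fin n₂) ℝ} {r s : ℕ}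
  {p : Fin n₁ → Fin n₁ → ℝ} {q : Fin n₁ → Fin n₂ → ℝ} {Z : Matrix (Fin n₁) (Fin n₂) ℝ}
  {σ : Fin n₁ → ℝ} {x : Fin n₁ → Fin n₁ → ℝ} {y : Fin n₁ → Fin n₂ → ℝ} {κ δ γ L : ℝ}

/-- Both extrema include the Rayleigh quotient of a matrix of rank one. -/
lemma thetaMin_le_thetaMax_of_pos {k : ℕ} (hs1 : 1 ≤ s) (hn : 0 < n₁) (hp : Orth p) (hq : Orth q)
    (hsk : s ≤ k) : thetaMin A k ≤ thetaMax A s := by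
  set Y := vecMulVec (p ⟨0, hn⟩) (q ⟨0, hn⟩) with hY
  have h1 : frobNorm Y ^ 2 = 1 := by
    rw [← traceInner_self_eq, hY, traceInner_vecMulVec_vecMulVec, hp.self, hq.self, one_mul]
  have hrk : Y.rank ≤ s := (Matrix.rank_vecMulVec_le _ _).trans hs1
  have h2 := thetaMin_mul_le A (hrk.trans hsk)
  have h3 := le_thetaMax_mul A hrk
  rw [h1] at h2 h3
  linarith

lemma thetaMin_nonneg (A : Fin m → Matrix (Fin n₁) (Fin n₂) ℝ) (k : ℕ) : 0 ≤ thetaMin A k := by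
  refine Real.sInf_nonneg ?_
  rintro _ ⟨X, -, rfl⟩
  simp only [traceInner_sampleAdj]
  positivity

/-- Decomposition of `Z` into a main part `J`, which holds the tangent part and the first `s` singular
values of the normal part, and a tail of blocks of rank at most `s`; `N₀` is the sum of those first
singular values. -/
lemma exists_main_tail (hs1 : 1 ≤ s) (hr : r ≤ n₁) (hp : Orth p) (hq : Orth q)
    (h : PartSVD (perpPart r p q Z) σ x y) :
    ∃ (J : Matrix (Fin n₁) (Fin n₂) ℝ) (B : ℕ → Matrix (Fin n₁) (Fin n₂) ℝ) (N₀ : ℝ),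
      Z = J + ∑ k ∈ Finset.range n₁, B k ∧ J.rank ≤ 2 * r + s ∧ (∀ k, (B k).rank ≤ s) ∧
      (∀ k ∈ Finset.range n₁, traceInner J (B k) = 0) ∧ 0 ≤ N₀ ∧ N₀ ≤ ∑ j, σ j ∧
      frobNorm (tanPart r p q Z) ^ 2 + N₀ ^ 2 / s ≤ frobNorm J ^ 2 ∧
      s * frobNorm (∑ k ∈ Finset.range n₁, B k) ^ 2 ≤ N₀ * (∑ j, σ j - N₀) ∧
      √s * ∑ k ∈ Finset.range n₁, frobNorm (B k) ≤ ∑ j, σ j - N₀ / 2 ∧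
      frobNorm Z ^ 2 = frobNorm J ^ 2 + frobNorm (∑ k ∈ Finset.range n₁, B k) ^ 2 := by
  obtain ⟨S, B, hSa, hS0, hSN, hM, hBr, hBn, hBB, hTB⟩ := exists_blocks h hs1
    (T := tanPart r p q Z) fun j hj => dotProduct_tanPart_mulVec hp hq h hj
  have hsR : (0 : ℝ) < s := by exact_mod_cast hs1
  have hsq2 : √(s : ℝ) ^ 2 = s := Real.sq_sqrt hsR.le
  have hZJR : Z = tanPart r p q Z + B 0 + ∑ k ∈ Finset.range n₁, B (k + 1) := by
    conv_lhs => rw [← tanPart_add_perpPart (r := r) (p := p) (q := q) Z]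
    rw [hM, Finset.sum_range_succ']
    abel
  have hJB : ∀ k ∈ Finset.range n₁, traceInner (tanPart r p q Z + B 0) (B (k + 1)) = 0 := by
    intro k _
    rw [traceInner_add_left, hTB, hBB 0 (k + 1) (by omega), add_zero]
  have hJsq : frobNorm (tanPart r p q Z + B 0) ^ 2
      = frobNorm (tanPart r p q Z) ^ 2 + frobNorm (B 0) ^ 2 := by
    rw [frobNorm_sq_add, hTB]; ring
  have hRsq : frobNorm (∑ k ∈ Finset.range n₁, B (k + 1)) ^ 2
      = ∑ k ∈ Finset.range n₁, frobNorm (B (k + 1)) ^ 2 := by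
    rw [← traceInner_self_eq, traceInner_sum_left]
    refine Finset.sum_congr rfl fun k hk => ?_
    rw [traceInner_sum_right, Finset.sum_eq_single k, traceInner_self_eq]
    · intro l _ hl
      exact hBB _ _ (by omega)
    · exact fun h => absurd hk h
  have hZsq : frobNorm Z ^ 2 = frobNorm (tanPart r p q Z + B 0) ^ 2
      + frobNorm (∑ k ∈ Finset.range n₁, B (k + 1)) ^ 2 := by
    have : traceInner (tanPart r p q Z + B 0) (∑ k ∈ Finset.range n₁, B (k + 1)) = 0 := by
      rw [traceInner_sum_right]
      exact Finset.sum_eq_zero hJB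
    conv_lhs => rw [hZJR]
    rw [frobNorm_sq_add, this]; ring
  have htail : ∑ k ∈ Finset.range n₁, blockSum S s (k + 1) = ∑ j, σ j - blockSum S s 0 := by
    rw [← hSN, Finset.sum_range_succ']; ring
  have hBsq : ∀ k, s * frobNorm (B (k + 1)) ^ 2 ≤ blockSum S s k * blockSum S s (k + 1) := by
    intro k
    rw [hBn]; exact mul_sum_sq_le hSa hS0 k
  refine ⟨tanPart r p q Z + B 0, fun k => B (k + 1), blockSum S s 0, hZJR,
    (matrix_rank_add_le _ _).trans (add_le_add (tanPart_rank_le _ hr) (hBr 0)),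
    fun k => hBr (k + 1), hJB, blockSum_nonneg hS0 0, ?_, ?_, ?_, ?_, hZsq⟩
  · have : 0 ≤ ∑ k ∈ Finset.range n₁, blockSum S s (k + 1) :=
      Finset.sum_nonneg fun k _ => blockSum_nonneg hS0 _
    linarith
  · rw [hJsq]
    have : blockSum S s 0 ^ 2 / s ≤ frobNorm (B 0) ^ 2 := by
      rw [div_le_iff₀' hsR, hBn]; exact sq_blockSum_le S s 0
    linarith
  · rw [hRsq, Finset.mul_sum, ← htail, Finset.mul_sum]
    refine Finset.sum_le_sum fun k _ => (hBsq k).trans ?_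
    exact mul_le_mul_of_nonneg_right (blockSum_anti hSa k) (blockSum_nonneg hS0 _)
  · rw [Finset.mul_sum, ← hSN]
    refine le_trans (Finset.sum_le_sum fun k _ => ?_) (sum_blockSum_mean S hS0 s n₁)
    have h1 := hBsq k
    have h2 := blockSum_nonneg (s := s) hS0 k
    have h3 := blockSum_nonneg (s := s) hS0 (k + 1)
    refine (abs_le_of_sq_le_sq' ?_ (by linarith)).2
    rw [mul_pow, hsq2]
    linear_combination h1 + sq_nonneg (blockSum S s k - blockSum S s (k + 1)) / 4

set_option maxHeartbeats 400000 in
/-- The scalars that describe an error matrix `Z` in a cone, measured in units of the norm of its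
tangent part. -/
lemma exists_scalars (hs1 : 1 ≤ s) (hr0 : 0 < r) (hr : r ≤ n₁) (hL : L = thetaMin A (2 * r + 2 * s))
    (hL0 : 0 < L) (hκ : 0 ≤ κ) (hratio : thetaMax A s ≤ (1 + κ ^ 2) * L) (hp : Orth p) (hq : Orth q)
    (hZ : ‖sample A Z‖ ≤ 2 * δ) (hδ : 0 ≤ δ) (h : PartSVD (perpPart r p q Z) σ x y)
    (ht : 0 < frobNorm (tanPart r p q Z))
    (hN : ∑ j, σ j ≤ √(2 * r) * γ * frobNorm (tanPart r p q Z)) :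
    ∃ a g D H u u0 B : ℝ, 0 ≤ a ∧ a ≤ 2 * (√(r / (2 * s)) * γ) ∧ 0 < D ∧ 1 + a ^ 2 ≤ D ^ 2 ∧
      g ^ 2 ≤ a * (2 * (√(r / (2 * s)) * γ) - a) ∧ 0 ≤ H ∧
      H ≤ κ * (2 * (√(r / (2 * s)) * γ) - a / 2) ∧ 0 ≤ u0 ∧ u0 ≤ u ∧ u0 ≤ κ ∧ 0 ≤ B ∧
      D * (1 + u ^ 2) - H * u ≤ B * √(1 + u ^ 2) ∧
      D ^ 2 + g ^ 2 + D ^ 2 * u ^ 2 - 2 * D * u * H - H ^ 2 ≤ B ^ 2 ∧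
      B * √(1 + u ^ 2) ≤ (2 * δ * √(thetaMax A (2 * r + s)) / thetaMin A (2 * r + s)) /
        frobNorm (tanPart r p q Z) * (1 + u0 ^ 2) ∧
      frobNorm Z = frobNorm (tanPart r p q Z) * √(D ^ 2 + g ^ 2) := by
  obtain ⟨J, B, N0, hZJR, hJrank, hBr, hJB, hN0nn, hN0N, hJsq, hRle, hGle, hZsq⟩ :=
    exists_main_tail hs1 hr hp hq h
  obtain ⟨t, htt⟩ : ∃ t, t = frobNorm (tanPart r p q Z) := ⟨_, rfl⟩
  rw [← htt] at ht hN hJsq ⊢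
  have hsR : (0 : ℝ) < s := by exact_mod_cast hs1
  obtain ⟨R, hR⟩ : ∃ R, R = ∑ k ∈ Finset.range n₁, B k := ⟨_, rfl⟩
  rw [← hR] at hZJR hRle hZsq
  have hJ2 : 0 < frobNorm J ^ 2 := lt_of_lt_of_le (by positivity) hJsq
  have hJpos : 0 < frobNorm J := by
    refine (frobNorm_nonneg J).lt_of_ne' fun h => ?_
    rw [h] at hJ2; norm_num at hJ2
  have hJne : J ≠ 0 := fun h => hJpos.ne' ((frobNorm_eq_zero J).2 h)
  -- the ratio `u`
  obtain ⟨θ, hθ⟩ : ∃ θ, θ = thetaMin A (2 * r + s) := ⟨_, rfl⟩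
  have hθL : L ≤ θ := by
    rw [hL, hθ]
    exact thetaMin_le_of_rank_le A (by omega) hJne hJrank
  have hθ0 : 0 < θ := hL0.trans_le hθL
  have hAJ1 : θ * frobNorm J ^ 2 ≤ ‖sample A J‖ ^ 2 := by
    rw [hθ]; exact thetaMin_mul_le A hJrank
  obtain ⟨u, hu⟩ : ∃ u, u = √(‖sample A J‖ ^ 2 / (L * frobNorm J ^ 2) - 1) := ⟨_, rfl⟩
  obtain ⟨u0, hu0⟩ : ∃ u0, u0 = √(θ / L - 1) := ⟨_, rfl⟩
  have hle : θ / L ≤ ‖sample A J‖ ^ 2 / (L * frobNorm J ^ 2) := by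
    rw [div_le_div_iff₀ hL0 (by positivity)]
    linear_combination L * hAJ1
  have h1le : 1 ≤ θ / L := by rwa [one_le_div hL0]
  have hu0sq : u0 ^ 2 = θ / L - 1 := by rw [hu0, Real.sq_sqrt (by linarith)]
  have husq : u ^ 2 = ‖sample A J‖ ^ 2 / (L * frobNorm J ^ 2) - 1 := by
    rw [hu, Real.sq_sqrt (by linarith)]
  have hunn : 0 ≤ u := by rw [hu]; exact Real.sqrt_nonneg _
  have hu0u : u0 ≤ u := by rw [hu0, hu]; exact Real.sqrt_le_sqrt (by linarith)
  have hu0κ : u0 ≤ κ := by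
    rw [hu0, Real.sqrt_le_left hκ]
    have h1 : θ ≤ thetaMax A s := by
      rw [hθ]; exact thetaMin_le_thetaMax_of_pos hs1 (hr0.trans_le hr) hp hq (by omega)
    have h2 : θ / L ≤ 1 + κ ^ 2 := by rw [div_le_iff₀ hL0]; linarith
    linarith
  have hAJ : ‖sample A J‖ ^ 2 = L * frobNorm J ^ 2 * (1 + u ^ 2) := by
    rw [husq]; field_simp; ring
  have hθu0 : θ = L * (1 + u0 ^ 2) := by rw [hu0sq]; field_simp; ring
  have hB := restricted_bounds (k₀ := 2 * r + s) (s := s) (t := Finset.range n₁) (B := B)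
    hL hL0 hκ hunn hratio (by omega) (by omega) hJrank hBr hJB hAJ (by rw [← hR, ← hZJR]; exact hZ)
  rw [← hR] at hB
  obtain ⟨G, hG⟩ : ∃ G, G = ∑ k ∈ Finset.range n₁, frobNorm (B k) := ⟨_, rfl⟩
  rw [← hG] at hB hGle
  obtain ⟨hB1, hB2⟩ := hB
  have hsq2 : √(s : ℝ) ^ 2 = s := Real.sq_sqrt hsR.le
  have hs0 : 0 < √(s : ℝ) := Real.sqrt_pos.2 hsR
  obtain ⟨N, hNdef⟩ : ∃ N, N = ∑ j, σ j := ⟨_, rfl⟩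
  rw [← hNdef] at hN hN0N hRle hGle
  have hxγ : √(2 * r) * γ = √s * (2 * (√(r / (2 * s)) * γ)) := by
    have h1 : √(2 * (r : ℝ)) = √s * (2 * √(r / (2 * s))) := by
      rw [← Real.sqrt_sq (by norm_num : (0 : ℝ) ≤ 2), ← Real.sqrt_mul (by positivity),
        ← Real.sqrt_mul (by positivity)]
      congr 1
      field_simp
      norm_num
    rw [h1]; ring
  rw [hxγ] at hN
  obtain ⟨ξ, hξ⟩ : ∃ ξ, ξ = √(r / (2 * s)) * γ := ⟨_, rfl⟩
  rw [← hξ] at hN ⊢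
  have hNξ : N / (√s * t) ≤ 2 * ξ := by
    rw [div_le_iff₀ (by positivity)]; linarith
  have hst : 0 < √(s : ℝ) * t := by positivity
  have hLs2 : √L ^ 2 = L := Real.sq_sqrt hL0.le
  have hLpos : 0 < √L := Real.sqrt_pos.2 hL0
  have hGnn : 0 ≤ G := by rw [hG]; exact Finset.sum_nonneg fun k _ => frobNorm_nonneg _
  have haN : N0 / (√s * t) ≤ N / (√s * t) := by gcongr
  refine ⟨N0 / (√s * t), frobNorm R / t, frobNorm J / t, κ * G / t, u, u0, 2 * δ / (t * √L),
    by positivity, haN.trans hNξ, by positivity, ?_, ?_, by positivity, ?_,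
    by rw [hu0]; exact Real.sqrt_nonneg _, hu0u, hu0κ, by positivity, ?_, ?_, ?_, ?_⟩
  · rw [div_pow, div_pow, mul_pow, hsq2]
    rw [show 1 + N0 ^ 2 / (s * t ^ 2) = (t ^ 2 + N0 ^ 2 / s) / t ^ 2 by field_simp]
    gcongr
  · have h1 : frobNorm R ^ 2 ≤ N0 * (N - N0) / s := by rw [le_div_iff₀ hsR]; linarith
    calc (frobNorm R / t) ^ 2 ≤ N0 * (N - N0) / s / t ^ 2 := by rw [div_pow]; gcongr
      _ = N0 / (√s * t) * (N / (√s * t) - N0 / (√s * t)) := by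
        field_simp; rw [hsq2]
      _ ≤ _ := by gcongr
  · have h1 : G ≤ (N - N0 / 2) / √s := by rw [le_div_iff₀ hs0]; linarith
    calc κ * G / t ≤ κ * ((N - N0 / 2) / √s) / t := by gcongr
      _ = κ * (N / (√s * t) - N0 / (√s * t) / 2) := by field_simp
      _ ≤ _ := by gcongr
  · have h1 : (frobNorm J * (1 + u ^ 2) - u * (κ * G)) * (L * frobNorm J)
        ≤ (2 * δ * √(1 + u ^ 2) / √L) * (L * frobNorm J) := by
      have : (2 * δ * √(1 + u ^ 2) / √L) * (L * frobNorm J)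
          = 2 * δ * (√L * frobNorm J * √(1 + u ^ 2)) := by
        nth_rw 2 [← hLs2]; field_simp
      rw [this]
      linarith
    have h2 := le_of_mul_le_mul_right h1 (by positivity)
    calc frobNorm J / t * (1 + u ^ 2) - κ * G / t * u
        = (frobNorm J * (1 + u ^ 2) - u * (κ * G)) / t := by ring
      _ ≤ (2 * δ * √(1 + u ^ 2) / √L) / t := by gcongr
      _ = _ := by field_simp
  · have h1 : (frobNorm J ^ 2 * (1 + u ^ 2) - 2 * (frobNorm J * u * (κ * G)) + frobNorm R ^ 2
        - (κ * G) ^ 2) ≤ (2 * δ) ^ 2 / L := by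
      rw [le_div_iff₀ hL0]; linarith
    calc (frobNorm J / t) ^ 2 + (frobNorm R / t) ^ 2 + (frobNorm J / t) ^ 2 * u ^ 2
          - 2 * (frobNorm J / t) * u * (κ * G / t) - (κ * G / t) ^ 2
        = (frobNorm J ^ 2 * (1 + u ^ 2) - 2 * (frobNorm J * u * (κ * G)) + frobNorm R ^ 2
        - (κ * G) ^ 2) / t ^ 2 := by ring
      _ ≤ (2 * δ) ^ 2 / L / t ^ 2 := by gcongr
      _ = (2 * δ / (t * √L)) ^ 2 := by rw [div_pow (2 * δ), mul_pow t, hLs2]; field_simp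
  · rw [← hθ]
    have h1 : √L * √(1 + u ^ 2) ≤ √(thetaMax A (2 * r + s)) := by
      rw [← Real.sqrt_mul hL0.le]
      refine Real.sqrt_le_sqrt ?_
      have := le_thetaMax_mul A hJrank
      rw [hAJ] at this
      have h2 : L * (1 + u ^ 2) * frobNorm J ^ 2 ≤ thetaMax A (2 * r + s) * frobNorm J ^ 2 := by
        linarith
      exact le_of_mul_le_mul_right h2 hJ2
    calc 2 * δ / (t * √L) * √(1 + u ^ 2) = 2 * δ * (√L * √(1 + u ^ 2)) / (t * L) := by
          nth_rw 3 [← hLs2]; field_simp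
      _ ≤ 2 * δ * √(thetaMax A (2 * r + s)) / (t * L) := by gcongr
      _ = _ := by rw [hθu0]; field_simp
  · rw [div_pow, div_pow, ← add_div, ← hZsq, ← div_pow, Real.sqrt_sq (by
      have := frobNorm_nonneg Z; positivity)]
    field_simp

/-- A matrix in the cone with vanishing tangent part is zero. -/
lemma eq_zero_of_tanPart_eq_zero (h : PartSVD (perpPart r p q Z) σ x y)
    (ht : frobNorm (tanPart r p q Z) = 0) (hN : ∑ j, σ j ≤ 0) : Z = 0 := by
  have h1 : ∀ j, σ j = 0 := by
    intro j
    have := (Finset.single_le_sum (fun i _ => h.nonneg i) (Finset.mem_univ j)).trans hN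
    exact le_antisymm this (h.nonneg j)
  have h2 : perpPart r p q Z = 0 := by
    rw [h.eq, tensorSum]
    exact Finset.sum_eq_zero fun j _ => by rw [h1, zero_smul]
  have h3 := (frobNorm_eq_zero _).1 ht
  rw [← tanPart_add_perpPart (r := r) (p := p) (q := q) Z, h2, h3, add_zero]

/-- The two error bounds for a matrix in the cone with parameter `γ`: the plain one, and the one
that exploits a larger cone parameter in the denominator. -/
theorem error_bounds (hs1 : 1 ≤ s) (hr0 : 0 < r) (hr : r ≤ n₁)
    (hL0 : 0 < thetaMin A (2 * r + 2 * s)) (hκ : 0 ≤ κ)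
    (hratio : thetaMax A s ≤ (1 + κ ^ 2) * thetaMin A (2 * r + 2 * s)) (hp : Orth p) (hq : Orth q)
    (hZ : ‖sample A Z‖ ≤ 2 * δ) (hδ : 0 ≤ δ) (h : PartSVD (perpPart r p q Z) σ x y)
    (hγ : 0 ≤ γ) (hN : ∑ j, σ j ≤ √(2 * r) * γ * frobNorm (tanPart r p q Z))
    {S ξ : ℝ} (hS : S = 2 * δ * √(thetaMax A (2 * r + s)) / thetaMin A (2 * r + s))
    (hξ : ξ = √(r / (2 * s)) * γ) :
    (κ * ξ < 1 → frobNorm Z * (1 - κ * ξ) ≤ S * √(1 + ξ ^ 2)) ∧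
    ∀ X k : ℝ, ξ ≤ X → κ * X < 1 → 1 ≤ k → ξ + 1 ≤ k * (1 + X / √(1 + X ^ 2)) →
      frobNorm Z * (1 - κ * X) ≤ k * S := by
  have hξ0 : 0 ≤ ξ := by rw [hξ]; positivity
  have hS0 : 0 ≤ S := by
    rw [hS]; exact div_nonneg (by positivity) (thetaMin_nonneg A _)
  rcases (frobNorm_nonneg (tanPart r p q Z)).eq_or_lt with ht | ht
  · rw [← ht, mul_zero] at hN
    have hZ0 := eq_zero_of_tanPart_eq_zero h ht.symm hN
    have hZf : frobNorm Z = 0 := (frobNorm_eq_zero Z).2 hZ0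
    rw [hZf, zero_mul]
    refine ⟨fun _ => by positivity, fun X k _ _ hk _ => ?_⟩
    rw [zero_mul]; positivity
  · obtain ⟨a, g, D, H, u, u0, B, h1, h2, h3, h4, h5, h6, h7, h8, h9, h10, h11, h12, h13, h14, h15⟩ :=
      exists_scalars hs1 hr0 hr rfl hL0 hκ hratio hp hq hZ hδ h ht hN
    rw [← hξ] at h2 h5 h7
    rw [← hS] at h14
    set t := frobNorm (tanPart r p q Z) with htdef
    constructor
    · intro hκξ
      have := crude_bound hκ hξ0 hκξ h1 h3 h4 h5 h7 h8 h9 h12 h14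
      rw [h15]
      calc t * √(D ^ 2 + g ^ 2) * (1 - κ * ξ) = t * (√(D ^ 2 + g ^ 2) * (1 - κ * ξ)) := by ring
        _ ≤ t * (S / t * √(1 + ξ ^ 2)) := by gcongr
        _ = S * √(1 + ξ ^ 2) := by field_simp
    · intro X k hX hκX hk hkX
      have := numeric_bound hκ hξ0 hX hκX hk hkX h1 h2 h3 h4 h5 h6 h7 h8 h9 h10 h11 h12 h13 h14
      rw [h15]
      calc t * √(D ^ 2 + g ^ 2) * (1 - κ * X) = t * (√(D ^ 2 + g ^ 2) * (1 - κ * X)) := by ring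
        _ ≤ t * (k * (S / t)) := by gcongr
        _ = k * S := by field_simp

end error

/-! ### The conjugate function -/

section conj
variable {φ : ℝ → EReal} {u v w y : ℝ}

lemma IsPhi.toReal_nonneg (hφ : IsPhi φ) {t : ℝ} (ht : t ∈ Icc (0 : ℝ) 1) : 0 ≤ (φ t).toReal :=
  EReal.toReal_nonneg (hφ.nonneg t ht)

lemma bddAbove_conj (hφ : IsPhi φ) (u : ℝ) :
    BddAbove ((fun t : ℝ => u * t - (φ t).toReal) '' Icc (0 : ℝ) 1) := by
  refine ⟨|u|, ?_⟩
  rintro _ ⟨t, ht, rfl⟩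
  have h1 := hφ.toReal_nonneg ht
  have h2 : u * t ≤ |u| * 1 := by
    have := le_abs_self u
    have := abs_nonneg u
    nlinarith [ht.1, ht.2]
  simp only
  linarith

lemma le_psiConj (hφ : IsPhi φ) (u : ℝ) {t : ℝ} (ht : t ∈ Icc (0 : ℝ) 1) :
    u * t - (φ t).toReal ≤ psiConj φ u :=
  le_csSup (bddAbove_conj hφ u) ⟨t, ht, rfl⟩

lemma psiConj_le {c : ℝ} (h : ∀ t ∈ Icc (0 : ℝ) 1, u * t - (φ t).toReal ≤ c) :
    psiConj φ u ≤ c := by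
  refine csSup_le ⟨_, 0, ⟨le_rfl, zero_le_one⟩, rfl⟩ ?_
  rintro _ ⟨t, ht, rfl⟩
  exact h t ht

lemma convexOn_psiConj (hφ : IsPhi φ) : ConvexOn ℝ univ (psiConj φ) := by
  refine ⟨convex_univ, fun x _ y _ a b ha hb hab => psiConj_le fun t ht => ?_⟩
  have h1 := mul_le_mul_of_nonneg_left (le_psiConj hφ x ht) ha
  have h2 := mul_le_mul_of_nonneg_left (le_psiConj hφ y ht) hb
  have h3 : (φ t).toReal = a * (φ t).toReal + b * (φ t).toReal := by rw [← add_mul, hab, one_mul]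
  simp only [smul_eq_mul]
  linarith

lemma psiConj_mono (hφ : IsPhi φ) (huv : u ≤ v) : psiConj φ u ≤ psiConj φ v :=
  psiConj_le fun t ht => by
    have := le_psiConj hφ v ht
    have := mul_le_mul_of_nonneg_right huv ht.1
    linarith

lemma psiConj_le_add (hφ : IsPhi φ) (huv : u ≤ v) : psiConj φ v ≤ psiConj φ u + (v - u) :=
  psiConj_le fun t ht => by
    have := le_psiConj hφ u ht
    have : (v - u) * t ≤ v - u := mul_le_of_le_one_right (by linarith) ht.2
    linarith

lemma subdiff_nonneg (hφ : IsPhi φ) (hw : w ∈ psiConjSubdiff φ u) : 0 ≤ w := by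
  have h1 := hw (u - 1)
  have h2 := psiConj_mono hφ (by linarith : u - 1 ≤ u)
  linarith

lemma subdiff_le_one (hφ : IsPhi φ) (hw : w ∈ psiConjSubdiff φ u) : w ≤ 1 := by
  have h1 := hw (u + 1)
  have h2 := psiConj_le_add hφ (by linarith : u ≤ u + 1)
  linarith

lemma psiConjRight_eq (hφ : IsPhi φ) (u : ℝ) :
    psiConjRight φ u = sInf (slope (psiConj φ) u '' {y ∈ univ | u < y}) :=
  (convexOn_psiConj hφ).rightDeriv_eq_sInf_slope_of_mem_interior (by simp)

lemma psiConjLeft_eq (hφ : IsPhi φ) (u : ℝ) :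
    psiConjLeft φ u = sSup (slope (psiConj φ) u '' {y ∈ univ | y < u}) :=
  (convexOn_psiConj hφ).leftDeriv_eq_sSup_slope_of_mem_interior (by simp)

lemma psiConjRight_mono (hφ : IsPhi φ) : Monotone (psiConjRight φ) := by
  have := (convexOn_psiConj hφ).monotoneOn_rightDeriv
  rw [interior_univ] at this
  exact fun a b hab => this (mem_univ a) (mem_univ b) hab

lemma psiConjLeft_mono (hφ : IsPhi φ) : Monotone (psiConjLeft φ) := by
  have := (convexOn_psiConj hφ).monotoneOn_leftDeriv
  rw [interior_univ] at this
  exact fun a b hab => this (mem_univ a) (mem_univ b) hab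

lemma slope_mem (hφ : IsPhi φ) (huv : u ≠ v) : slope (psiConj φ) u v ∈ Icc (0 : ℝ) 1 := by
  wlog h : u < v generalizing u v with H
  · rw [slope_comm]
    exact H huv.symm (lt_of_le_of_ne (not_lt.1 h) huv.symm)
  rw [slope_def_field]
  constructor
  · exact div_nonneg (sub_nonneg.2 (psiConj_mono hφ h.le)) (by linarith)
  · rw [div_le_one (by linarith)]
    linarith [psiConj_le_add hφ h.le]

lemma psiConjRight_nonneg (hφ : IsPhi φ) (u : ℝ) : 0 ≤ psiConjRight φ u := by
  rw [psiConjRight_eq hφ]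
  refine Real.sInf_nonneg ?_
  rintro _ ⟨y, hy, rfl⟩
  exact (slope_mem hφ hy.2.ne).1

lemma psiConjLeft_le_one (hφ : IsPhi φ) (u : ℝ) : psiConjLeft φ u ≤ 1 := by
  rw [psiConjLeft_eq hφ]
  refine csSup_le ⟨_, u - 1, by simp, rfl⟩ ?_
  rintro _ ⟨y, hy, rfl⟩
  exact (slope_mem hφ hy.2.ne').2

/-- Subgradients of the convex function `ψ*` lie below its right derivative at any point further
to the right. -/
lemma subdiff_le_psiConjRight (hφ : IsPhi φ) (hw : w ∈ psiConjSubdiff φ u) (huy : u ≤ y) :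
    w ≤ psiConjRight φ y := by
  refine le_trans ?_ (psiConjRight_mono hφ huy)
  rw [psiConjRight_eq hφ]
  refine le_csInf ⟨_, u + 1, by simp, rfl⟩ ?_
  rintro _ ⟨y, hy, rfl⟩
  rw [slope_def_field, le_div_iff₀ (sub_pos.2 hy.2)]
  linarith [hw y]

lemma psiConjLeft_le_subdiff (hφ : IsPhi φ) (hw : w ∈ psiConjSubdiff φ u) (huy : y ≤ u) :
    psiConjLeft φ y ≤ w := by
  refine (psiConjLeft_mono hφ huy).trans ?_
  rw [psiConjLeft_eq hφ]
  refine csSup_le ⟨_, u - 1, by simp, rfl⟩ ?_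
  rintro _ ⟨y, hy, rfl⟩
  rw [slope_comm, slope_def_field, div_le_iff₀ (sub_pos.2 hy.2)]
  linarith [hw y]

end conj

/-! ### The function `β̃` -/

section beta
variable {σ x y : ℝ}

/-- The logarithm inequality `2 (a - b) / (a + b) ≤ log (a / b)` for `a = 1`, `b = 1 - z`. -/
lemma two_div_le_neg_log {z : ℝ} (hz0 : 0 ≤ z) (hz : z < 1) : 2 * z / (2 - z) ≤ -Real.log (1 - z) := by
  have h1 : 0 < 1 - z := by linarith
  have h := Real.le_log_one_add_of_nonneg (x := z / (1 - z)) (by positivity)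
  have h2 : 1 + z / (1 - z) = (1 - z)⁻¹ := by field_simp; ring
  rw [h2, Real.log_inv] at h
  refine le_trans (le_of_eq ?_) h
  rw [div_eq_div_iff (by linarith) (by positivity)]
  field_simp
  ring

lemma betaTilde_eq : betaTilde σ x = -Real.log (1 - √2 * x / σ) / √2 := by
  rw [betaTilde]; ring

lemma betaTilde_mono (hσ : 0 < σ) (hxy : x ≤ y) (hy : √2 * y < σ) :
    betaTilde σ x ≤ betaTilde σ y := by
  rw [betaTilde_eq, betaTilde_eq]
  have h1 : 0 < 1 - √2 * y / σ := by rw [sub_pos, div_lt_one hσ]; exact hy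
  have h2 : 1 - √2 * y / σ ≤ 1 - √2 * x / σ := by gcongr
  have := Real.log_le_log h1 h2
  gcongr

lemma betaTilde_zero : betaTilde σ 0 = 0 := by simp [betaTilde]

lemma betaTilde_nonneg (hσ : 0 < σ) (hx : 0 ≤ x) (hy : √2 * x < σ) : 0 ≤ betaTilde σ x := by
  rw [← betaTilde_zero (σ := σ)]
  exact betaTilde_mono hσ hx hy

/-- `β̃` is convex and vanishes at `0`. -/
lemma betaTilde_le_mul (hσ : 0 < σ) (hx : 0 ≤ x) (hxy : x ≤ y) (hy0 : 0 < y) (hy : √2 * y < σ) :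
    betaTilde σ x ≤ x / y * betaTilde σ y := by
  rw [betaTilde_eq, betaTilde_eq]
  have h1 : 0 < 1 - √2 * y / σ := by rw [sub_pos, div_lt_one hσ]; exact hy
  have hc := strictConcaveOn_log_Ioi.concaveOn
  have h := hc.2 (mem_Ioi.2 h1) (mem_Ioi.2 (zero_lt_one' ℝ)) (by positivity : 0 ≤ x / y)
    (by rw [sub_nonneg, div_le_one hy0]; exact hxy : 0 ≤ 1 - x / y) (by ring)
  have h2 : (x / y) • (1 - √2 * y / σ) + (1 - x / y) • (1 : ℝ) = 1 - √2 * x / σ := by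
    simp only [smul_eq_mul]; field_simp; ring
  rw [h2] at h
  simp only [smul_eq_mul, Real.log_one, mul_zero, add_zero] at h
  rw [mul_div_assoc', mul_neg]
  gcongr

/-- The derivative of `β̃` at `t` is `1 / (σ - √2 t)`, which increases. -/
lemma betaTilde_le_div (hσ : 0 < σ) (hx : 0 ≤ x) (hxy : x ≤ y) (hy : √2 * y < σ) :
    betaTilde σ x ≤ x / (σ - √2 * y) := by
  have hx' : √2 * x ≤ √2 * y := by gcongr
  have h1 : 0 < 1 - √2 * x / σ := by rw [sub_pos, div_lt_one hσ]; linarith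
  have h2 := Real.one_sub_inv_le_log_of_pos h1
  have hs : (0 : ℝ) < √2 := by positivity
  rw [betaTilde_eq, div_le_iff₀ hs]
  have h3 : (1 - √2 * x / σ)⁻¹ = σ / (σ - √2 * x) := by
    rw [show 1 - √2 * x / σ = (σ - √2 * x) / σ by field_simp, inv_div]
  rw [h3] at h2
  have h4 : 0 < σ - √2 * x := by linarith
  have h5 : σ / (σ - √2 * x) - 1 = x / (σ - √2 * x) * √2 := by
    field_simp; ring
  have h6 : x / (σ - √2 * x) * √2 ≤ x / (σ - √2 * y) * √2 := by
    have : 0 < σ - √2 * y := by linarith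
    gcongr
  linarith

/-- `β̃` at `σ / 2` is at most `1`. -/
lemma betaTilde_lt_one (hσ : 0 < σ) (hxσ : 2 * x < σ) : betaTilde σ x < 1 := by
  have hs : (0 : ℝ) < √2 := by positivity
  have hs2 : √2 * √2 = (2 : ℝ) := Real.mul_self_sqrt (by norm_num)
  have hlt : √2 < (2 : ℝ) := by nlinarith
  rw [betaTilde_eq, div_lt_one hs]
  -- `exp √2 ≥ 1 + √2 + 1 = √2 / (√2 - 1)`
  have h1 : 1 + √2 + (√2) ^ 2 / 2 ≤ Real.exp √2 := Real.quadratic_le_exp_of_nonneg hs.le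
  have h2 : 1 - √2 / 2 < 1 - √2 * x / σ := by
    have : √2 * x / σ < √2 / 2 := by
      rw [div_lt_div_iff₀ hσ (by norm_num)]
      nlinarith
    linarith
  have h3 : Real.exp (-√2) ≤ 1 - √2 / 2 := by
    rw [Real.exp_neg, inv_le_comm₀ (Real.exp_pos _) (by linarith)]
    refine le_trans ?_ h1
    rw [inv_le_iff_one_le_mul₀ (by linarith)]
    nlinarith
  have h4 := Real.lt_log_iff_exp_lt (y := 1 - √2 * x / σ) (x := -√2) (by linarith) |>.2 (by linarith)
  linarith

/-- The rotation of the leading singular vectors, bounded by the mean of the gaps `σ` and `σ - √2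
x`, is at most `β̃`. -/
lemma lead_bound_le_betaTilde (hσ : 0 < σ) (hx : 0 ≤ x) (hy : √2 * x < σ) {d : ℝ}
    (hd : (σ - √2 * x + σ) / 2 * d ≤ x) : d ≤ betaTilde σ x := by
  have hs : (0 : ℝ) < √2 := by positivity
  have h1 := two_div_le_neg_log (z := √2 * x / σ) (by positivity) (by rw [div_lt_one hσ]; exact hy)
  rw [betaTilde_eq, le_div_iff₀ hs]
  refine le_trans ?_ h1
  have h2 : 2 * (√2 * x / σ) / (2 - √2 * x / σ) = 2 * x / (2 * σ - √2 * x) * √2 := by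
    have : 0 < 2 * σ - √2 * x := by linarith
    have h3 : 2 - √2 * x / σ = (2 * σ - √2 * x) / σ := by field_simp
    rw [h3]; field_simp
  rw [h2]
  gcongr
  rw [le_div_iff₀ (by linarith)]
  linarith

end beta

/-! ### The cone condition along the iterates -/

section gammaZero
open Matrix
variable {n₁ n₂ r : ℕ}

lemma firstCols_transpose_mul {n : ℕ} {U : Matrix (Fin n) (Fin n) ℝ}
    (hU : U ∈ Matrix.orthogonalGroup (Fin n) ℝ) (hr : r ≤ n) :
    (firstCols r U)ᵀ * firstCols r U = 1 := by
  have h := (Matrix.mem_orthogonalGroup_iff' (Fin n) ℝ).1 hU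
  ext i j
  have h1 := congrFun (congrFun h (Fin.castLE hr i)) (Fin.castLE hr j)
  simp only [Matrix.mul_apply, Matrix.transpose_apply, firstCols,
    Matrix.of_apply] at h1 ⊢
  rw [Matrix.one_apply] at h1 ⊢
  simp only [Fin.castLE_inj] at h1
  rw [← h1]
  refine Finset.sum_congr rfl fun k _ => ?_
  rw [dif_pos (i.2.trans_le hr), dif_pos (j.2.trans_le hr)]
  rfl

/-- The start value `γ₀` for `W = 0`. -/
lemma gammaOf_zero {U : Matrix (Fin n₁) (Fin n₁) ℝ} {V : Matrix (Fin n₂) (Fin n₂) ℝ}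
    (hU : U ∈ Matrix.orthogonalGroup (Fin n₁) ℝ) (hV : V ∈ Matrix.orthogonalGroup (Fin n₂) ℝ)
    (hr1 : r ≤ n₁) (hr2 : r ≤ n₂) (hr0 : 0 < r) :
    gammaOf (firstCols r U) (firstCols r V) 0 = 1 / √2 := by
  have hU1 := firstCols_transpose_mul hU hr1
  have hV1 := firstCols_transpose_mul hV hr2
  generalize firstCols r U = P at hU1 ⊢
  generalize firstCols r V = Q at hV1 ⊢
  have h1 : projT P Q (0 - P * Qᵀ) = -(P * Qᵀ) := by
    have e1 : P * Pᵀ * (P * Qᵀ) = P * Qᵀ := by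
      rw [Matrix.mul_assoc, ← Matrix.mul_assoc Pᵀ, hU1, Matrix.one_mul]
    have e2 : P * Qᵀ * (Q * Qᵀ) = P * Qᵀ := by
      rw [Matrix.mul_assoc, ← Matrix.mul_assoc Qᵀ, hV1, Matrix.one_mul]
    rw [projT, zero_sub, Matrix.mul_neg, Matrix.neg_mul, Matrix.neg_mul, e1, e2]
    abel
  have h2 : projTperp P Q (0 : Matrix (Fin n₁) (Fin n₂) ℝ) = 0 := by simp [projTperp, projT]
  have h3 : specNorm (0 : Matrix (Fin n₁) (Fin n₂) ℝ) = 0 := by simp [specNorm]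
  have h4 : frobNorm (P * Qᵀ) = √r := by
    rw [frobNorm]
    congr 1
    rw [traceInner, Matrix.transpose_mul, Matrix.transpose_transpose, Matrix.mul_assoc,
      ← Matrix.mul_assoc Pᵀ, hU1, Matrix.one_mul, Matrix.trace_mul_comm, hV1, Matrix.trace_one,
      Fintype.card_fin]
  have hr' : (0 : ℝ) < √r := Real.sqrt_pos.2 (by exact_mod_cast hr0)
  rw [gammaOf, h1, h2, h3, frobNorm_neg, h4, Real.sqrt_mul (by norm_num)]
  field_simp
  norm_num

end gammaZero

section iterates
open Matrix
variable {m n₁ n₂ r : ℕ} {A : Fin m → Matrix (Fin n₁) (Fin n₂) ℝ}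
  {Xbar : Matrix (Fin n₁) (Fin n₂) ℝ} {ξ b : EuclideanSpace ℝ (Fin m)} {δ : ℝ}
  {Ω : Set (Matrix (Fin n₁) (Fin n₂) ℝ)} {φ : ℝ → EReal} {ρ μ : ℕ → ℝ}
  {X W : ℕ → Matrix (Fin n₁) (Fin n₂) ℝ} {p : Fin n₁ → Fin n₁ → ℝ} {q : Fin n₁ → Fin n₂ → ℝ}

lemma mem_feasible (hξ : ‖ξ‖ ≤ δ) (hb : b = sample A Xbar + ξ) (hXΩ : Xbar ∈ Ω) :
    Xbar ∈ feasible A b δ Ω := by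
  refine ⟨?_, hXΩ⟩
  rw [hb, sub_add_cancel_left, norm_neg]
  exact hξ

/-- Two feasible points, one of them `Xbar`, differ by at most `2 δ` after sampling. -/
lemma norm_sample_sub_le (hξ : ‖ξ‖ ≤ δ) (hb : b = sample A Xbar + ξ)
    {Y : Matrix (Fin n₁) (Fin n₂) ℝ} (hY : Y ∈ feasible A b δ Ω) :
    ‖sample A (Y - Xbar)‖ ≤ 2 * δ := by
  have h1 : sample A (Y - Xbar) = (sample A Y - b) + ξ := by
    rw [sample_sub, hb]; abel
  rw [h1]
  refine (norm_add_le _ _).trans ?_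
  have := hY.1
  linarith

/-- The closed form of `W (k + 1)`, in terms of singular vectors of `X (k + 1)`. -/
lemma IsMultiStage.exists_family (hn : n₁ ≤ n₂) (hXW : IsMultiStage A b δ Ω φ ρ μ X W) (k : ℕ) :
    ∃ u v w, SingFam (X (k + 1)) (singVal (X (k + 1))) u v ∧ W (k + 1) = tensorSum w u v ∧
      ∀ i : Fin n₁, w i ∈ psiConjSubdiff φ (ρ (k + 1) * singVal (X (k + 1)) i) := by
  obtain ⟨U, V, w, h1, h2, h3⟩ := hXW.W_form k
  exact ⟨_, _, w, h1.singFam hn, by rw [h2, mul_rectDiag_mul_transpose hn], h3⟩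

/-- Optimality of `X (k + 1)`, tested at `Xbar`. -/
lemma IsMultiStage.exists_certificate (hn : n₁ ≤ n₂) (hXW : IsMultiStage A b δ Ω φ ρ μ X W)
    (hfeas : Xbar ∈ feasible A b δ Ω) (hXb : SingFam Xbar (singVal Xbar) p q)
    (hr : Xbar.rank ≤ r) (k : ℕ) :
    ∃ s x y, PartSVD (perpPart r p q (X (k + 1) - Xbar)) s x y ∧
      traceInner (lead r p q) (X (k + 1) - Xbar) + ∑ j, s j
        ≤ traceInner (W k) (X (k + 1) - Xbar) := by
  obtain ⟨u, v, -, hfam, -⟩ := hXW.exists_family hn k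
  obtain ⟨s, x, y, hs⟩ := exists_partSVD (perpPart r p q (X (k + 1) - Xbar))
  refine ⟨s, x, y, hs, ?_⟩
  have h1 := sum_singular_sub_ge hfam hXb
    (fun i hi => (singVal_eq_zero_iff Xbar i).2 (hr.trans hi)) hs
  have h2 := isMinOn_iff.1 (hXW.X_min k) Xbar hfeas
  simp only [nuclearNorm] at h2
  rw [traceInner_sub_right (W k)]
  linarith

/-- The cone condition for the first iterate. -/
lemma IsMultiStage.cone_one (hn : n₁ ≤ n₂) (hXW : IsMultiStage A b δ Ω φ ρ μ X W)
    (hfeas : Xbar ∈ feasible A b δ Ω) (hXb : SingFam Xbar (singVal Xbar) p q)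
    (hr : Xbar.rank ≤ r) (hrn : r ≤ n₁) :
    ∃ s x y, PartSVD (perpPart r p q (X 1 - Xbar)) s x y ∧
      ∑ j, s j ≤ √(2 * r) * (1 / √2) * frobNorm (tanPart r p q (X 1 - Xbar)) := by
  obtain ⟨s, x, y, hs, hle⟩ := hXW.exists_certificate hn hfeas hXb hr 0
  refine ⟨s, x, y, hs, ?_⟩
  rw [hXW.W_zero, traceInner_zero_left, zero_add] at hle
  have h1 := traceInner_eq_tanPart (r := r) (lead r p q) (X 1 - Xbar) hXb.left hXb.right
  have h2 : perpPart r p q (lead r p q) = 0 := by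
    rw [perpPart, Matrix.sub_mul, lead_mul_lead hXb.left]; simp
  rw [← traceInner_perpPart, h2, traceInner_zero_left, add_zero, tanPart, h2, sub_zero] at h1
  have h3 := traceInner_le (-lead r p q) (tanPart r p q (X 1 - Xbar))
  have h4 : traceInner (-lead r p q) (tanPart r p q (X 1 - Xbar))
      = -traceInner (lead r p q) (tanPart r p q (X 1 - Xbar)) := by simp [traceInner]
  have h5 : frobNorm (lead r p q) = √r := by
    rw [← frobNorm_sq_lead hrn hXb.left hXb.right, Real.sqrt_sq (frobNorm_nonneg _)]
  have h6 : √(2 * (r : ℝ)) * (1 / √2) = √r := by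
    rw [Real.sqrt_mul (by norm_num)]; field_simp
  rw [frobNorm_neg, h5] at h3
  rw [h6]
  linarith

/-- The cone condition for the later iterates, in terms of the error of the previous one. -/
lemma IsMultiStage.cone_succ (hn : n₁ ≤ n₂) (hφ : IsPhi φ) (hXW : IsMultiStage A b δ Ω φ ρ μ X W)
    (hfeas : Xbar ∈ feasible A b δ Ω) (hXb : SingFam Xbar (singVal Xbar) p q)
    (hr : Xbar.rank = r) (hr0 : 0 < r) (hrn : r < n₁) {k : ℕ} (hρ : 0 ≤ ρ (k + 1))
    {σr a₁ b₁ β : ℝ} (hσr : σr = singVal Xbar (r - 1))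
    (he : √2 * frobNorm (X (k + 1) - Xbar) < σr)
    (ha : psiConjRight φ (ρ (k + 1) * frobNorm (X (k + 1) - Xbar)) ≤ a₁) (ha1 : a₁ ≤ 1)
    (hb : b₁ ≤ psiConjLeft φ (ρ (k + 1) * (σr - frobNorm (X (k + 1) - Xbar))))
    (hβ : betaTilde σr (frobNorm (X (k + 1) - Xbar)) ≤ β) :
    ∃ s x y, PartSVD (perpPart r p q (X (k + 2) - Xbar)) s x y ∧
      (∑ j, s j) * ((1 - a₁) * (1 - β ^ 2)) ≤
        (√r * (1 - b₁) + (√2 * a₁ + 1) * β) * frobNorm (tanPart r p q (X (k + 2) - Xbar)) := by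
  obtain ⟨u, v, w, hfam, hW, hw⟩ := hXW.exists_family hn k
  obtain ⟨s, x, y, hs, hle⟩ := hXW.exists_certificate hn hfeas hXb hr.le (k + 1)
  refine ⟨s, x, y, hs, ?_⟩
  rw [hW] at hle
  have he0 := frobNorm_nonneg (X (k + 1) - Xbar)
  have hσ0 : 0 < σr := lt_of_le_of_lt (by positivity) he
  have hzero : ∀ i, r ≤ i → singVal Xbar i = 0 := fun i hi =>
    (singVal_eq_zero_iff Xbar i).2 (hr.le.trans hi)
  refine cone_le hrn.le hfam.left hfam.right hXb.left hXb.right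
    ((psiConjRight_nonneg hφ _).trans ha) ha1 (hb.trans (psiConjLeft_le_one hφ _))
    (fun i => subdiff_nonneg hφ (hw i)) (fun i => subdiff_le_one hφ (hw i)) ?_ ?_ ?_ hs hle
  · intro i hi
    refine (subdiff_le_psiConjRight hφ (hw i) ?_).trans ha
    have h1 := hfam.abs_sub_le hXb i
    rw [hzero i hi, sub_zero] at h1
    exact mul_le_mul_of_nonneg_left ((le_abs_self _).trans h1) hρ
  · intro i hi
    refine hb.trans (psiConjLeft_le_subdiff hφ (hw i) (mul_le_mul_of_nonneg_left ?_ hρ))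
    have h1 := (abs_le.1 (hfam.abs_sub_le hXb i)).1
    have h2 : singVal Xbar (r - 1) ≤ singVal Xbar i := hXb.anti (by omega)
    linarith
  · refine le_trans (lead_bound_le_betaTilde hσ0 he0 he ?_) hβ
    have h1 := hfam.gap_le hXb hr0 hrn
    have h2 := hfam.lead_sub_le hXb hrn.le
    rw [hzero r le_rfl, sub_zero, ← hσr] at h1 h2
    refine le_trans (mul_le_mul_of_nonneg_right ?_ (frobNorm_nonneg _)) h2
    linarith

end iterates

/-! ### The scalar recursion -/

section recursion

/-- The step of the recursion: `K (1 + p) + F` bounds the previous error `e`, and `K (1 + p) + q F`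
will bound the next one. -/
lemma recursion_step {K Ξ₀ X p Q β₁ D F e βe q : ℝ} (hK : 0 < K) (hΞ : 0 < Ξ₀) (hD : 0 < D)
    (hKX : K * √(1 + X ^ 2) ≤ Ξ₀) (hX : X = p + Q * β₁) (hp : 0 ≤ p) (hQ : 0 ≤ Q) (hβ₁ : 0 ≤ β₁)
    (hF : 0 ≤ F) (he : e ≤ K * (1 + p) + F) (hβe1 : βe ≤ e / Ξ₀ * β₁) (hβe2 : βe ≤ e / D)
    (hKQ : K * Q ≤ q * D) :
    p + Q * βe + 1 ≤ (1 + p + q * F / K) * (1 + X / √(1 + X ^ 2)) := by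
  have hX0 : 0 ≤ X := by rw [hX]; positivity
  have hq : 0 ≤ q := by
    have : 0 ≤ q * D := le_trans (by positivity) hKQ
    exact nonneg_of_mul_nonneg_left this hD
  have h1 : βe ≤ K * (1 + p) * (β₁ / Ξ₀) + F * (1 / D) := by
    have hw : 0 ≤ K * (1 + p) := by positivity
    rcases le_total (β₁ / Ξ₀) (1 / D) with h | h
    · have e1 : e * (β₁ / Ξ₀) ≤ (K * (1 + p) + F) * (β₁ / Ξ₀) := by gcongr
      have e2 : F * (β₁ / Ξ₀) ≤ F * (1 / D) := by gcongr
      have e3 : e / Ξ₀ * β₁ = e * (β₁ / Ξ₀) := by ring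
      linarith
    · have e1 : e * (1 / D) ≤ (K * (1 + p) + F) * (1 / D) := by gcongr
      have e2 : K * (1 + p) * (1 / D) ≤ K * (1 + p) * (β₁ / Ξ₀) := by gcongr
      have e3 : e / D = e * (1 / D) := by ring
      linarith
  have h2 : Q * βe ≤ Q * (K * (1 + p) * (β₁ / Ξ₀)) + Q * (F * (1 / D)) := by
    rw [← mul_add]; gcongr
  have h3 : Q * (F * (1 / D)) ≤ q * F / K := by
    rw [le_div_iff₀ hK]
    have : Q * (F * (1 / D)) * K = K * Q * (F / D) := by ring
    rw [this]
    calc K * Q * (F / D) ≤ q * D * (F / D) := by gcongr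
      _ = q * F := by field_simp
  have h4 : Q * (K * (1 + p) * (β₁ / Ξ₀)) ≤ (1 + p) * (X / √(1 + X ^ 2)) := by
    have e1 : Q * β₁ ≤ X := by linarith
    have e2 : K / Ξ₀ ≤ 1 / √(1 + X ^ 2) := by
      rw [div_le_div_iff₀ hΞ (by positivity)]; linarith
    calc Q * (K * (1 + p) * (β₁ / Ξ₀)) = (1 + p) * ((Q * β₁) * (K / Ξ₀)) := by ring
      _ ≤ (1 + p) * (X * (1 / √(1 + X ^ 2))) := by gcongr
      _ = _ := by ring
  have h5 : 0 ≤ q * F / K * (X / √(1 + X ^ 2)) := by positivity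
  linarith

/-- `gammaStep` increases in `a` and `β` and decreases in `b`. -/
lemma gammaStep_mono {r : ℕ} {a a' b b' β β' : ℝ} (hr0 : 0 < r) (ha' : 0 ≤ a') (ha : a' ≤ a)
    (ha1 : a < 1) (hb : b ≤ b') (hb1 : b' ≤ 1) (hβ' : 0 ≤ β') (hβ : β' ≤ β) (hβ1 : β < 1) :
    gammaStep r a' b' β' ≤ gammaStep r a b β := by
  have hr : (0 : ℝ) < r := by exact_mod_cast hr0
  have h1 : 0 < 1 - a := by linarith
  have h2 : 0 < 1 - β ^ 2 := by nlinarith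
  have h3 : 0 ≤ 1 - b := by linarith
  have h4 : 0 ≤ a := ha'.trans ha
  have h5 : 0 ≤ β := hβ'.trans hβ
  have h6 : 0 ≤ √(2 * r) * (1 - a') := mul_nonneg (Real.sqrt_nonneg _) (by linarith)
  unfold gammaStep
  gcongr

lemma gammaStep_nonneg {r : ℕ} {a b β : ℝ} (ha : 0 ≤ a) (ha1 : a < 1) (hb1 : b ≤ 1) (hβ : 0 ≤ β)
    (hβ1 : β < 1) : 0 ≤ gammaStep r a b β := by
  have h1 : 0 < 1 - a := by linarith
  have h2 : 0 < 1 - β ^ 2 := by nlinarith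
  have h3 : 0 ≤ 1 - b := by linarith
  unfold gammaStep
  positivity

/-- The condition on `ρ₁` says that the cone parameter decreases in the first step. -/
lemma gammaStep_lt {r : ℕ} {a b β : ℝ} (hr0 : 0 < r) (ha : 0 ≤ a) (hb1 : b ≤ 1) (hβ : 0 ≤ β)
    (hβ1 : β < 1) (h : a < ((b - β ^ 2) * √r - β) / ((1 - β ^ 2) * √r + √2 * β)) :
    a < 1 ∧ gammaStep r a b β < 1 / √2 := by
  have hr : (0 : ℝ) < √r := Real.sqrt_pos.2 (by exact_mod_cast hr0)
  have h2 : 0 < 1 - β ^ 2 := by nlinarith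
  have h3 : 0 ≤ 1 - b := by linarith
  rw [lt_div_iff₀ (by positivity)] at h
  have h4 : √r * (1 - b) + (√2 * a + 1) * β < √r * (1 - β ^ 2) * (1 - a) := by linarith
  have h5 : 0 < √r * (1 - β ^ 2) * (1 - a) := lt_of_le_of_lt (by positivity) h4
  have h6 : 0 < 1 - a := by
    by_contra hc
    have : √r * (1 - β ^ 2) * (1 - a) ≤ 0 := mul_nonpos_of_nonneg_of_nonpos (by positivity)
      (not_lt.1 hc)
    linarith
  refine ⟨by linarith, ?_⟩
  rw [gammaStep, Real.sqrt_mul (by norm_num), div_lt_div_iff₀ (by positivity) (by positivity)]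
  have : (√r * (1 - b) + (√2 * a + 1) * β) * √2 < √r * (1 - β ^ 2) * (1 - a) * √2 := by gcongr
  linarith

end recursion

/-! ### The error bound function and the comparison sequence -/

section Xi
open Matrix
variable {m n₁ n₂ : ℕ} {A : Fin m → Matrix (Fin n₁) (Fin n₂) ℝ} {r s : ℕ} {δ c : ℝ}

lemma Xi_zero : Xi A δ c r s 0 = 2 * δ * √(thetaMax A (2 * r + s)) / thetaMin A (2 * r + s) := by
  simp [Xi]

/-- `Ξ` in terms of the rescaled parameter `√(r / (2 s)) t`. -/
lemma Xi_eq (t : ℝ) :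
    Xi A δ c r s t = Xi A δ c r s 0 / (1 - c * t) * √(1 + (√(r / (2 * s)) * t) ^ 2) := by
  rw [Xi_zero, Xi, mul_pow, Real.sq_sqrt (by positivity), mul_one_div]
  congr 3
  ring

lemma Xi_mono (hS : 0 ≤ Xi A δ c r s 0) (hc : 0 ≤ c) {t u : ℝ} (ht : 0 ≤ t) (htu : t ≤ u)
    (hu : c * u < 1) : Xi A δ c r s t ≤ Xi A δ c r s u := by
  rw [Xi_eq t, Xi_eq u]
  have h1 : 0 < 1 - c * u := by linarith
  have h2 : c * t ≤ c * u := by gcongr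
  gcongr

lemma Xi_pos (hS : 0 < Xi A δ c r s 0) {t : ℝ} (ht : c * t < 1) : 0 < Xi A δ c r s t := by
  rw [Xi_eq t]
  have h1 : 0 < 1 - c * t := by linarith
  positivity

lemma Xi_zero_pos (hδ : 0 < δ) (hs1 : 1 ≤ s) (hn : 0 < n₁)
    {p : Fin n₁ → Fin n₁ → ℝ} {q : Fin n₁ → Fin n₂ → ℝ} (hp : Orth p) (hq : Orth q)
    (hpos : 0 < thetaMin A (2 * r + 2 * s)) {Y : Matrix (Fin n₁) (Fin n₂) ℝ} (hY : Y ≠ 0)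
    (hYr : Y.rank ≤ 2 * r + s) : 0 < Xi A δ c r s 0 := by
  have h1 := hpos.trans_le (thetaMin_le_of_rank_le A (by omega : 2 * r + s ≤ 2 * r + 2 * s) hY hYr)
  have h2 := h1.trans_le (thetaMin_le_thetaMax_of_pos (s := 2 * r + s) (by omega) hn hp hq le_rfl)
  rw [Xi_zero]
  positivity

/-- The error bounds in terms of `Ξ` for a matrix that satisfies the cone condition with parameter
`γ`. -/
lemma error_le_Xi {p : Fin n₁ → Fin n₁ → ℝ} {q : Fin n₁ → Fin n₂ → ℝ}
    {Z : Matrix (Fin n₁) (Fin n₂) ℝ} {σ : Fin n₁ → ℝ} {x : Fin n₁ → Fin n₁ → ℝ}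
    {y : Fin n₁ → Fin n₂ → ℝ} {γ : ℝ} (hs1 : 1 ≤ s) (hr0 : 0 < r) (hr : r ≤ n₁) (hc : 0 ≤ c)
    (hpos : 0 < thetaMin A (2 * r + 2 * s))
    (hratio : thetaMax A s / thetaMin A (2 * r + 2 * s) ≤ 1 + 2 * c ^ 2 * s / r)
    (hp : Orth p) (hq : Orth q) (hZ : ‖sample A Z‖ ≤ 2 * δ) (hδ : 0 ≤ δ)
    (h : PartSVD (perpPart r p q Z) σ x y) (hγ : 0 ≤ γ)
    (hN : ∑ j, σ j ≤ √(2 * r) * γ * frobNorm (tanPart r p q Z)) :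
    (c * γ < 1 → frobNorm Z ≤ Xi A δ c r s γ) ∧
    ∀ γ₁ k X : ℝ, γ ≤ γ₁ → c * γ₁ < 1 → 1 ≤ k → X = √(r / (2 * s)) * γ₁ →
      √(r / (2 * s)) * γ + 1 ≤ k * (1 + X / √(1 + X ^ 2)) →
      frobNorm Z ≤ k * (Xi A δ c r s 0 / (1 - c * γ₁)) := by
  have hrR : (0 : ℝ) < r := by exact_mod_cast hr0
  have hsR : (0 : ℝ) < s := by exact_mod_cast hs1
  have hκγ : ∀ t, c * √(2 * s / r) * (√(r / (2 * s)) * t) = c * t := by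
    intro t
    have h1 : √(2 * (s : ℝ) / r) * √(r / (2 * s)) = 1 := by
      rw [← Real.sqrt_mul (by positivity), div_mul_div_comm, mul_comm (r : ℝ),
        div_self (by positivity), Real.sqrt_one]
    calc c * √(2 * s / r) * (√(r / (2 * s)) * t)
        = c * (√(2 * s / r) * √(r / (2 * s))) * t := by ring
      _ = c * t := by rw [h1, mul_one]
  have hratio' : thetaMax A s ≤ (1 + (c * √(2 * s / r)) ^ 2) * thetaMin A (2 * r + 2 * s) := by
    rw [div_le_iff₀ hpos] at hratio
    rw [mul_pow, Real.sq_sqrt (by positivity)]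
    have : c ^ 2 * (2 * (s : ℝ) / r) = 2 * c ^ 2 * s / r := by ring
    rwa [this]
  obtain ⟨h1, h2⟩ := error_bounds hs1 hr0 hr hpos (κ := c * √(2 * s / r)) (by positivity) hratio'
    hp hq hZ hδ h hγ hN (S := Xi A δ c r s 0) Xi_zero rfl
  rw [hκγ] at h1
  constructor
  · intro hcγ
    have h3 : 0 < 1 - c * γ := by linarith
    rw [Xi_eq, div_mul_eq_mul_div, le_div_iff₀ h3]
    exact h1 hcγ
  · intro γ₁ k X hγ₁ hcγ hk hX hle
    have h3 : 0 < 1 - c * γ₁ := by linarith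
    rw [← mul_div_assoc, le_div_iff₀ h3]
    have h4 := h2 X k (by rw [hX]; gcongr) (by rwa [hX, hκγ]) hk hle
    rwa [hX, hκγ] at h4

end Xi

section comparison
variable {Ξ : ℝ → ℝ} {φ : ℝ → EReal} {r : ℕ} {σr γ₀ : ℝ} {ρ μ γt : ℕ → ℝ}

/-- The comparison sequence decreases, the parameters `ρ` increase, and `ρ (k + 1) * Ξ (γt k)`
decreases. -/
lemma gammaTilde_antitone (hφ : IsPhi φ) (hr0 : 0 < r)
    (hΞm : ∀ t u, 0 ≤ t → t ≤ u → u ≤ γ₀ → Ξ t ≤ Ξ u) (hΞp : ∀ t, 0 ≤ t → t ≤ γ₀ → 0 < Ξ t)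
    (hγ₀ : 0 ≤ γ₀) (hσ : 2 * Ξ γ₀ < σr) (hρ1 : 0 < ρ 1)
    (hρ : ∀ k, ρ (k + 2) = μ (k + 2) * ρ (k + 1))
    (hγt : γt = gammaTilde Ξ φ r σr ρ γ₀)
    (hμ : ∀ k, μ (k + 2) ∈ Icc 1 (Ξ (γt k) / Ξ (γt (k + 1))))
    (ha : aTilde φ (ρ 1) (Ξ γ₀) < 1) (h1 : γt 1 ≤ γ₀) (k : ℕ) :
    0 ≤ γt (k + 1) ∧ γt (k + 1) ≤ γt k ∧ γt (k + 1) ≤ γt 1 ∧ 0 ≤ γt k ∧ γt k ≤ γ₀ ∧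
      ρ 1 ≤ ρ (k + 1) ∧ ρ (k + 1) * Ξ (γt k) ≤ ρ 1 * Ξ γ₀ := by
  have hstep : ∀ k, γt (k + 1) = gammaStep r (aTilde φ (ρ (k + 1)) (Ξ (γt k)))
      (bTilde φ σr (ρ (k + 1)) (Ξ (γt k))) (betaTilde σr (Ξ (γt k))) := by
    intro k
    rw [hγt]
    rfl
  have hΞ₀ : 0 < Ξ γ₀ := hΞp γ₀ hγ₀ le_rfl
  have hσ0 : 0 < σr := by linarith
  have hsqrt : √2 ≤ (2 : ℝ) := by
    rw [Real.sqrt_le_left (by norm_num)]; norm_num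
  -- bounds on the ingredients of a step that starts from a value in `[0, γ₀]`
  have hβ : ∀ t, 0 ≤ t → t ≤ γ₀ → 2 * Ξ t < σr ∧ √2 * Ξ t < σr := by
    intro t ht ht'
    have e1 := hΞm t γ₀ ht ht' le_rfl
    have e2 := hΞp t ht ht'
    refine ⟨by linarith, lt_of_le_of_lt ?_ hσ⟩
    gcongr
  have hnn : ∀ k, 0 ≤ γt k → γt k ≤ γ₀ → ρ (k + 1) * Ξ (γt k) ≤ ρ 1 * Ξ γ₀ →
      0 ≤ γt (k + 1) := by
    intro k h0 h1 h2
    rw [hstep]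
    obtain ⟨e1, e2⟩ := hβ _ h0 h1
    exact gammaStep_nonneg (psiConjRight_nonneg hφ _)
      (lt_of_le_of_lt (psiConjRight_mono hφ h2) ha) (psiConjLeft_le_one hφ _)
      (betaTilde_nonneg hσ0 (hΞp _ h0 h1).le e2) (betaTilde_lt_one hσ0 e1)
  have h00 : γt 0 = γ₀ := by rw [hγt]; rfl
  induction k with
  | zero =>
    have h2 : ρ (0 + 1) * Ξ (γt 0) ≤ ρ 1 * Ξ γ₀ := by rw [h00]
    have h3 := hnn 0 (by rw [h00]; exact hγ₀) h00.le h2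
    refine ⟨h3, ?_, le_rfl, ?_, h00.le, le_rfl, h2⟩
    · rw [h00]; exact h1
    · rw [h00]; exact hγ₀
  | succ k ih =>
    obtain ⟨i1, i2, i2', i3, i4, i5, i6⟩ := ih
    have hk1 : γt (k + 1) ≤ γ₀ := i2.trans i4
    have hp1 := hΞp _ i1 hk1
    have hp0 := hΞp _ i3 i4
    have hm := hΞm _ _ i1 i2 i4
    have hρk : 0 < ρ (k + 1) := hρ1.trans_le i5
    have hρle : ρ (k + 1) ≤ ρ (k + 2) := by
      rw [hρ k]
      exact le_mul_of_one_le_left hρk.le (hμ k).1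
    have hρΞ : ρ (k + 2) * Ξ (γt (k + 1)) ≤ ρ (k + 1) * Ξ (γt k) := by
      have e1 := (le_div_iff₀ hp1).1 (hμ k).2
      calc ρ (k + 2) * Ξ (γt (k + 1)) = ρ (k + 1) * (μ (k + 2) * Ξ (γt (k + 1))) := by
            rw [hρ k]; ring
        _ ≤ ρ (k + 1) * Ξ (γt k) := by gcongr
    have hle := hρΞ.trans i6
    obtain ⟨e1, e2⟩ := hβ _ i1 hk1
    obtain ⟨e3, e4⟩ := hβ _ i3 i4
    have hdec : γt (k + 2) ≤ γt (k + 1) := by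
      refine (hstep (k + 1)).trans_le (le_of_le_of_eq ?_ (hstep k).symm)
      refine gammaStep_mono hr0 (psiConjRight_nonneg hφ _) (psiConjRight_mono hφ hρΞ)
        (lt_of_le_of_lt (psiConjRight_mono hφ i6) ha) (psiConjLeft_mono hφ ?_)
        (psiConjLeft_le_one hφ _) (betaTilde_nonneg hσ0 hp1.le e2) (betaTilde_mono hσ0 hm e4)
        (betaTilde_lt_one hσ0 e3)
      exact mul_le_mul hρle (by linarith) (by linarith) (by linarith)
    exact ⟨hnn (k + 1) i1 hk1 hle, hdec, hdec.trans i2', i1, hk1, i5.trans hρle, hle⟩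

end comparison

/-! ### The error recursion -/

section main
open Matrix
variable {m n₁ n₂ r : ℕ} {A : Fin m → Matrix (Fin n₁) (Fin n₂) ℝ}
  {Xbar : Matrix (Fin n₁) (Fin n₂) ℝ} {b : EuclideanSpace ℝ (Fin m)} {δ : ℝ}
  {Ω : Set (Matrix (Fin n₁) (Fin n₂) ℝ)} {φ : ℝ → EReal} {ρ μ : ℕ → ℝ}
  {X W : ℕ → Matrix (Fin n₁) (Fin n₂) ℝ} {p : Fin n₁ → Fin n₁ → ℝ} {q : Fin n₁ → Fin n₂ → ℝ}

/-- The cone condition after a stage whose error `e` is at most `x`. The numbers `a`, `b` may be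
taken at any earlier stage of the comparison, with parameter `ρ₁` and error bound `y`; in the
numerator `β̃` is evaluated at the actual error `e`, which makes the cone parameter of the next
iterate small when `e` is. -/
lemma IsMultiStage.cone_succ_param (hn : n₁ ≤ n₂) (hφ : IsPhi φ)
    (hXW : IsMultiStage A b δ Ω φ ρ μ X W)
    (hfeas : Xbar ∈ feasible A b δ Ω) (hXb : SingFam Xbar (singVal Xbar) p q)
    (hr : Xbar.rank = r) (hr0 : 0 < r) (hrn : r < n₁) {k : ℕ}
    {σr x ρ₁ y β₁ : ℝ} (hσr : σr = singVal Xbar (r - 1)) (hx : 2 * x < σr)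
    (hex : frobNorm (X (k + 1) - Xbar) ≤ x) (hρ₁ : 0 ≤ ρ₁) (hρ : ρ₁ ≤ ρ (k + 1))
    (hρy : ρ (k + 1) * x ≤ ρ₁ * y) (hxy : x ≤ y) (ha1 : aTilde φ ρ₁ y < 1)
    (hβ1 : betaTilde σr x ≤ β₁) (hβ₁ : β₁ < 1) :
    ∃ s u v, PartSVD (perpPart r p q (X (k + 2) - Xbar)) s u v ∧
      ∑ j, s j ≤ √(2 * r) * ((√r * (1 - bTilde φ σr ρ₁ y) + (√2 * aTilde φ ρ₁ y + 1) *
        betaTilde σr (frobNorm (X (k + 1) - Xbar))) /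
          (√(2 * r) * (1 - aTilde φ ρ₁ y) * (1 - β₁ ^ 2))) *
        frobNorm (tanPart r p q (X (k + 2) - Xbar)) := by
  have hrR : (0 : ℝ) < r := by exact_mod_cast hr0
  set e := frobNorm (X (k + 1) - Xbar) with he
  have he0 : 0 ≤ e := frobNorm_nonneg _
  have hsqrt : √2 ≤ (2 : ℝ) := by
    rw [Real.sqrt_le_left (by norm_num)]; norm_num
  have hx0 : 0 ≤ x := he0.trans hex
  have hσ0 : 0 < σr := by linarith
  have hx2 : √2 * x < σr := lt_of_le_of_lt (by gcongr) hx
  have he2 : √2 * e < σr := lt_of_le_of_lt (by gcongr) hx2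
  have hβe : betaTilde σr e ≤ β₁ := (betaTilde_mono hσ0 hex hx2).trans hβ1
  have hβe0 := betaTilde_nonneg hσ0 he0 he2
  have hρ0 : 0 ≤ ρ (k + 1) := hρ₁.trans hρ
  have ha : psiConjRight φ (ρ (k + 1) * e) ≤ aTilde φ ρ₁ y :=
    psiConjRight_mono hφ ((mul_le_mul_of_nonneg_left hex hρ0).trans hρy)
  have hb : bTilde φ σr ρ₁ y ≤ psiConjLeft φ (ρ (k + 1) * (σr - e)) :=
    psiConjLeft_mono hφ <|
      (mul_le_mul_of_nonneg_left (by linarith : σr - y ≤ σr - x) hρ₁).trans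
        (mul_le_mul hρ (by linarith) (by linarith) hρ0)
  obtain ⟨s, u, v, h1, h2⟩ :=
    hXW.cone_succ hn hφ hfeas hXb hr hr0 hrn hρ0 hσr he2 ha ha1.le hb le_rfl
  refine ⟨s, u, v, h1, ?_⟩
  have ha0 : 0 < 1 - aTilde φ ρ₁ y := by linarith
  have hβ0 : 0 < 1 - β₁ ^ 2 := by nlinarith
  have hN : 0 ≤ ∑ j, s j := Finset.sum_nonneg fun j _ => h1.nonneg j
  have h3 : (∑ j, s j) * ((1 - aTilde φ ρ₁ y) * (1 - β₁ ^ 2)) ≤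
      (∑ j, s j) * ((1 - aTilde φ ρ₁ y) * (1 - betaTilde σr e ^ 2)) := by gcongr
  have h4 := h3.trans h2
  rw [← le_div_iff₀ (mul_pos ha0 hβ0)] at h4
  refine h4.trans_eq ?_
  rw [← he]
  have : 0 < √(2 * (r : ℝ)) := by positivity
  generalize √(2 * (r : ℝ)) = w at *
  field_simp

end main

lemma one_sub_sq_pos {β : ℝ} (h0 : 0 ≤ β) (h1 : β < 1) : 0 < 1 - β ^ 2 := by nlinarith

/-- The cone parameter, rescaled by `√(r / (2 s))`. -/
lemma scaled_param {r s a b β₁ : ℝ} (hr : 0 < r) (hs : 0 < s) (ha : 0 < 1 - a)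
    (hβ : 0 < 1 - β₁ ^ 2) (β : ℝ) :
    √(r / (2 * s)) * ((√r * (1 - b) + (√2 * a + 1) * β) / (√(2 * r) * (1 - a) * (1 - β₁ ^ 2))) =
      (1 - b) * √r / (2 * (1 - a) * (1 - β₁ ^ 2) * √s) +
        (√2 * a + 1) / (2 * (1 - a) * (1 - β₁ ^ 2) * √s) * β := by
  have h1 : √(r / (2 * s)) = √(2 * r) / (2 * √s) := by
    rw [Real.sqrt_eq_iff_mul_self_eq (by positivity) (by positivity), div_mul_div_comm,
      Real.mul_self_sqrt (by positivity), mul_mul_mul_comm, Real.mul_self_sqrt hs.le]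
    field_simp
  have h2 : 0 < √(2 * r) := by positivity
  rw [h1]
  generalize √(2 * r) = w at *
  field_simp

/-- The factor `√(r + 4 s)` in `α` comes from the value of `Ξ` at `1 / √2`. -/
lemma sqrt_one_add_sq_scaled {r s : ℝ} (hr : 0 < r) (hs : 0 < s) :
    √(1 + (√(r / (2 * s)) * (1 / √2)) ^ 2) = √(r + 4 * s) / (2 * √s) := by
  rw [Real.sqrt_eq_iff_mul_self_eq (by positivity) (by positivity), div_mul_div_comm,
    Real.mul_self_sqrt (by positivity), mul_mul_mul_comm, Real.mul_self_sqrt hs.le, mul_pow,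
    Real.sq_sqrt (by positivity), div_pow, Real.sq_sqrt (by norm_num)]
  field_simp
  ring

/-- The ratio of the geometric term lies in `[0, 1)`. -/
lemma ratio_mem {α x σ : ℝ} (hα : 0 ≤ α) (hx : 0 < x) (hσ : max 2 (√2 + α) * x < σ) :
    0 < σ - √2 * x ∧ 0 ≤ α * x / (σ - √2 * x) ∧ α * x / (σ - √2 * x) < 1 := by
  have h1 : (√2 + α) * x ≤ max 2 (√2 + α) * x := by gcongr; exact le_max_right _ _
  have h2 : 0 < σ - √2 * x := by nlinarith
  refine ⟨h2, by positivity, ?_⟩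
  rw [div_lt_one h2]
  linarith

end MultiStage

set_option maxHeartbeats 400000 in
open MultiStage in
theorem theorem4p2
    {m n₁ n₂ : ℕ} (hn : n₁ ≤ n₂)
    -- the measurement model `b = 𝒜 X̄ + ξ`, `‖ξ‖ ≤ δ`, and the structure set `Ω`
    (A : Fin m → Matrix (Fin n₁) (Fin n₂) ℝ)
    (Xbar : Matrix (Fin n₁) (Fin n₂) ℝ) (ξ b : EuclideanSpace ℝ (Fin m)) (δ : ℝ)
    (hδ : 0 < δ) (hξ : ‖ξ‖ ≤ δ) (hb : b = MultiStage.sample A Xbar + ξ)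
    (Ω : Set (Matrix (Fin n₁) (Fin n₂) ℝ)) (hΩc : IsCompact Ω) (hΩ : Convex ℝ Ω)
    (hXΩ : Xbar ∈ Ω)
    -- the rank, the smallest nonzero singular value and an SVD of `X̄`
    (r : ℕ) (hr : Xbar.rank = r) (hr0 : 0 < r)
    (σr : ℝ) (hσr : σr = MultiStage.singVal Xbar (r - 1))
    (Ubar : Matrix (Fin n₁) (Fin n₁) ℝ) (Vbar : Matrix (Fin n₂) (Fin n₂) ℝ)
    (hSVD : MultiStage.IsSVD Xbar Ubar Vbar)
    -- the restricted eigenvalue assumption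
    (c : ℝ) (hc0 : 0 ≤ c) (hc : c < Real.sqrt 2)
    (s : ℕ) (hs1 : 1 ≤ s) (hs : 2 * r + 2 * s ≤ n₁)
    (hpos : 0 < MultiStage.thetaMin A (2 * r + 2 * s))
    (hratio : MultiStage.thetaMax A s / MultiStage.thetaMin A (2 * r + 2 * s)
      ≤ 1 + 2 * c ^ 2 * s / r)
    -- the iterates of the algorithm
    (φ : ℝ → EReal) (hφ : MultiStage.IsPhi φ) (ρ μ : ℕ → ℝ)
    (X W : ℕ → Matrix (Fin n₁) (Fin n₂) ℝ)
    (hXW : MultiStage.IsMultiStage A b δ Ω φ ρ μ X W)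
    -- the quantities that appear in the bound
    (Ξ : ℝ → ℝ) (hΞ : Ξ = MultiStage.Xi A δ c r s)
    (γ₀ : ℝ)
    (hγ₀ : γ₀ = MultiStage.gammaOf (MultiStage.firstCols r Ubar) (MultiStage.firstCols r Vbar) (W 0))
    (γt : ℕ → ℝ) (hγt : γt = MultiStage.gammaTilde Ξ φ r σr ρ γ₀)
    (a₁ b₁ β₁ α : ℝ)
    (ha₁ : a₁ = MultiStage.aTilde φ (ρ 1) (Ξ (γt 0)))
    (hb₁ : b₁ = MultiStage.bTilde φ σr (ρ 1) (Ξ (γt 0)))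
    (hβ₁ : β₁ = MultiStage.betaTilde σr (Ξ (γt 0)))
    (hα : α = (1 + Real.sqrt 2 * a₁) /
      ((1 - a₁) * (1 - β₁ ^ 2) * Real.sqrt ((r : ℝ) + 4 * s)))
    -- the condition on the smallest nonzero singular value, and the choice of `ρ₁` and `μ_k`
    (hσ : max 2 (Real.sqrt 2 + α) * Ξ γ₀ < σr)
    (hρ₁ : a₁ < ((b₁ - β₁ ^ 2) * Real.sqrt r - β₁) /
      ((1 - β₁ ^ 2) * Real.sqrt r + Real.sqrt 2 * β₁))
    (hμ : ∀ k, μ (k + 2) ∈ Set.Icc 1 (Ξ (γt k) / Ξ (γt (k + 1)))) :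
    (0 ≤ α * Ξ γ₀ / (σr - Real.sqrt 2 * Ξ γ₀) ∧
      α * Ξ γ₀ / (σr - Real.sqrt 2 * Ξ γ₀) < 1) ∧
    ∀ k, 1 ≤ k →
      MultiStage.frobNorm (X k - Xbar) ≤
        Ξ 0 / (1 - c * γt 1) *
          (1 + (1 - b₁) * Real.sqrt r / (2 * (1 - a₁) * (1 - β₁ ^ 2) * Real.sqrt s)) +
        (α * Ξ γ₀ / (σr - Real.sqrt 2 * Ξ γ₀)) ^ (k - 1) * MultiStage.frobNorm (X 1 - Xbar) := by
  have hXb := hSVD.singFam hn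
  have hfeas : Xbar ∈ feasible A b δ Ω := mem_feasible hξ hb hXΩ
  have hrn : r < n₁ := by omega
  have hrR : (0 : ℝ) < r := by exact_mod_cast hr0
  have hsR : (0 : ℝ) < s := by exact_mod_cast hs1
  have hXne : Xbar ≠ 0 := by
    rintro rfl
    rw [Matrix.rank_zero] at hr
    omega
  -- `Ξ` is positive and increasing on `[0, γ₀]`, where `c γ₀ < 1`
  have hS : 0 < Ξ 0 := by
    rw [hΞ]
    exact Xi_zero_pos hδ hs1 (by omega) hXb.left hXb.right hpos hXne (by omega)
  have hγ₀' : γ₀ = 1 / √2 := by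
    rw [hγ₀, hXW.W_zero]
    exact gammaOf_zero hSVD.1 hSVD.2.1 hrn.le (hrn.le.trans hn) hr0
  have hγ₀0 : 0 ≤ γ₀ := by rw [hγ₀']; positivity
  have hcγ : ∀ t, t ≤ γ₀ → c * t < 1 := by
    intro t ht
    have h1 : c * t ≤ c * (1 / √2) := by rw [← hγ₀']; gcongr
    have h2 : c * (1 / √2) < 1 := by
      rw [mul_one_div, div_lt_one (by positivity)]; exact hc
    linarith
  have hΞm : ∀ t u, 0 ≤ t → t ≤ u → u ≤ γ₀ → Ξ t ≤ Ξ u := by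
    intro t u ht htu hu
    rw [hΞ] at hS ⊢
    exact Xi_mono hS.le hc0 ht htu (hcγ u hu)
  have hΞp : ∀ t, 0 ≤ t → t ≤ γ₀ → 0 < Ξ t := by
    intro t _ ht
    rw [hΞ] at hS ⊢
    exact Xi_pos hS (hcγ t ht)
  have hΞ₀ := hΞp γ₀ hγ₀0 le_rfl
  have hσ2 : 2 * Ξ γ₀ < σr := lt_of_le_of_lt (by gcongr; exact le_max_left _ _) hσ
  have hσ0 : 0 < σr := by linarith
  have hsqrt : √2 ≤ (2 : ℝ) := by
    rw [Real.sqrt_le_left (by norm_num)]; norm_num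
  have hσs : √2 * Ξ γ₀ < σr := lt_of_le_of_lt (by gcongr) hσ2
  -- the first stage
  have h00 : γt 0 = γ₀ := by rw [hγt]; rfl
  have hγt1 : γt 1 = gammaStep r a₁ b₁ β₁ := by rw [ha₁, hb₁, hβ₁, hγt]; rfl
  rw [h00] at ha₁ hb₁ hβ₁
  have ha0 : 0 ≤ a₁ := by rw [ha₁]; exact psiConjRight_nonneg hφ _
  have hb1 : b₁ ≤ 1 := by rw [hb₁]; exact psiConjLeft_le_one hφ _
  have hβ0 : 0 ≤ β₁ := by rw [hβ₁]; exact betaTilde_nonneg hσ0 hΞ₀.le hσs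
  have hβ1 : β₁ < 1 := by rw [hβ₁]; exact betaTilde_lt_one hσ0 hσ2
  obtain ⟨ha1, hγlt⟩ := gammaStep_lt hr0 ha0 hb1 hβ0 hβ1 hρ₁
  rw [← hγt1, ← hγ₀'] at hγlt
  have h1a : 0 < 1 - a₁ := by linarith
  have h1b : 0 ≤ 1 - b₁ := by linarith
  have h1β := one_sub_sq_pos hβ0 hβ1
  have hα0 : 0 ≤ α := by rw [hα]; positivity
  obtain ⟨hD, hq0, hq1⟩ := ratio_mem hα0 hΞ₀ hσ
  refine ⟨⟨hq0, hq1⟩, ?_⟩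
  have hcomp := gammaTilde_antitone hφ hr0 hΞm hΞp hγ₀0 hσ2 hXW.rho_one hXW.rho_succ hγt hμ
    (by rw [← ha₁]; exact ha1) hγlt.le
  have hbnd : ∀ k, ‖sample A (X (k + 1) - Xbar)‖ ≤ 2 * δ := fun k =>
    norm_sample_sub_le hξ hb (hXW.X_mem k)
  -- every error is at most `Ξ` at the comparison sequence
  have hcrude : ∀ k, frobNorm (X (k + 1) - Xbar) ≤ Ξ (γt k) := by
    intro k
    induction k with
    | zero =>
      obtain ⟨s', u, v, h1, h2⟩ := hXW.cone_one hn hfeas hXb hr.le hrn.le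
      rw [← hγ₀'] at h2
      rw [h00, hΞ]
      exact (error_le_Xi hs1 hr0 hrn.le hc0 hpos hratio hXb.left hXb.right (hbnd 0) hδ.le h1 hγ₀0
        h2).1 (hcγ _ le_rfl)
    | succ k ih =>
      obtain ⟨i1, i2, -, i3, i4, i5, i6⟩ := hcomp k
      have hx0 := hΞp _ i3 i4
      have hxσ : 2 * Ξ (γt k) < σr := by linarith [hΞm _ _ i3 i4 le_rfl]
      have hx2 : √2 * Ξ (γt k) < σr := lt_of_le_of_lt (by gcongr) hxσ
      have hak : aTilde φ (ρ (k + 1)) (Ξ (γt k)) < 1 := by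
        refine lt_of_le_of_lt (psiConjRight_mono hφ i6) ?_
        rw [ha₁] at ha1
        exact ha1
      obtain ⟨s', u, v, h1, h2⟩ := hXW.cone_succ_param hn hφ hfeas hXb hr hr0 hrn hσr hxσ ih
        (hXW.rho_one.le.trans i5) le_rfl le_rfl le_rfl hak le_rfl (betaTilde_lt_one hσ0 hxσ)
      rw [hΞ]
      refine (error_le_Xi hs1 hr0 hrn.le hc0 hpos hratio hXb.left hXb.right (hbnd (k + 1)) hδ.le h1
        i1 (h2.trans ?_)).1 (hcγ _ (i2.trans i4))
      have hstep : γt (k + 1) = gammaStep r (aTilde φ (ρ (k + 1)) (Ξ (γt k)))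
          (bTilde φ σr (ρ (k + 1)) (Ξ (γt k))) (betaTilde σr (Ξ (γt k))) := by rw [hγt]; rfl
      rw [hstep, gammaStep]
      have e1 : 0 ≤ aTilde φ (ρ (k + 1)) (Ξ (γt k)) := psiConjRight_nonneg hφ _
      have e2 : betaTilde σr (frobNorm (X (k + 1) - Xbar)) ≤ betaTilde σr (Ξ (γt k)) :=
        betaTilde_mono hσ0 ih hx2
      have e3 : 0 < 1 - aTilde φ (ρ (k + 1)) (Ξ (γt k)) := by linarith
      have e4 := one_sub_sq_pos (betaTilde_nonneg hσ0 hx0.le hx2) (betaTilde_lt_one hσ0 hxσ)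
      have e5 := frobNorm_nonneg (tanPart r (fun i k => Ubar k i) (fun i k => Vbar k (Fin.castLE hn i))
        (X (k + 2) - Xbar))
      gcongr
  -- the constants of the refined recursion
  obtain ⟨i1, -, -, -, -, -, -⟩ := hcomp 0
  rw [zero_add] at i1
  have hcγ1 := hcγ _ hγlt.le
  have h1c : 0 < 1 - c * γt 1 := by linarith
  obtain ⟨K, hK⟩ : ∃ K, K = Ξ 0 / (1 - c * γt 1) := ⟨_, rfl⟩
  obtain ⟨P, hP⟩ : ∃ P, P = (1 - b₁) * √r / (2 * (1 - a₁) * (1 - β₁ ^ 2) * √s) := ⟨_, rfl⟩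
  obtain ⟨Q, hQ⟩ : ∃ Q, Q = (√2 * a₁ + 1) / (2 * (1 - a₁) * (1 - β₁ ^ 2) * √s) := ⟨_, rfl⟩
  obtain ⟨x, hx⟩ : ∃ x, x = √(r / (2 * s)) * γt 1 := ⟨_, rfl⟩
  obtain ⟨q, hq⟩ : ∃ q, q = α * Ξ γ₀ / (σr - √2 * Ξ γ₀) := ⟨_, rfl⟩
  rw [← hq] at hq0 hq1
  rw [← hK, ← hP, ← hq]
  have hK0 : 0 < K := by rw [hK]; positivity
  have hP0 : 0 ≤ P := by rw [hP]; positivity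
  have hQ0 : 0 ≤ Q := by rw [hQ]; positivity
  have hx0 : 0 ≤ x := by rw [hx]; positivity
  have hKx : K * √(1 + x ^ 2) ≤ Ξ γ₀ := by
    refine le_of_eq_of_le ?_ (hΞm _ _ i1 hγlt.le le_rfl)
    rw [hK, hx, hΞ]
    exact (Xi_eq _).symm
  -- the cone parameter, rescaled
  have hscale := scaled_param (b := b₁) hrR hsR h1a h1β
  rw [← hP, ← hQ] at hscale
  have hxPQ : x = P + Q * β₁ := by rw [hx, hγt1, gammaStep, hscale]
  -- `Ξ γ₀ = S √(1 + r / (4 s)) / (1 - c γ₀)` dominates `K √(r + 4 s) / (2 √s)`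
  have hKQ : K * Q ≤ q * (σr - √2 * Ξ γ₀) := by
    rw [hq, div_mul_cancel₀ _ hD.ne']
    have h1 : K * √(1 + (√(r / (2 * s)) * γ₀) ^ 2) ≤ Ξ γ₀ := by
      rw [hK, hΞ, Xi_eq γ₀, ← hΞ]
      have h3 : 0 < 1 - c * γ₀ := by linarith [hcγ γ₀ le_rfl]
      gcongr
    rw [hγ₀', sqrt_one_add_sq_scaled hrR hsR, ← hγ₀'] at h1
    have h3 : 0 < √((r : ℝ) + 4 * s) := by positivity
    have h4 : K * Q = α * (K * (√(r + 4 * s) / (2 * √s))) := by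
      rw [hQ, hα]
      field_simp
      ring
    rw [h4]
    gcongr
  -- the refined recursion
  have hmain : ∀ k, frobNorm (X (k + 1) - Xbar) ≤
      K * (1 + P) + q ^ k * frobNorm (X 1 - Xbar) := by
    intro k
    induction k with
    | zero =>
      have : 0 ≤ K * (1 + P) := by positivity
      rw [zero_add, pow_zero, one_mul]
      linarith
    | succ k ih =>
      obtain ⟨-, i2, -, i3, i4, i5, i6⟩ := hcomp k
      have hxσ : 2 * Ξ (γt k) < σr := by linarith [hΞm _ _ i3 i4 le_rfl]
      have heΞ : frobNorm (X (k + 1) - Xbar) ≤ Ξ γ₀ := (hcrude k).trans (hΞm _ _ i3 i4 le_rfl)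
      have he0 := frobNorm_nonneg (X (k + 1) - Xbar)
      have hF : 0 ≤ q ^ k * frobNorm (X 1 - Xbar) :=
        mul_nonneg (pow_nonneg hq0 k) (frobNorm_nonneg _)
      have hβe := betaTilde_mono hσ0 heΞ hσs
      rw [← hβ₁] at hβe
      have hβe0 := betaTilde_nonneg hσ0 he0 (lt_of_le_of_lt (by gcongr) hσs)
      obtain ⟨s', u, v, h1, h2⟩ := hXW.cone_succ_param hn hφ hfeas hXb hr hr0 hrn hσr hxσ
        (hcrude k) hXW.rho_one.le i5 i6 (hΞm _ _ i3 i4 le_rfl) (by rw [← ha₁]; exact ha1)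
        (by rw [hβ₁]; exact betaTilde_mono hσ0 (hΞm _ _ i3 i4 le_rfl) hσs) hβ1
      rw [← ha₁, ← hb₁] at h2
      have hm := recursion_step hK0 hΞ₀ hD hKx hxPQ hP0 hQ0 hβ0 hF ih
        (by
          have := betaTilde_le_mul hσ0 he0 heΞ hΞ₀ hσs
          rwa [← hβ₁] at this)
        (betaTilde_le_div hσ0 he0 heΞ hσs) hKQ
      have h3 := (error_le_Xi hs1 hr0 hrn.le hc0 hpos hratio hXb.left hXb.right (hbnd (k + 1)) hδ.le
        h1 (by positivity) h2).2 (γt 1) (1 + P + q * (q ^ k * frobNorm (X 1 - Xbar)) / K) x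
        (by rw [hγt1, gammaStep]; gcongr) hcγ1
        (by
          have : 0 ≤ q * (q ^ k * frobNorm (X 1 - Xbar)) / K := by positivity
          linarith)
        hx (by rw [hscale]; exact hm)
      rw [← hΞ, ← hK] at h3
      refine h3.trans_eq ?_
      rw [add_mul, div_mul_cancel₀ _ hK0.ne', pow_succ]
      ring
  intro k hk
  obtain ⟨k, rfl⟩ := Nat.exists_eq_add_of_le' hk
  exact hmain k
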